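/- Let $K$ be an arbitrary field and let $\lambda\approx 1.5214$ be the real root of $t^3-t-2$. **Growth.** If an algebra $B$ is generated by a finite set $X$, let $\gamma_B(n)$ be the dimension of the span of all monomials in $X$ of length at most $n$, and put $$\operatorname{GKdim}B=\limsup_{n\to\infty}\frac{\ln\gamma_B(n)}{\ln n},\qquad \underline{\operatorname{GKdim}}\,B=\liminf_{n\to\infty}\frac{\ln\gamma_B(n)}{\ln n}.$$ **The associative hull $\mathbf A$.** Let $\Lambda=\Lambda(x_i\mid i\ge 0)$ be the Grassmann algebra over $K$, let $x_i$ also denote left multiplication by $x_i$, and let $\partial_i$ be the superderivation of $\Lambda$ with $\partial_i(x_j)=\delta_{ij}$. Put $$v_i=\partial_i+x_ix_{i+1}\bigl(\partial_{i+3}+x_{i+3}x_{i+4}(\partial_{i+6}+\cdots)\bigr)\in\operatorname{End}\Lambda ,\qquad i\ge 0$$ (the sum is finite on each element of $\Lambda$), and let $\mathbf A\subset\operatorname{End}\Lambda$ be the associative subalgebra (without unit) generated by $X=\{v_0,v_1,v_2\}$. **The Poisson superalgebra $\mathbf P$.** Let $\tilde H$ be the space of all formal, possibly infinite, $K$-linear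 combinations of the monomials $x^\alpha y^\beta$ in anticommuting letters $x_i,y_i$ ($i\ge0$) of square zero, where $\alpha,\beta$ are finite sets of indices with $\alpha=\emptyset$ or $\max\alpha<\max\beta$. With the Grassmann product and the bracket $$\{f,g\}=(-1)^{|f|-1}\sum_{i\ge 0}\Bigl(\frac{\partial f}{\partial x_i}\frac{\partial g}{\partial y_i}+\frac{\partial f}{\partial y_i}\frac{\partial g}{\partial x_i}\Bigr)$$ (so that $\{y_i,x_j\}=\delta_{ij}$, $\{x_i,x_j\}=\{y_i,y_j\}=0$) it is a unital Poisson superalgebra; if $\operatorname{char}K=2$ it also has the formal square on odd elements that vanishes on odd monomials and satisfies $(f+g)^{[2]}=f^{[2]}+\{f,g\}+g^{[2]}$, that is, $f^{[2]}=\sum_i\frac{\partial f}{\partial x_i}\frac{\partial f}{\partial y_i}$. Put $$V_i=y_i+x_ix_{i+1}\bigl(y_{i+3}+x_{i+3}x_{i+4}(y_{i+6}+\cdots)\bigr)\in\tilde H,\qquad i\ge 0,$$ and let $\mathbf P\subset\tilde H$ be the unital Poisson superalgebra generated by $X=\{V_0,V_1,V_2\}$, i.e. the smallest subspace containing $1,V_0,V_1,V_2$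 and closed under the product, the bracket and, if $\operatorname{char}K=2$, formal squares of odd elements. Its monomials are obtained from $1$ (length $0$) and $V_0,V_1,V_2$ (length $1$) by products and brackets (lengths add) and, if $\operatorname{char}K=2$, formal squares of odd monomials (the length doubles). **The Jordan superalgebra $\mathbf J$.** For $\operatorname{char}K\ne 2$ let $\mathbf J=\mathbf P\oplus\bar{\mathbf P}$ be the Kantor double of $\mathbf P$, with product $$a\bullet b=ab,\quad \bar a\bullet b=(-1)^{|b|}\overline{ab},\quad a\bullet\bar b=\overline{ab},\quad \bar a\bullet\bar b=(-1)^{|b|}\{a,b\}.$$ **Theorem.** Over any field $K$, $$\operatorname{GKdim}\mathbf P=\underline{\operatorname{GKdim}}\,\mathbf P=\operatorname{GKdim}\mathbf A=\underline{\operatorname{GKdim}}\,\mathbf A=2\log_\lambda 2\approx 3.3037 .$$ If $\operatorname{char}K\ne2$, then $\mathbf J$ is generated, as a unital algebra, by $X=\{V_0,V_1,V_2,\bar 1\}$, and also $$\operatorname{GKdim}\mathbf J=\underline{\operatorname{GKdim}}\,\mathbf J=2\log_\lambda 2 .$$ Here $\approx$ means equality after rounding to four decimal places. -/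

import Mathlib

noncomputable section

namespace FractalSuper

/-! ## Gelfand-Kirillov dimensions of a filtration by length of monomials -/

section Growth

variable {K M : Type*} [Field K] [AddCommGroup M] [Module K M]

/-- Upper Gelfand-Kirillov dimension `limsup ln γ(n) / ln n`, where `γ(n) = dim (F n)`. -/
def gkDim (F : ℕ → Submodule K M) : EReal :=
  Filter.limsup (fun n : ℕ =>
    ((Real.log (Module.finrank K (F n)) / Real.log n : ℝ) : EReal)) Filter.atTop

/-- Lower Gelfand-Kirillov dimension `liminf ln γ(n) / ln n`, where `γ(n) = dim (F n)`. -/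
def lowerGkDim (F : ℕ → Submodule K M) : EReal :=
  Filter.liminf (fun n : ℕ =>
    ((Real.log (Module.finrank K (F n)) / Real.log n : ℝ) : EReal)) Filter.atTop

end Growth

/-! ## The associative hull -/

section Hull

variable (K : Type*) [Field K]

/-- The Grassmann algebra in the variables `x_i`, `i ≥ 0`. -/
abbrev Lam : Type _ := ExteriorAlgebra K (ℕ →₀ K)

/-- The Grassmann variable `x_i`. -/
def gx (i : ℕ) : Lam K := ExteriorAlgebra.ι K (Finsupp.single i 1)

/-- The superderivation `∂_i` with `∂_i (x_j) = δ_ij`: contraction with the `i`-th coordinate. -/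
def pd (i : ℕ) : Module.End K (Lam K) :=
  CliffordAlgebra.contractLeft (Q := (0 : QuadraticForm K (ℕ →₀ K))) (Finsupp.lapply i)

/-- The product `(x_n x_{n+1}) (x_{n+3} x_{n+4}) ⋯ (x_{n+3l-3} x_{n+3l-2})`. -/
def tailProd (n : ℕ) : ℕ → Lam K
  | 0 => 1
  | l + 1 => tailProd n l * (gx K (n + 3 * l) * gx K (n + 3 * l + 1))

/-- An element of the Grassmann algebra involves finitely many variables. -/
theorem pd_support_finite (f : Lam K) : {i : ℕ | pd K i f ≠ 0}.Finite := by
  induction f using CliffordAlgebra.left_induction with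
  | algebraMap r =>
    convert Set.finite_empty (α := ℕ)
    ext i
    simp [pd, CliffordAlgebra.contractLeft_algebraMap]
  | add a b ha hb =>
    refine (ha.union hb).subset ?_
    intro i hi
    by_contra hcon
    simp only [Set.mem_union, Set.mem_ofPred_eq, not_or, not_not] at hcon
    exact hi (by rw [map_add, hcon.1, hcon.2, add_zero])
  | ι_mul a m ha =>
    refine (ha.union m.support.finite_toSet).subset ?_
    intro i hi
    by_contra hcon
    simp only [Set.mem_union, Set.mem_ofPred_eq, not_or, not_not, Finset.mem_coe,
      Finsupp.mem_support_iff] at hcon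
    apply hi
    have h1 := hcon.1
    simp only [pd] at h1 ⊢
    rw [CliffordAlgebra.contractLeft_ι_mul, h1]
    simp [hcon.2]

theorem pivot_support_finite (n : ℕ) (f : Lam K) :
    (Function.support fun l : ℕ => tailProd K n l * pd K (n + 3 * l) f).Finite := by
  have h := (pd_support_finite K f).preimage (f := fun l : ℕ => n + 3 * l)
    (fun a _ b _ hab => by simpa using hab)
  refine h.subset ?_
  intro l hl hz
  exact hl (by simp only [hz, mul_zero])

/-- The pivot element
`v_n = ∂_n + x_n x_{n+1} (∂_{n+3} + x_{n+3} x_{n+4} (∂_{n+6} + ⋯))`,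
an infinite sum of operators which is finite on each element of the Grassmann algebra. -/
def v (n : ℕ) : Module.End K (Lam K) where
  toFun f := ∑ᶠ l : ℕ, tailProd K n l * pd K (n + 3 * l) f
  map_add' f g := by
    rw [← finsum_add_distrib (pivot_support_finite K n f) (pivot_support_finite K n g)]
    exact finsum_congr fun l => by rw [map_add, mul_add]
  map_smul' c f := by
    rw [RingHom.id_apply, smul_finsum' c (pivot_support_finite K n f)]
    exact finsum_congr fun l => by rw [map_smul, mul_smul_comm]

/-- The generators `v_0, v_1, v_2`. -/
def hullGens : Set (Module.End K (Lam K)) := {v K 0, v K 1, v K 2}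

/-- The associative hull: the associative subalgebra (without unit) of `End Λ`
generated by `v_0, v_1, v_2`. -/
def assocHull : NonUnitalSubalgebra K (Module.End K (Lam K)) :=
  NonUnitalAlgebra.adjoin K (hullGens K)

/-- The span of all associative monomials of length at most `n` in `v_0, v_1, v_2`. -/
def hullFiltration (n : ℕ) : Submodule K (Module.End K (Lam K)) :=
  Submodule.span K {w | ∃ l : List (Module.End K (Lam K)),
    (∀ a ∈ l, a ∈ hullGens K) ∧ 1 ≤ l.length ∧ l.length ≤ n ∧ w = l.prod}

end Hull

/-! ## Formal Grassmann series

For a linearly ordered set `I` of anticommuting letters, a function `f : Finset I → K` stands for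
the formal sum of `f S • e_S` over all finite `S ⊆ I`, where `e_S` is the product of the letters
of `S` in increasing order. -/

section Series

variable {K I : Type*} [Field K] [LinearOrder I]

/-- The sign with `e_S e_T = sgn S T • e_{S ∪ T}`, for disjoint `S` and `T`. -/
def sgn (K : Type*) [Field K] (S T : Finset I) : K :=
  (-1) ^ ((S ×ˢ T).filter fun p => p.2 < p.1).card

/-- The Grassmann product of formal series. -/
def gmul (f g : Finset I → K) : Finset I → K := fun U =>
  ∑ S ∈ U.powerset, sgn K S (U \ S) * f S * g (U \ S)

/-- The (left) superderivation with respect to the letter `i`. -/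
def gder (i : I) (f : Finset I → K) : Finset I → K := fun S =>
  if i ∈ S then 0 else (-1) ^ (S.filter (· < i)).card * f (insert i S)

/-- The parity automorphism `f ↦ (-1)^|f| f`. -/
def gpar (f : Finset I → K) : Finset I → K := fun S => (-1) ^ S.card * f S

/-- `f` lies in the odd component. -/
def IsOddSeries (f : Finset I → K) : Prop := ∀ S, f S ≠ 0 → Odd S.card

/-- The unit. -/
def gone : Finset I → K := Pi.single ∅ 1

end Series

/-! ## The Poisson superalgebra -/

/-- The letters `x_i`, `y_i`, in the order `x_0 < x_1 < ⋯ < y_0 < y_1 < ⋯`. -/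
abbrev Letter : Type := ℕ ⊕ₗ ℕ

/-- The letter `x_i`. -/
def lx (i : ℕ) : Letter := toLex (Sum.inl i)

/-- The letter `y_i`. -/
def ly (i : ℕ) : Letter := toLex (Sum.inr i)

section Poisson

variable (K : Type*) [Field K]

/-- All formal series in the monomials `x^α y^β`. -/
abbrev Ser : Type _ := Finset Letter → K

/-- The completion of the Grassmann algebra on the letters `x_i`, `y_i`: all formal sums of
monomials `x^α y^β` with `max α < max β` (the condition being empty if `α = ∅`). -/
def Htilde : Submodule K (Ser K) where
  carrier := {f | ∀ S, f S ≠ 0 → ∀ i, lx i ∈ S → ∃ j, i < j ∧ ly j ∈ S}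
  zero_mem' := fun S h => (h rfl).elim
  add_mem' := by
    intro f g hf hg S h
    by_cases h1 : f S = 0
    · exact hg S fun h2 => h (by rw [Pi.add_apply, h1, h2, add_zero])
    · exact hf S h1
  smul_mem' := by
    intro c f hf S h
    exact hf S fun h1 => h (by rw [Pi.smul_apply, h1, smul_zero])

variable {K}

/-- The Poisson bracket determined by `{y_i, x_j} = δ_ij`, `{x_i, x_j} = {y_i, y_j} = 0`:
`{f, g} = (-1)^(|f| - 1) ∑_i (∂f/∂x_i ∂g/∂y_i + ∂f/∂y_i ∂g/∂x_i)`.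
Each coefficient is a finite sum for `f, g ∈ Htilde`, see `bracket_support_finite`. -/
def bracket (f g : Ser K) : Ser K := fun U =>
  -∑ᶠ i : ℕ, (gmul (gder (lx i) (gpar f)) (gder (ly i) g) U
    + gmul (gder (ly i) (gpar f)) (gder (lx i) g) U)

/-- The formal square `f^[2] = ∑_i ∂f/∂x_i ∂f/∂y_i` of odd elements. It vanishes on odd monomials
and satisfies `(f + g)^[2] = f^[2] + {f, g} + g^[2]` and `2 f^[2] = {f, f}`. -/
def fsquare (f : Ser K) : Ser K := fun U =>
  ∑ᶠ i : ℕ, gmul (gder (lx i) f) (gder (ly i) f) U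

theorem exists_of_gmul_ne {f g : Ser K} {U : Finset Letter} (h : gmul f g U ≠ 0) :
    ∃ S T, S ∪ T = U ∧ Disjoint S T ∧ f S ≠ 0 ∧ g T ≠ 0 := by
  obtain ⟨S, hS, hne⟩ := Finset.exists_ne_zero_of_sum_ne_zero h
  refine ⟨S, U \ S, Finset.union_sdiff_of_subset (Finset.mem_powerset.1 hS),
    Finset.disjoint_sdiff, fun h0 => hne ?_, fun h0 => hne ?_⟩
  · rw [h0, mul_zero, zero_mul]
  · exact mul_eq_zero_of_right _ h0

theorem of_gder_ne {i : Letter} {f : Ser K} {S : Finset Letter} (h : gder i f S ≠ 0) :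
    i ∉ S ∧ f (insert i S) ≠ 0 := by
  unfold gder at h
  split_ifs at h with hi
  · exact (h rfl).elim
  · exact ⟨hi, right_ne_zero_of_mul h⟩

theorem gpar_mem {f : Ser K} (hf : f ∈ Htilde K) : gpar f ∈ Htilde K :=
  fun S h => hf S (right_ne_zero_of_mul h)

theorem gone_mem : (gone : Ser K) ∈ Htilde K := by
  intro S h i hi
  by_cases hS : S = ∅
  · simp [hS] at hi
  · exact (h (by simp [gone, hS])).elim

theorem gmul_mem {f g : Ser K} (hf : f ∈ Htilde K) (hg : g ∈ Htilde K) :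
    gmul f g ∈ Htilde K := by
  intro U h i hi
  obtain ⟨S, T, rfl, -, hS, hT⟩ := exists_of_gmul_ne h
  rcases Finset.mem_union.1 hi with hi | hi
  · obtain ⟨j, hj, hm⟩ := hf S hS i hi
    exact ⟨j, hj, Finset.mem_union_left _ hm⟩
  · obtain ⟨j, hj, hm⟩ := hg T hT i hi
    exact ⟨j, hj, Finset.mem_union_right _ hm⟩

theorem lx_ne_ly (i j : ℕ) : lx i ≠ ly j := by
  intro h
  cases h

theorem ly_inj {i j : ℕ} : ly i = ly j ↔ i = j :=
  ⟨fun h => by cases h; rfl, fun h => h ▸ rfl⟩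

theorem pair_bound {f g : Ser K} (hf : f ∈ Htilde K) (hg : g ∈ Htilde K)
    {S T : Finset Letter} {k : ℕ} (hS : f (insert (lx k) S) ≠ 0) (hT : g (insert (ly k) T) ≠ 0) :
    (∃ j, k < j ∧ ly j ∈ S ∪ T) ∧ ∀ i, lx i ∈ S ∪ T → ∃ j, i < j ∧ ly j ∈ S ∪ T := by
  have key : ∃ j, k < j ∧ ly j ∈ S ∪ T := by
    obtain ⟨j, hj, hm⟩ := hf _ hS k (Finset.mem_insert_self _ _)
    refine ⟨j, hj, Finset.mem_union_left _ ?_⟩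
    exact (Finset.mem_insert.1 hm).resolve_left fun h => lx_ne_ly _ _ h.symm
  refine ⟨key, fun i hi => ?_⟩
  rcases Finset.mem_union.1 hi with hi | hi
  · obtain ⟨j, hj, hm⟩ := hf _ hS i (Finset.mem_insert_of_mem hi)
    refine ⟨j, hj, Finset.mem_union_left _ ?_⟩
    exact (Finset.mem_insert.1 hm).resolve_left fun h => lx_ne_ly _ _ h.symm
  · obtain ⟨j, hj, hm⟩ := hg _ hT i (Finset.mem_insert_of_mem hi)
    rcases Finset.mem_insert.1 hm with he | hm
    · obtain rfl := ly_inj.1 he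
      obtain ⟨j', hj', hm'⟩ := key
      exact ⟨j', hj.trans hj', hm'⟩
    · exact ⟨j, hj, Finset.mem_union_right _ hm⟩

theorem xy_bound {f g : Ser K} (hf : f ∈ Htilde K) (hg : g ∈ Htilde K) {U : Finset Letter}
    {k : ℕ} (h : gmul (gder (lx k) f) (gder (ly k) g) U ≠ 0) :
    (∃ j, k < j ∧ ly j ∈ U) ∧ ∀ i, lx i ∈ U → ∃ j, i < j ∧ ly j ∈ U := by
  obtain ⟨S, T, rfl, -, hS, hT⟩ := exists_of_gmul_ne h
  exact pair_bound hf hg (of_gder_ne hS).2 (of_gder_ne hT).2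

theorem yx_bound {f g : Ser K} (hf : f ∈ Htilde K) (hg : g ∈ Htilde K) {U : Finset Letter}
    {k : ℕ} (h : gmul (gder (ly k) f) (gder (lx k) g) U ≠ 0) :
    (∃ j, k < j ∧ ly j ∈ U) ∧ ∀ i, lx i ∈ U → ∃ j, i < j ∧ ly j ∈ U := by
  obtain ⟨S, T, rfl, -, hS, hT⟩ := exists_of_gmul_ne h
  rw [Finset.union_comm]
  exact pair_bound hg hf (of_gder_ne hT).2 (of_gder_ne hS).2

theorem bracket_bound {f g : Ser K} (hf : f ∈ Htilde K) (hg : g ∈ Htilde K) {U : Finset Letter}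
    {k : ℕ} (h : gmul (gder (lx k) (gpar f)) (gder (ly k) g) U
      + gmul (gder (ly k) (gpar f)) (gder (lx k) g) U ≠ 0) :
    (∃ j, k < j ∧ ly j ∈ U) ∧ ∀ i, lx i ∈ U → ∃ j, i < j ∧ ly j ∈ U := by
  by_cases h1 : gmul (gder (lx k) (gpar f)) (gder (ly k) g) U = 0
  · exact yx_bound (gpar_mem hf) hg fun h2 => h (by rw [h1, h2, add_zero])
  · exact xy_bound (gpar_mem hf) hg h1

theorem bound_finite (U : Finset Letter) : {k : ℕ | ∃ j, k < j ∧ ly j ∈ U}.Finite := by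
  have h : {j : ℕ | ly j ∈ U}.Finite :=
    U.finite_toSet.preimage fun a _ b _ hab => ly_inj.1 hab
  refine (h.biUnion fun j _ => Set.finite_Iio j).subset ?_
  rintro k ⟨j, hj, hm⟩
  exact Set.mem_biUnion (x := j) hm hj

theorem bracket_support_finite {f g : Ser K} (hf : f ∈ Htilde K) (hg : g ∈ Htilde K)
    (U : Finset Letter) :
    (Function.support fun i : ℕ => gmul (gder (lx i) (gpar f)) (gder (ly i) g) U
      + gmul (gder (ly i) (gpar f)) (gder (lx i) g) U).Finite :=
  (bound_finite U).subset fun _ hk => (bracket_bound hf hg hk).1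

theorem fsquare_support_finite {f : Ser K} (hf : f ∈ Htilde K) (U : Finset Letter) :
    (Function.support fun i : ℕ => gmul (gder (lx i) f) (gder (ly i) f) U).Finite :=
  (bound_finite U).subset fun _ hk => (xy_bound hf hf hk).1

theorem bracket_mem {f g : Ser K} (hf : f ∈ Htilde K) (hg : g ∈ Htilde K) :
    bracket f g ∈ Htilde K := by
  intro U h
  obtain ⟨k, hk⟩ : ∃ k : ℕ, gmul (gder (lx k) (gpar f)) (gder (ly k) g) U
      + gmul (gder (ly k) (gpar f)) (gder (lx k) g) U ≠ 0 := by
    by_contra hcon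
    push Not at hcon
    exact h (by simp [bracket, hcon])
  exact (bracket_bound hf hg hk).2

theorem fsquare_mem {f : Ser K} (hf : f ∈ Htilde K) : fsquare f ∈ Htilde K := by
  intro U h
  obtain ⟨k, hk⟩ : ∃ k : ℕ, gmul (gder (lx k) f) (gder (ly k) f) U ≠ 0 := by
    by_contra hcon
    push Not at hcon
    exact h (by simp [fsquare, hcon])
  exact (xy_bound hf hf hk).2

/-- The letters of the monomial
`(x_n x_{n+1}) (x_{n+3} x_{n+4}) ⋯ (x_{n+3l-3} x_{n+3l-2}) y_{n+3l}`. -/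
def pivotLetters (n l : ℕ) : Finset Letter :=
  insert (ly (n + 3 * l))
    ((Finset.range l).biUnion fun j => {lx (n + 3 * j), lx (n + 3 * j + 1)})

open Classical in
/-- The pivot element `V_n = y_n + x_n x_{n+1} (y_{n+3} + x_{n+3} x_{n+4} (y_{n+6} + ⋯))`. -/
def V (K : Type*) [Field K] (n : ℕ) : Ser K := fun S =>
  if ∃ l : ℕ, S = pivotLetters n l then 1 else 0

theorem V_mem (n : ℕ) : V K n ∈ Htilde K := by
  intro S h i hi
  by_cases hS : ∃ l : ℕ, S = pivotLetters n l
  · obtain ⟨l, rfl⟩ := hS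
    refine ⟨n + 3 * l, ?_, Finset.mem_insert_self _ _⟩
    have hi := (Finset.mem_insert.1 hi).resolve_left (lx_ne_ly _ _)
    obtain ⟨j, hj, hm⟩ := Finset.mem_biUnion.1 hi
    have hj := Finset.mem_range.1 hj
    rcases Finset.mem_insert.1 hm with hm | hm
    · cases hm
      omega
    · cases Finset.mem_singleton.1 hm
      omega
  · exact (h (by simp [V, hS])).elim

variable (K)

/-- The generators `V_0, V_1, V_2`. -/
def poissonGens : Set (Ser K) := {V K 0, V K 1, V K 2}

variable {K}

/-- Subspaces containing the unit and `V_0, V_1, V_2`, closed under the product, the bracket and,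
in characteristic 2, the formal squares of odd elements. -/
structure IsPoissonClosed (P : Submodule K (Ser K)) : Prop where
  one_mem : gone ∈ P
  gen_mem : ∀ f ∈ poissonGens K, f ∈ P
  mul_mem : ∀ f ∈ P, ∀ g ∈ P, gmul f g ∈ P
  bracket_mem : ∀ f ∈ P, ∀ g ∈ P, bracket f g ∈ P
  square_mem : (2 : K) = 0 → ∀ f ∈ P, IsOddSeries f → fsquare f ∈ P

variable (K)

/-- The Poisson superalgebra generated by `V_0, V_1, V_2`. -/
def poissonAlg : Submodule K (Ser K) := sInf {P | IsPoissonClosed P}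

theorem poissonAlg_le_Htilde : poissonAlg K ≤ Htilde K := by
  refine sInf_le ⟨gone_mem, ?_, fun f hf g hg => gmul_mem hf hg,
    fun f hf g hg => bracket_mem hf hg, fun _ f hf _ => fsquare_mem hf⟩
  rintro f (rfl | rfl | rfl) <;> exact V_mem _

/-- Poisson monomials in `V_0, V_1, V_2` of given length. -/
inductive PoissonMonomial : ℕ → Ser K → Prop
  | one : PoissonMonomial 0 gone
  | gen {f : Ser K} : f ∈ poissonGens K → PoissonMonomial 1 f
  | mul {m n : ℕ} {f g : Ser K} : PoissonMonomial m f → PoissonMonomial n g →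
      PoissonMonomial (m + n) (gmul f g)
  | bracket {m n : ℕ} {f g : Ser K} : PoissonMonomial m f → PoissonMonomial n g →
      PoissonMonomial (m + n) (bracket f g)
  | square {n : ℕ} {f : Ser K} : (2 : K) = 0 → PoissonMonomial n f → IsOddSeries f →
      PoissonMonomial (2 * n) (fsquare f)

/-- The span of all Poisson monomials of length at most `n` in `V_0, V_1, V_2`. -/
def poissonFiltration (n : ℕ) : Submodule K (Ser K) :=
  Submodule.span K {f | ∃ m ≤ n, PoissonMonomial K m f}

/-! ## The Jordan superalgebra -/

/-- The product of the Kantor double, where the pair `(a, b)` stands for `a + \bar b`: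
`a • b = ab`, `\bar a • b = (-1)^|b| \bar{ab}`, `a • \bar b = \bar{ab}`,
`\bar a • \bar b = (-1)^|b| {a, b}`. -/
def kanMul (p q : Ser K × Ser K) : Ser K × Ser K :=
  (gmul p.1 q.1 + bracket p.2 (gpar q.2), gmul p.2 (gpar q.1) + gmul p.1 q.2)

/-- The Kantor double of the Poisson superalgebra `poissonAlg`. -/
def jordanAlg : Submodule K (Ser K × Ser K) := (poissonAlg K).prod (poissonAlg K)

/-- The generators `V_0, V_1, V_2, \bar 1`. -/
def jordanGens : Set (Ser K × Ser K) := {(V K 0, 0), (V K 1, 0), (V K 2, 0), (0, gone)}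

/-- Jordan monomials in `V_0, V_1, V_2, \bar 1` of given length. -/
inductive JordanMonomial : ℕ → Ser K × Ser K → Prop
  | one : JordanMonomial 0 (gone, 0)
  | gen {p : Ser K × Ser K} : p ∈ jordanGens K → JordanMonomial 1 p
  | mul {m n : ℕ} {p q : Ser K × Ser K} : JordanMonomial m p → JordanMonomial n q →
      JordanMonomial (m + n) (kanMul K p q)

/-- The span of all Jordan monomials of length at most `n` in `V_0, V_1, V_2, \bar 1`. -/
def jordanFiltration (n : ℕ) : Submodule K (Ser K × Ser K) :=
  Submodule.span K {p | ∃ m ≤ n, JordanMonomial K m p}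

end Poisson

end FractalSuper

end

noncomputable section

namespace FractalSuper

/-! ## The ring of formal Grassmann series -/

section GrassmannRing

variable {K I : Type*} [Field K] [LinearOrder I]

/-! Let wt(n+3) = wt(n+1) + 2 wt(n), with three initial values 1. The characteristic polynomial is
t^3 - t - 2, so wt(n) is λ^n up to bounded factors. Two relations drive the proof: {V_{n+1}, V_n} =
-x_n V_{n+3} and {V_n, x_n V_{n+3}} = V_{n+3}. By induction V_n is then a combination of monomials
of length at most wt(n). It suffices to show that at lengths comparable with wt(N) the dimension is
4^N up to constant factors; then ln γ(n) = (ln 4 / ln λ) ln n + O(1) (`gkDim_eq_of_bounds`).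

Upper bound. Give V_n and y_n the weight wt(n), and x_n the weight -wt(n); then V_k = y_k + x_k
x_{k+1} V_{k+3} is homogeneous. Hence monomials in V_k, V_{k+1}, V_{k+2} are combinations of 1, x_k,
y_k, y_k x_k with coefficients built from V_{k+1}, V_{k+2}, V_{k+3} and the letter x_{k+1}
(`pivSpanAdj_le`). One such step costs a factor 4 and raises the weight by at most wt(k)
(`finrank_le_four_pow`). For n ≤ wt(k), the weight after k steps is at most a constant times wt(k),
while each generator weighs at least wt(k), so boundedly many monomials remain
(`finrank_monSpan_le`). The elements of the Poisson algebra are infinite series; the count is made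
for the letters with indices below M, uniformly in M, and `finrank_le_of_separating` passes to the
limit.

Lower bound. Take the products of a subset of V_0, ..., V_{N-1}, a subset of about N letters x_j,
and V_N. The relations above, applied to pivot elements that carry letters, show that x^α V_N still
has length at most wt(N) (`prodSpan_mul_piv_mem`). All these elements have length at most wt(0) +
... + wt(N) ≤ 4 wt(N), and they are independent since derivations dual to the factors separate them
(`finrank_subwordSpan`).

The hull is treated in the same way, with ∂_k for y_k and anticommutators for brackets; a
`PivotSystem` records the relations that this takes. The Jordan superalgebra lies in two copies of
the Poisson one, and conversely a bracket is a product of two barred elements, so lengths grow at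
most threefold (`PoissonMonomial.mem_jordanFiltration`). -/

theorem sgn_union_left {S T R : Finset I} (h : Disjoint S T) :
    sgn K (S ∪ T) R = sgn K S R * sgn K T R := by
  unfold sgn
  rw [← pow_add, Finset.union_product, Finset.filter_union, Finset.card_union_of_disjoint]
  refine Finset.disjoint_filter_filter ?_
  exact Finset.disjoint_product.2 (Or.inl h)

theorem sgn_union_right {S T R : Finset I} (h : Disjoint S T) :
    sgn K R (S ∪ T) = sgn K R S * sgn K R T := by
  unfold sgn
  rw [← pow_add, Finset.product_union, Finset.filter_union, Finset.card_union_of_disjoint]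
  refine Finset.disjoint_filter_filter ?_
  exact Finset.disjoint_product.2 (Or.inr h)

theorem sgn_empty_left (S : Finset I) : sgn K ∅ S = 1 := by simp [sgn]

theorem sgn_empty_right (S : Finset I) : sgn K S ∅ = 1 := by simp [sgn]

theorem sgn_singleton_left (i : I) (S : Finset I) :
    sgn K {i} S = (-1) ^ (S.filter (· < i)).card := by
  unfold sgn
  congr 1
  refine Finset.card_bij' (fun p _ => p.2) (fun t _ => (i, t)) ?_ ?_ ?_ ?_ <;>
    simp +contextual [Prod.ext_iff]

theorem sgn_singleton_right (i : I) (S : Finset I) :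
    sgn K S {i} = (-1) ^ (S.filter (i < ·)).card := by
  unfold sgn
  congr 1
  refine Finset.card_bij' (fun p _ => p.1) (fun t _ => (t, i)) ?_ ?_ ?_ ?_ <;>
    simp +contextual [Prod.ext_iff]

theorem sgn_insert_left {i : I} {S R : Finset I} (h : i ∉ S) :
    sgn K (insert i S) R = (-1) ^ (R.filter (· < i)).card * sgn K S R := by
  rw [Finset.insert_eq, sgn_union_left (Finset.disjoint_singleton_left.2 h), sgn_singleton_left]

theorem sgn_insert_right {i : I} {S R : Finset I} (h : i ∉ S) :
    sgn K R (insert i S) = (-1) ^ (R.filter (i < ·)).card * sgn K R S := by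
  rw [Finset.insert_eq, sgn_union_right (Finset.disjoint_singleton_left.2 h), sgn_singleton_right]

/-- This trades the sign of moving a letter past a monomial from one side for the sign from the
other side. -/
theorem card_eq_lt_add_gt {i : I} {S : Finset I} (h : i ∉ S) :
    S.card = (S.filter (· < i)).card + (S.filter (i < ·)).card := by
  rw [← Finset.card_filter_add_card_filter_not (s := S) (· < i)]
  congr 2
  refine Finset.filter_congr fun x hx => ?_
  have : x ≠ i := fun h' => h (h' ▸ hx)
  rw [not_lt, le_iff_lt_or_eq, or_iff_left this.symm]

theorem neg_one_pow_mul_self (n : ℕ) : ((-1 : K) ^ n) * (-1) ^ n = 1 := by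
  rw [← mul_pow]; simp

/-- Formal Grassmann series, as a ring under the Grassmann product. -/
def Gr (K I : Type*) [Field K] [LinearOrder I] : Type _ := Finset I → K

namespace Gr

instance : AddCommGroup (Gr K I) := inferInstanceAs (AddCommGroup (Finset I → K))

instance : Module K (Gr K I) := inferInstanceAs (Module K (Finset I → K))

theorem gmul_gone (f : Finset I → K) : gmul f gone = f := by
  funext U
  unfold gmul
  rw [Finset.sum_eq_single U]
  · simp [sgn_empty_right, gone]
  · intro S hS hne
    have : U \ S ≠ ∅ := fun h => hne
      (Finset.Subset.antisymm (Finset.mem_powerset.1 hS) (Finset.sdiff_eq_empty_iff_subset.1 h))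
    simp [gone, this]
  · simp

theorem gone_gmul (f : Finset I → K) : gmul gone f = f := by
  funext U
  unfold gmul
  rw [Finset.sum_eq_single ∅]
  · simp [sgn_empty_left, gone]
  · intro S hS hne
    simp [gone, hne]
  · simp

theorem gmul_assoc (f g h : Finset I → K) : gmul (gmul f g) h = gmul f (gmul g h) := by
  funext U
  simp only [gmul, Finset.mul_sum, Finset.sum_mul]
  rw [Finset.sum_sigma', Finset.sum_sigma']
  -- A chain S ⊆ W ⊆ U amounts to an ordered partition of U into S, W \ S and U \ W, and both sides
  -- sum over these partitions.
  refine Finset.sum_bij' (fun p _ => ⟨p.2, p.1 \ p.2⟩) (fun p _ => ⟨p.1 ∪ p.2, p.1⟩) ?_ ?_ ?_ ?_ ?_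
  · rintro ⟨W, S⟩ h
    simp only [Finset.mem_sigma, Finset.mem_powerset] at h ⊢
    exact ⟨h.2.trans h.1, Finset.sdiff_subset_sdiff h.1 le_rfl⟩
  · rintro ⟨S, T⟩ h
    simp only [Finset.mem_sigma, Finset.mem_powerset] at h ⊢
    exact ⟨Finset.union_subset h.1 (h.2.trans Finset.sdiff_subset), Finset.subset_union_left⟩
  · rintro ⟨W, S⟩ h
    simp only [Finset.mem_sigma, Finset.mem_powerset] at h
    simp [Finset.union_sdiff_of_subset h.2]
  · rintro ⟨S, T⟩ h
    simp only [Finset.mem_sigma, Finset.mem_powerset] at h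
    have hd : Disjoint T S := Finset.disjoint_of_subset_left h.2 Finset.sdiff_disjoint
    simp [Finset.union_sdiff_cancel_left hd.symm]
  · rintro ⟨W, S⟩ h
    simp only [Finset.mem_sigma, Finset.mem_powerset] at h
    have h1 : (U \ S) \ (W \ S) = U \ W := by
      ext x
      simp only [Finset.mem_sdiff]
      have := @h.2 x
      tauto
    have h2 : U \ S = (W \ S) ∪ (U \ W) := by
      ext x
      simp only [Finset.mem_sdiff, Finset.mem_union]
      have := @h.2 x
      have := @h.1 x
      tauto
    have h3 : sgn K W (U \ W) = sgn K S (U \ W) * sgn K (W \ S) (U \ W) := by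
      rw [← sgn_union_left Finset.disjoint_sdiff, Finset.union_sdiff_of_subset h.2]
    have h4 : sgn K S (U \ S) = sgn K S (W \ S) * sgn K S (U \ W) := by
      rw [h2, sgn_union_right]
      exact Finset.disjoint_of_subset_left Finset.sdiff_subset Finset.disjoint_sdiff
    simp only [h1, h3, h4]
    ring

instance : Ring (Gr K I) :=
  { (inferInstance : AddCommGroup (Gr K I)) with
    mul := gmul
    one := gone
    mul_assoc := gmul_assoc
    one_mul := gone_gmul
    mul_one := gmul_gone
    left_distrib := fun f g h => by
      funext U
      change gmul f (fun S => g S + h S) U = gmul f g U + gmul f h U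
      simp only [gmul, mul_add, Finset.sum_add_distrib]
    right_distrib := fun f g h => by
      funext U
      change gmul (fun S => f S + g S) h U = gmul f h U + gmul g h U
      simp only [gmul, mul_add, add_mul, Finset.sum_add_distrib]
    zero_mul := fun f => by
      funext U
      change gmul (fun _ => 0) f U = 0
      simp [gmul]
    mul_zero := fun f => by
      funext U
      change gmul f (fun _ => 0) U = 0
      simp [gmul] }

instance : Algebra K (Gr K I) := Algebra.ofModule
  (fun c f g => by
    funext U
    change gmul (fun S => c * f S) g U = c * gmul f g U
    simp only [gmul, Finset.mul_sum]
    exact Finset.sum_congr rfl fun _ _ => by ring)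
  (fun c f g => by
    funext U
    change gmul f (fun S => c * g S) U = c * gmul f g U
    simp only [gmul, Finset.mul_sum]
    exact Finset.sum_congr rfl fun _ _ => by ring)

theorem one_def : (1 : Gr K I) = gone := rfl

theorem add_apply (f g : Gr K I) (U : Finset I) : (f + g) U = f U + g U := rfl

theorem smul_apply (c : K) (f : Gr K I) (U : Finset I) : (c • f) U = c * f U := rfl

theorem neg_apply (f : Gr K I) (U : Finset I) : (-f) U = -f U := rfl

theorem zero_apply (U : Finset I) : (0 : Gr K I) U = 0 := rfl

theorem sum_apply {J : Type*} (s : Finset J) (f : J → Gr K I) (U : Finset I) :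
    (∑ j ∈ s, f j) U = ∑ j ∈ s, f j U := Finset.sum_apply (M := fun _ : Finset I => K) U s f

@[ext] theorem ext {f g : Gr K I} (h : ∀ U, f U = g U) : f = g := funext h

/-- The superderivation with respect to a letter. -/
def der (i : I) : Gr K I →ₗ[K] Gr K I where
  toFun := gder i
  map_add' f g := by
    ext U
    change gder i (fun S => f S + g S) U = gder i f U + gder i g U
    simp only [gder]
    split_ifs <;> ring
  map_smul' c f := by
    ext U
    change gder i (fun S => c * f S) U = c * gder i f U
    simp only [gder]
    split_ifs <;> ring

theorem der_apply (i : I) (f : Gr K I) (S : Finset I) : der i f S =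
    if i ∈ S then 0 else (-1) ^ (S.filter (· < i)).card * f (insert i S) := rfl

/-- The parity automorphism. -/
def par : Gr K I →ₗ[K] Gr K I where
  toFun := gpar
  map_add' f g := by
    ext U
    exact mul_add _ _ _
  map_smul' c f := by
    ext U
    exact mul_left_comm _ _ _

theorem par_apply (f : Gr K I) (S : Finset I) : par f S = (-1) ^ S.card * f S := rfl

theorem mul_apply (f g : Gr K I) (U : Finset I) :
    (f * g) U = ∑ S ∈ U.powerset, sgn K S (U \ S) * f S * g (U \ S) := rfl

theorem par_par (f : Gr K I) : par (par f) = f := by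
  ext U
  rw [par_apply, par_apply, ← mul_assoc, neg_one_pow_mul_self, one_mul]

theorem par_one : par (1 : Gr K I) = 1 := by
  ext U
  rw [par_apply]
  by_cases h : U = ∅
  · simp [h]
  · simp [one_def, gone, h]

theorem par_mul (f g : Gr K I) : par (f * g) = par f * par g := by
  ext U
  rw [par_apply, mul_apply, mul_apply, Finset.mul_sum]
  refine Finset.sum_congr rfl fun S hS => ?_
  rw [par_apply, par_apply, ← Finset.card_sdiff_add_card_eq_card (Finset.mem_powerset.1 hS),
    pow_add]
  ring

theorem der_der (i j : I) (f : Gr K I) : der i (der j f) = -der j (der i f) := by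
  ext U
  rw [neg_apply]
  simp only [der_apply, Finset.mem_insert]
  by_cases hij : i = j
  · subst hij; simp
  by_cases hi : i ∈ U
  · simp [hi]
  by_cases hj : j ∈ U
  · simp [hj]
  simp only [hi, hj, hij, Ne.symm hij, or_self, if_false, Finset.filter_insert]
  rw [Finset.insert_comm]
  rcases lt_or_gt_of_ne hij with h | h
  · simp [h, h.not_gt, hi, pow_succ]; ring
  · simp [h, h.not_gt, hj, pow_succ]; ring

theorem par_der (i : I) (f : Gr K I) : par (der i f) = -der i (par f) := by
  ext U
  rw [neg_apply, par_apply, der_apply, der_apply]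
  split_ifs with h
  · simp
  · rw [par_apply, Finset.card_insert_of_notMem h, pow_succ]; ring

/-- Compare coefficients at U. If i ∉ U, the letter i of `insert i U` belongs to exactly one factor,
which gives the two terms. If i ∈ U, the left side vanishes and the two terms on the right cancel.
-/
theorem der_mul (i : I) (f g : Gr K I) : der i (f * g) = der i f * g + par f * der i g := by
  have key : ∀ V : Finset I, i ∉ V → ∀ S ∈ V.powerset, i ∉ S ∧ i ∉ V \ S ∧
      insert i V \ S = insert i (V \ S) ∧ insert i V \ insert i S = V \ S ∧ V \ insert i S = V \ S
      ∧ S ∪ (V \ S) = V := by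
    intro V hV S hS
    have hS' := Finset.mem_powerset.1 hS
    have h1 : i ∉ S := fun h => hV (hS' h)
    refine ⟨h1, fun h => hV (Finset.mem_sdiff.1 h).1, Finset.insert_sdiff_of_notMem _ h1, ?_, ?_,
      Finset.union_sdiff_of_subset hS'⟩
    · rw [Finset.insert_sdiff_insert, Finset.sdiff_insert_of_notMem hV]
    · exact Finset.sdiff_insert_of_notMem hV _
  ext U
  rw [add_apply, der_apply]
  by_cases hi : i ∈ U
  · obtain ⟨V, hV, rfl⟩ : ∃ V, i ∉ V ∧ U = insert i V :=
      ⟨U.erase i, Finset.notMem_erase _ _, (Finset.insert_erase hi).symm⟩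
    rw [if_pos hi, mul_apply, mul_apply, Finset.sum_powerset_insert hV,
      Finset.sum_powerset_insert hV]
    have e1 : ∀ S ∈ V.powerset, sgn K (insert i S) (insert i V \ insert i S) *
        der i f (insert i S) * g (insert i V \ insert i S) = 0 := fun S _ => by
      simp [der_apply]
    have e2 : ∀ S ∈ V.powerset, sgn K S (insert i V \ S) * par f S *
        der i g (insert i V \ S) = 0 := fun S hS => by
      rw [(key V hV S hS).2.2.1]; simp [der_apply]
    rw [Finset.sum_eq_zero e1, Finset.sum_eq_zero e2, add_zero, zero_add,
      ← Finset.sum_add_distrib, eq_comm]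
    refine Finset.sum_eq_zero fun S hS => ?_
    obtain ⟨h1, h2, h3, h4, -⟩ := key V hV S hS
    rw [h3, h4, der_apply, der_apply, if_neg h1, if_neg h2, par_apply, sgn_insert_left h1,
      sgn_insert_right h2, Finset.card_insert_of_notMem h1, card_eq_lt_add_gt h1, pow_succ, pow_add]
    linear_combination -(-1 : K) ^ (S.filter (· < i)).card * (-1) ^ (S.filter (i < ·)).card *
      sgn K S (V \ S) * f (insert i S) * g (insert i (V \ S)) *
      neg_one_pow_mul_self (K := K) ((V \ S).filter (· < i)).card
  · rw [if_neg hi, mul_apply, mul_apply, mul_apply, Finset.sum_powerset_insert hi, mul_add, add_comm,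
      Finset.mul_sum, Finset.mul_sum]
    congr 1
    · refine Finset.sum_congr rfl fun S hS => ?_
      obtain ⟨h1, h2, h3, h4, h5, h6⟩ := key U hi S hS
      rw [h4, der_apply, if_neg h1, sgn_insert_left h1]
      have : (U.filter (· < i)).card = (S.filter (· < i)).card + ((U \ S).filter (· < i)).card := by
        rw [← Finset.card_union_of_disjoint (Finset.disjoint_filter_filter Finset.disjoint_sdiff),
          ← Finset.filter_union, h6]
      rw [this, pow_add]
      linear_combination (-1 : K) ^ (S.filter (· < i)).card * sgn K S (U \ S) * f (insert i S) *
        g (U \ S) * neg_one_pow_mul_self (K := K) ((U \ S).filter (· < i)).card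
    · refine Finset.sum_congr rfl fun S hS => ?_
      obtain ⟨h1, h2, h3, h4, h5, h6⟩ := key U hi S hS
      rw [h3, der_apply, if_neg h2, par_apply, sgn_insert_right h2]
      have : (U.filter (· < i)).card = (S.filter (· < i)).card + ((U \ S).filter (· < i)).card := by
        rw [← Finset.card_union_of_disjoint (Finset.disjoint_filter_filter Finset.disjoint_sdiff),
          ← Finset.filter_union, h6]
      rw [this, pow_add, card_eq_lt_add_gt h1, pow_add]
      ring

/-! ### Multiplication by a single letter. -/

/-- A letter, as a series. -/
def letter (K : Type*) [Field K] (i : I) : Gr K I := (Pi.single {i} 1 : Finset I → K)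

theorem letter_apply (i : I) (S : Finset I) : letter K i S = if S = {i} then 1 else 0 := by
  simp only [letter, Pi.single_apply]

theorem letter_mul_apply (i : I) (f : Gr K I) (U : Finset I) : (letter K i * f) U =
    if i ∈ U then (-1) ^ ((U.erase i).filter (· < i)).card * f (U.erase i) else 0 := by
  rw [mul_apply]
  split_ifs with h
  · rw [Finset.sum_eq_single {i}]
    · rw [letter_apply, if_pos rfl, Finset.sdiff_singleton_eq_erase, sgn_singleton_left, mul_one]
    · intro S _ hS
      rw [letter_apply, if_neg hS]; ring
    · intro h'
      exact (h' (Finset.mem_powerset.2 (Finset.singleton_subset_iff.2 h))).elim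
  · refine Finset.sum_eq_zero fun S hS => ?_
    rw [letter_apply, if_neg]
    · ring
    · rintro rfl
      exact h (Finset.singleton_subset_iff.1 (Finset.mem_powerset.1 hS))

/-- A letter below all the others already stands in front, so no sign arises; this computes the
pivot elements in `piv_eq`. -/
theorem letter_mul_apply_of_lt {i : I} {f : Gr K I} {U T : Finset I}
    (hU : ∀ s, s ∈ U ↔ s = i ∨ s ∈ T) (hT : ∀ s ∈ T, i < s) : (letter K i * f) U = f T := by
  have e : U.erase i = T := by
    ext s
    rw [Finset.mem_erase, hU]
    exact ⟨fun h => h.2.resolve_left h.1, fun h => ⟨(hT s h).ne', Or.inr h⟩⟩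
  have e2 : T.filter (· < i) = ∅ := by
    rw [Finset.filter_eq_empty_iff]
    exact fun s hs => (hT s hs).not_gt
  rw [letter_mul_apply, if_pos ((hU i).2 (Or.inl rfl)), e, e2, Finset.card_empty, pow_zero, one_mul]

theorem exists_of_letter_mul_ne {i : I} {f : Gr K I} {U : Finset I} (h : (letter K i * f) U ≠ 0) :
    ∃ T, (∀ s, s ∈ U ↔ s = i ∨ s ∈ T) ∧ f T ≠ 0 := by
  rw [letter_mul_apply] at h
  split_ifs at h with hi
  · refine ⟨U.erase i, fun s => ?_, right_ne_zero_of_mul h⟩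
    rw [Finset.mem_erase]
    by_cases hs : s = i
    · simp [hs, hi]
    · simp [hs]
  · exact (h rfl).elim

theorem exists_of_der_ne {i : I} {f : Gr K I} {S : Finset I} (h : der i f S ≠ 0) :
    ∃ U, (∀ s, s ∈ U ↔ s = i ∨ s ∈ S) ∧ f U ≠ 0 := by
  rw [der_apply] at h
  split_ifs at h with hi
  · exact (h rfl).elim
  · exact ⟨_, fun s => Finset.mem_insert, right_ne_zero_of_mul h⟩

theorem mul_letter_apply (i : I) (f : Gr K I) (U : Finset I) : (f * letter K i) U =
    if i ∈ U then (-1) ^ ((U.erase i).filter (i < ·)).card * f (U.erase i) else 0 := by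
  rw [mul_apply]
  split_ifs with h
  · have h2 : U \ U.erase i = {i} := by
      ext x; simp only [Finset.mem_sdiff, Finset.mem_erase, Finset.mem_singleton]
      constructor
      · tauto
      · rintro rfl; tauto
    rw [Finset.sum_eq_single (U.erase i)]
    · rw [h2, letter_apply, if_pos rfl, sgn_singleton_right, mul_one]
    · intro S hS hne
      rw [letter_apply, if_neg]
      · ring
      · intro h3
        apply hne
        rw [← Finset.sdiff_singleton_eq_erase, ← h3,
          Finset.sdiff_sdiff_eq_self (Finset.mem_powerset.1 hS)]
    · intro h'
      exact (h' (Finset.mem_powerset.2 (Finset.erase_subset _ _))).elim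
  · refine Finset.sum_eq_zero fun S hS => ?_
    rw [letter_apply, if_neg]
    · ring
    · intro h3
      exact h (Finset.sdiff_subset (h3 ▸ Finset.mem_singleton_self i))

theorem mul_letter (f : Gr K I) (i : I) : f * letter K i = letter K i * par f := by
  ext U
  rw [letter_mul_apply, mul_letter_apply]
  split_ifs with h
  · rw [par_apply, card_eq_lt_add_gt (Finset.notMem_erase i U), pow_add]
    linear_combination -(-1 : K) ^ ((U.erase i).filter (i < ·)).card * f (U.erase i) *
      neg_one_pow_mul_self (K := K) ((U.erase i).filter (· < i)).card
  · rfl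

theorem par_letter (i : I) : par (letter K i) = -letter K i := by
  ext U
  rw [par_apply, neg_apply, letter_apply]
  split_ifs with h
  · simp [h]
  · simp

theorem letter_sq (i : I) : letter K i * letter K i = 0 := by
  ext U
  rw [letter_mul_apply]
  split_ifs with h
  · rw [letter_apply, if_neg, mul_zero]
    · rfl
    · intro h'
      exact Finset.notMem_erase i U (h' ▸ Finset.mem_singleton_self i)
  · rfl

theorem der_letter (i j : I) : der i (letter K j) = if i = j then 1 else 0 := by
  ext U
  rw [der_apply]
  by_cases hU : U = ∅
  · subst hU
    by_cases hij : i = j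
    · subst hij; simp [letter_apply, one_def, gone]
    · simp [letter_apply, hij, zero_apply]
  · have h2 : i ∉ U → letter K j (insert i U) = 0 := by
      intro hi
      rw [letter_apply, if_neg]
      intro h
      have hc := congrArg Finset.card h
      rw [Finset.card_insert_of_notMem hi, Finset.card_singleton] at hc
      exact hU (Finset.card_eq_zero.1 (by omega))
    have h3 : (if i = j then (1 : Gr K I) else 0) U = 0 := by
      split_ifs
      · simp [one_def, gone, hU]
      · rfl
    rw [h3]
    split_ifs with h
    · rfl
    · rw [h2 h, mul_zero]

theorem der_one (i : I) : der i (1 : Gr K I) = 0 := by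
  have h := der_mul i (1 : Gr K I) 1
  rw [par_one, mul_one, one_mul, mul_one] at h
  simpa using h

/-! ### Parity. -/

/-- The odd component. -/
def oddPart : Gr K I →ₗ[K] Gr K I where
  toFun f := fun S => if Odd S.card then f S else 0
  map_add' f g := by
    ext U
    change (if Odd U.card then f U + g U else 0) =
      (if Odd U.card then f U else 0) + (if Odd U.card then g U else 0)
    split_ifs <;> simp
  map_smul' c f := by
    ext U
    change (if Odd U.card then c * f U else 0) = c * (if Odd U.card then f U else 0)
    split_ifs <;> simp

theorem oddPart_apply (f : Gr K I) (S : Finset I) :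
    oddPart f S = if Odd S.card then f S else 0 := rfl

/-- In characteristic 2 the map `par` is the identity and no longer detects parity. Parity is
therefore tracked by `oddPart`, and by this formula a subspace stable under `oddPart` is stable
under `par` in every characteristic. -/
theorem par_eq (f : Gr K I) : par f = f - (2 : K) • oddPart f := by
  ext U
  rw [sub_eq_add_neg, add_apply, neg_apply, smul_apply, par_apply, oddPart_apply]
  split_ifs with h
  · rw [h.neg_one_pow]; ring
  · rw [(Nat.not_odd_iff_even.1 h).neg_one_pow]; ring

theorem oddPart_oddPart (f : Gr K I) : oddPart (oddPart f) = oddPart f := by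
  ext U
  simp only [oddPart_apply]
  split_ifs <;> rfl

theorem oddPart_eq_self_iff (f : Gr K I) : oddPart f = f ↔ IsOddSeries (K := K) (I := I) f := by
  constructor
  · intro h S hS
    by_contra hc
    rw [← h] at hS
    exact hS (by rw [oddPart_apply, if_neg hc])
  · intro h
    ext S
    rw [oddPart_apply]
    split_ifs with hc
    · rfl
    · by_contra hn
      exact hc (h S (Ne.symm hn))

/-- Homogeneous series of a given parity. -/
def IsHom (p : ZMod 2) (f : Gr K I) : Prop := ∀ S, f S ≠ 0 → (S.card : ZMod 2) = p

theorem IsHom.zero (p : ZMod 2) : IsHom p (0 : Gr K I) := fun _ h => (h rfl).elim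

theorem IsHom.one : IsHom 0 (1 : Gr K I) := by
  intro S h
  by_cases hS : S = ∅
  · simp [hS]
  · exact (h (by simp [one_def, gone, hS])).elim

theorem IsHom.add {p : ZMod 2} {f g : Gr K I} (hf : IsHom p f) (hg : IsHom p g) :
    IsHom p (f + g) := by
  intro S h
  by_cases h1 : f S = 0
  · exact hg S fun h2 => h (by rw [add_apply, h1, h2, add_zero])
  · exact hf S h1

theorem IsHom.sum {J : Type*} {s : Finset J} {p : ZMod 2} {f : J → Gr K I}
    (h : ∀ j ∈ s, IsHom p (f j)) : IsHom p (∑ j ∈ s, f j) :=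
  Finset.sum_induction f (IsHom p) (fun _ _ => IsHom.add) (IsHom.zero p) h

theorem IsHom.par {p : ZMod 2} {f : Gr K I} (hf : IsHom p f) : IsHom p (par f) :=
  fun S h => hf S fun h0 => h (by rw [par_apply, h0, mul_zero])

theorem IsHom.mul {p q : ZMod 2} {f g : Gr K I} (hf : IsHom p f) (hg : IsHom q g) :
    IsHom (p + q) (f * g) := by
  intro U h
  have h : ∃ S ∈ U.powerset, _ := Finset.exists_ne_zero_of_sum_ne_zero (mul_apply f g U ▸ h)
  obtain ⟨S, hS, hne⟩ := h
  rw [← Finset.card_sdiff_add_card_eq_card (Finset.mem_powerset.1 hS), Nat.cast_add, add_comm,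
    hf S (fun h0 => hne (by rw [h0]; ring)), hg _ (fun h0 => hne (by rw [h0]; ring))]

theorem IsHom.der {p : ZMod 2} {f : Gr K I} (i : I) (hf : IsHom p f) :
    IsHom (p + 1) (der i f) := by
  intro U h
  rw [der_apply] at h
  split_ifs at h with hi
  · exact (h rfl).elim
  · have := hf _ (right_ne_zero_of_mul h)
    rw [← this, Finset.card_insert_of_notMem hi, Nat.cast_add, Nat.cast_one, add_assoc,
      show (1 + 1 : ZMod 2) = 0 from rfl, add_zero]

theorem odd_iff_cast (n : ℕ) : Odd n ↔ (n : ZMod 2) = 1 := by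
  rw [ZMod.natCast_eq_one_iff_odd]

theorem IsHom.isOdd {f : Gr K I} (hf : IsHom 1 f) : IsOddSeries (K := K) (I := I) f :=
  fun S h => (odd_iff_cast _).2 (hf S h)

theorem IsHom.oddPart_one {f : Gr K I} (hf : IsHom 1 f) : oddPart f = f :=
  (oddPart_eq_self_iff f).2 hf.isOdd

theorem IsHom.oddPart_zero {f : Gr K I} (hf : IsHom 0 f) : oddPart f = 0 := by
  ext S
  rw [oddPart_apply]
  split_ifs with h
  · by_contra hn
    rw [odd_iff_cast, hf S hn] at h
    exact zero_ne_one h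
  · rfl

theorem oddPart_letter_mul (i : I) (f : Gr K I) :
    oddPart (letter K i * f) = letter K i * (f - oddPart f) := by
  ext U
  rw [oddPart_apply, letter_mul_apply, letter_mul_apply]
  by_cases h : i ∈ U
  · simp only [if_pos h]
    have hc := Finset.card_erase_add_one h
    rw [sub_eq_add_neg, add_apply, neg_apply, oddPart_apply, ← hc]
    by_cases h2 : Odd (U.erase i).card
    · rw [if_neg (by simpa [Nat.odd_add_one] using h2), if_pos h2]; ring
    · rw [if_pos (by simpa [Nat.odd_add_one] using h2), if_neg h2]; ring
  · simp [h]

/-! ### Disappearance of signs in characteristic 2. -/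

section CharTwo

variable (h2 : (2 : K) = 0)
include h2

theorem neg_one_eq_one : (-1 : K) = 1 := by linear_combination -h2

theorem par_eq_self (f : Gr K I) : par f = f := by
  ext U
  rw [par_apply, neg_one_eq_one h2]; simp

theorem neg_eq_self (f : Gr K I) : -f = f := by
  have : (2 : K) • f = 0 := by rw [h2, zero_smul]
  rw [two_smul] at this
  exact neg_eq_of_add_eq_zero_left this

theorem mul_comm_of_two (f g : Gr K I) : f * g = g * f := by
  ext U
  rw [mul_apply, mul_apply]
  have hs : ∀ S T : Finset I, sgn K S T = 1 := fun S T => by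
    unfold sgn; rw [neg_one_eq_one h2, one_pow]
  simp only [hs, one_mul]
  refine Finset.sum_bij' (fun S _ => U \ S) (fun S _ => U \ S) ?_ ?_ ?_ ?_ ?_ <;>
    simp +contextual [mul_comm]

end CharTwo

end Gr

end GrassmannRing

end FractalSuper

end

noncomputable section

namespace FractalSuper

/-! ## Weights of the pivot elements -/

/-- The length of the pivot element with a given index as a monomial in the generators. -/
def wt : ℕ → ℕ
  | 0 => 1
  | 1 => 1
  | 2 => 1
  | n + 3 => wt (n + 1) + 2 * wt n

theorem wt_add_three (n : ℕ) : wt (n + 3) = wt (n + 1) + 2 * wt n := by rw [wt]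

theorem wt_le_succ (n : ℕ) : wt n ≤ wt (n + 1) := by
  induction n using Nat.strong_induction_on with
  | _ n ih =>
    match n with
    | 0 => simp [wt]
    | 1 => simp [wt]
    | 2 => simp [wt]
    | m + 3 =>
      have h0 := ih m (by omega)
      have h1 := ih (m + 1) (by omega)
      have := wt_add_three m
      have := wt_add_three (m + 1)
      simp only [add_assoc, Nat.reduceAdd] at *
      omega

theorem wt_mono : Monotone wt := monotone_nat_of_le_succ wt_le_succ

/-- A crude bound suffices: each n is below some weight, so the upper bounds, and with them finite
dimensionality, apply at each n. -/
theorem le_wt (n : ℕ) : n ≤ wt (3 * n + 3) := by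
  suffices h : n + 1 ≤ wt (3 * n + 3) by omega
  induction n with
  | zero => simp [wt]
  | succ n ih =>
    have h3 := wt_add_three (3 * n + 3)
    have h4 := wt_le_succ (3 * n + 3)
    rw [show 3 * (n + 1) + 3 = 3 * n + 3 + 3 by ring, h3]
    omega

theorem wt_pos (n : ℕ) : 0 < wt n := lt_of_lt_of_le (by simp [wt]) (wt_mono (Nat.zero_le n))

/-- `wt 0 + ⋯ + wt (n - 1)`. -/
def wtSum (n : ℕ) : ℕ := ∑ i ∈ Finset.range n, wt i

theorem wtSum_succ (n : ℕ) : wtSum (n + 1) = wtSum n + wt n := Finset.sum_range_succ _ _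

/-- Geometric growth makes the partial sums comparable with the next weight. The constant 3 survives
a step of three because 4 wt(m) + wt(m+1) ≤ 2 wt(m+3) and wt(m+2) ≤ wt(m+3). -/
theorem wtSum_le (n : ℕ) : wtSum n ≤ 3 * wt n := by
  induction n using Nat.strong_induction_on with
  | _ n ih =>
    match n with
    | 0 => simp [wtSum]
    | 1 => simp [wtSum, wt]
    | 2 => simp [wtSum, wt, Finset.sum_range_succ]
    | m + 3 =>
      have h0 := ih m (by omega)
      have := wt_add_three m
      have h2 := wt_add_three (m + 1)
      have := wt_le_succ m
      have := wt_le_succ (m + 1)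
      have h5 : wt (m + 2) ≤ wt (m + 3) := wt_le_succ (m + 2)
      have e1 : m + 1 + 1 = m + 2 := rfl
      rw [e1] at *
      rw [wtSum_succ, wtSum_succ, wtSum_succ]
      omega

/-! ### The root λ, its powers and its logarithm. -/

section Lambda

variable {lam : ℝ}

theorem lam_bounds (h : lam ^ 3 - lam - 2 = 0) : 1.521379 < lam ∧ lam < 1.521380 := by
  constructor
  · by_contra hc
    push Not at hc
    have : lam ^ 3 - lam - 2 < 0 := by
      -- With c the claimed bound, the cofactor of λ - c in λ^3 - c^3 is λ^2 + cλ + c^2; the square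
      -- has nearly the same quadratic and linear terms, as 0.76 is about c/2.
      nlinarith [mul_nonneg (sq_nonneg (lam + 0.76)) (sub_nonneg.2 hc)]
    linarith
  · by_contra hc
    push Not at hc
    have : 0 < lam ^ 3 - lam - 2 := by
      nlinarith [mul_nonneg (sq_nonneg (lam + 0.76)) (sub_nonneg.2 hc)]
    linarith

theorem lam_cube (h : lam ^ 3 - lam - 2 = 0) (n : ℕ) :
    lam ^ (n + 3) = lam ^ (n + 1) + 2 * lam ^ n := by
  linear_combination lam ^ n * h

theorem wt_le_lam (h : lam ^ 3 - lam - 2 = 0) (n : ℕ) : (wt n : ℝ) ≤ lam ^ n := by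
  have hl := lam_bounds h
  induction n using Nat.strong_induction_on with
  | _ n ih =>
    match n with
    | 0 => simp [wt]
    | 1 => simp only [wt, Nat.cast_one, pow_one]; linarith
    | 2 => simp only [wt, Nat.cast_one]; nlinarith
    | m + 3 =>
      rw [wt_add_three, lam_cube h]
      push_cast
      linarith [ih m (by omega), ih (m + 1) (by omega)]

/-- The powers of λ obey the recursion of `wt`, so only the initial values matter; the constant 3
comes from λ^2 < 3. -/
theorem lam_le_wt (h : lam ^ 3 - lam - 2 = 0) (n : ℕ) : lam ^ n ≤ 3 * wt n := by
  have hl := lam_bounds h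
  induction n using Nat.strong_induction_on with
  | _ n ih =>
    match n with
    | 0 => simp [wt]
    | 1 => simp [wt]; linarith
    | 2 => simp [wt]; nlinarith
    | m + 3 =>
      rw [wt_add_three, lam_cube h]
      push_cast
      linarith [ih m (by omega), ih (m + 1) (by omega)]

/-- The fraction 223/135 is close to log_λ 2, that is, λ^223 is nearly 2^135. Six decimals of λ
place the quotient between 0.999 and 1.001, and 1 - 1/t ≤ log t ≤ t - 1 bounds its logarithm. -/
theorem abs_logb_sub_lt (h : lam ^ 3 - lam - 2 = 0) :
    |2 * Real.logb lam 2 - 3.3037| < 0.00005 := by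
  obtain ⟨h1, h2⟩ := lam_bounds h
  have l2 := Real.log_two_gt_d9
  have l2' := Real.log_two_lt_d9
  have hlog : 0 < Real.log lam := Real.log_pos (by linarith)
  have key : Real.log (lam ^ 223 / 2 ^ 135) = 223 * Real.log lam - 135 * Real.log 2 := by
    rw [Real.log_div (by positivity) (by positivity), Real.log_pow, Real.log_pow]
    norm_num
  have hp : (0 : ℝ) < lam ^ 223 / 2 ^ 135 := by positivity
  have hub : lam ^ 223 / 2 ^ 135 < 1.001 := by
    rw [div_lt_iff₀ (by positivity)]
    refine lt_of_lt_of_le (pow_lt_pow_left₀ h2 (by linarith) (by norm_num)) ?_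
    norm_num
  have hlb : 0.999 < lam ^ 223 / 2 ^ 135 := by
    rw [lt_div_iff₀ (by positivity)]
    refine lt_of_le_of_lt ?_ (pow_lt_pow_left₀ h1 (by norm_num) (by norm_num))
    norm_num
  have e1 : Real.log (lam ^ 223 / 2 ^ 135) < 0.001 :=
    lt_of_le_of_lt (Real.log_le_sub_one_of_pos hp) (by linarith)
  have e2 : -0.00101 < Real.log (lam ^ 223 / 2 ^ 135) := by
    refine lt_of_lt_of_le ?_ (Real.one_sub_inv_le_log_of_pos hp)
    have : (lam ^ 223 / 2 ^ 135)⁻¹ < 0.999⁻¹ := inv_strictAnti₀ (by norm_num) hlb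
    norm_num at this ⊢
    linarith
  rw [key] at e1 e2
  have hd : 2 * Real.logb lam 2 = 2 * Real.log 2 / Real.log lam := by
    rw [Real.logb, mul_div_assoc]
  have b1 : 3.30365 < 2 * Real.log 2 / Real.log lam := by
    rw [lt_div_iff₀ hlog]
    linarith
  have b2 : 2 * Real.log 2 / Real.log lam < 3.30375 := by
    rw [div_lt_iff₀ hlog]
    linarith
  rw [hd, abs_lt]
  constructor <;> linarith

end Lambda

end FractalSuper

end

noncomputable section

namespace FractalSuper

/-! ## Growth from two-sided bounds -/

section GrowthBounds

variable {K M : Type*} [Field K] [AddCommGroup M] [Module K M]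

/-- For the lower bound choose N with λ^N ≤ n/a < λ^(N+1), for the upper one N with λ^N ≤ 3n <
λ^(N+1). Since wt(N) ≤ λ^N ≤ 3 wt(N), both hypotheses apply, and 4^N is n^d up to a constant factor,
where d = log_λ 4. -/
theorem tendsto_log_div_log {lam : ℝ} (h : lam ^ 3 - lam - 2 = 0) {f : ℕ → ℕ} {a b C : ℕ}
    (ha : 0 < a) (hlow : ∀ N n, a * wt N ≤ n → 4 ^ N ≤ b * f n)
    (hup : ∀ N n, n ≤ wt N → f n ≤ C * 4 ^ N) :
    Filter.Tendsto (fun n : ℕ => Real.log (f n) / Real.log n) Filter.atTop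
      (nhds (2 * Real.logb lam 2)) := by
  obtain ⟨h1, h2⟩ := lam_bounds h
  have hl1 : 1 < lam := by linarith
  have hlog : 0 < Real.log lam := Real.log_pos hl1
  have hlog2 : 0 < Real.log 2 := Real.log_pos (by norm_num)
  have hlog4 : Real.log 4 = 2 * Real.log 2 := by
    rw [show (4 : ℝ) = 2 ^ 2 by norm_num, Real.log_pow]; norm_num
  set d := 2 * Real.logb lam 2 with hd
  have hdl : d * Real.log lam = Real.log 4 := by
    rw [hd, Real.logb, hlog4]; field_simp
  have ha' : (0 : ℝ) < a := by exact_mod_cast ha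
  have low : ∀ n : ℕ, a ≤ n → 0 < f n ∧
      d * Real.log n - (d * Real.log a + Real.log 4 + Real.log b) ≤ Real.log (f n) := by
    intro n hn
    have hn' : (a : ℝ) ≤ n := by exact_mod_cast hn
    have hn0 : (0 : ℝ) < n := lt_of_lt_of_le ha' hn'
    obtain ⟨N, hN1, hN2⟩ := exists_nat_pow_near ((one_le_div ha').2 hn') hl1
    have hb := hlow N n (by
      have : (a : ℝ) * wt N ≤ n := by
        rw [le_div_iff₀ ha'] at hN1
        nlinarith [wt_le_lam h N]
      exact_mod_cast this)
    have hbf : 0 < b * f n := lt_of_lt_of_le (by positivity) hb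
    have hb0 : 0 < b := by
      rcases Nat.eq_zero_or_pos b with h0 | h0
      · simp [h0] at hbf
      · exact h0
    have hf0 : 0 < f n := by
      rcases Nat.eq_zero_or_pos (f n) with h0 | h0
      · simp [h0] at hbf
      · exact h0
    refine ⟨hf0, ?_⟩
    have hb0' : (0 : ℝ) < b := by exact_mod_cast hb0
    have hf0' : (0 : ℝ) < f n := by exact_mod_cast hf0
    have e1 : (N : ℝ) * Real.log 4 ≤ Real.log b + Real.log (f n) := by
      rw [← Real.log_pow, ← Real.log_mul hb0'.ne' hf0'.ne']
      exact Real.log_le_log (by positivity) (by exact_mod_cast hb)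
    have e2 : Real.log n - Real.log a ≤ ((N : ℝ) + 1) * Real.log lam := by
      rw [← Real.log_div hn0.ne' ha'.ne']
      have := Real.log_le_log (by positivity) hN2.le
      rwa [Real.log_pow, Nat.cast_add, Nat.cast_one] at this
    have hd0 : 0 < d := by
      by_contra hc
      nlinarith
    nlinarith [mul_le_mul_of_nonneg_left e2 hd0.le]
  have up : ∀ n : ℕ, a ≤ n →
      Real.log (f n) ≤ d * Real.log n + (d * Real.log 3 + Real.log 4 + Real.log C) := by
    intro n hn
    have hn' : (a : ℝ) ≤ n := by exact_mod_cast hn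
    have hn0 : (0 : ℝ) < n := lt_of_lt_of_le ha' hn'
    have hn1 : (1 : ℝ) ≤ n := by
      have : 1 ≤ n := by omega
      exact_mod_cast this
    obtain ⟨N, hN1, hN2⟩ := exists_nat_pow_near (x := 3 * (n : ℝ)) (by linarith) hl1
    have hb := hup (N + 1) n (by
      have : (n : ℝ) ≤ wt (N + 1) := by linarith [lam_le_wt h (N + 1)]
      exact_mod_cast this)
    have hf0 := (low n hn).1
    have hC0 : 0 < C := by
      rcases Nat.eq_zero_or_pos C with h0 | h0
      · simp [h0] at hb; omega
      · exact h0
    have hC0' : (0 : ℝ) < C := by exact_mod_cast hC0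
    have hf0' : (0 : ℝ) < f n := by exact_mod_cast hf0
    have e1 : Real.log (f n) ≤ Real.log C + ((N : ℝ) + 1) * Real.log 4 := by
      have := Real.log_le_log hf0' (show (f n : ℝ) ≤ C * 4 ^ (N + 1) by exact_mod_cast hb)
      rwa [Real.log_mul hC0'.ne' (by positivity), Real.log_pow, Nat.cast_add, Nat.cast_one] at this
    have e2 : (N : ℝ) * Real.log lam ≤ Real.log 3 + Real.log n := by
      rw [← Real.log_mul (by norm_num) hn0.ne', ← Real.log_pow]
      exact Real.log_le_log (by positivity) hN1
    have hd0 : 0 < d := by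
      by_contra hc
      nlinarith
    nlinarith [mul_le_mul_of_nonneg_left e2 hd0.le]
  have hlt : Filter.Tendsto (fun n : ℕ => Real.log n) Filter.atTop Filter.atTop :=
    Real.tendsto_log_atTop.comp tendsto_natCast_atTop_atTop
  have t0 : ∀ c : ℝ, Filter.Tendsto (fun n : ℕ => d + c / Real.log n) Filter.atTop (nhds d) := by
    intro c
    simpa using tendsto_const_nhds.add (hlt.const_div_atTop c)
  refine tendsto_of_tendsto_of_tendsto_of_le_of_le'
    (t0 (-(d * Real.log a + Real.log 4 + Real.log b)))
    (t0 (d * Real.log 3 + Real.log 4 + Real.log C)) ?_ ?_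
  · filter_upwards [Filter.eventually_ge_atTop (a + 2)] with n hn
    have hp : 0 < Real.log n := Real.log_pos (by
      have : 1 < n := by omega
      exact_mod_cast this)
    rw [le_div_iff₀ hp, add_mul, div_mul_cancel₀ _ hp.ne']
    linarith [(low n (by omega)).2]
  · filter_upwards [Filter.eventually_ge_atTop (a + 2)] with n hn
    have hp : 0 < Real.log n := Real.log_pos (by
      have : 1 < n := by omega
      exact_mod_cast this)
    rw [div_le_iff₀ hp, add_mul, div_mul_cancel₀ _ hp.ne']
    linarith [up n (by omega)]

theorem gkDim_eq_of_bounds {lam : ℝ} (h : lam ^ 3 - lam - 2 = 0) {F : ℕ → Submodule K M}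
    {a b C : ℕ} (ha : 0 < a)
    (hlow : ∀ N n, a * wt N ≤ n → 4 ^ N ≤ b * Module.finrank K (F n))
    (hup : ∀ N n, n ≤ wt N → Module.finrank K (F n) ≤ C * 4 ^ N) :
    gkDim F = ((2 * Real.logb lam 2 : ℝ) : EReal) ∧
      lowerGkDim F = ((2 * Real.logb lam 2 : ℝ) : EReal) := by
  have t := (continuous_coe_real_ereal.tendsto _).comp (tendsto_log_div_log h ha hlow hup)
  exact ⟨t.limsup_eq, t.liminf_eq⟩

end GrowthBounds

/-! ## Dimension counts -/

section Dimension

variable {K M : Type*} [Field K] [AddCommGroup M] [Module K M]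

/-- The span of the products of subsequences of a list of operators, applied to `e`. -/
def subwordSpan (e : M) : List (Module.End K M × Module.End K M) → Submodule K M
  | [] => Submodule.span K {e}
  | p :: L => subwordSpan e L ⊔ (subwordSpan e L).map p.1

theorem subwordSpan_le_ker {e : M} {D : Module.End K M} (he : D e = 0) :
    ∀ L : List (Module.End K M × Module.End K M),
      (∀ q ∈ L, ∀ m, D (q.1 m) = -q.1 (D m)) → subwordSpan e L ≤ LinearMap.ker D
  | [], _ => by
    rw [subwordSpan, Submodule.span_singleton_le_iff_mem]
    exact he
  | p :: L, h => by
    have ih := subwordSpan_le_ker he L fun q hq => h q (List.mem_cons_of_mem _ hq)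
    refine sup_le ih ?_
    rintro _ ⟨m, hm, rfl⟩
    rw [LinearMap.mem_ker, h p List.mem_cons_self, LinearMap.mem_ker.1 (ih hm), map_zero, neg_zero]

instance subwordSpan_finite (e : M) (L : List (Module.End K M × Module.End K M)) :
    Module.Finite K (subwordSpan e L) := by
  induction L with
  | nil => rw [subwordSpan]; infer_instance
  | cons p L ih => rw [subwordSpan]; infer_instance

/-- Each pair consists of a creation operator and its dual annihilation operator. The head's `p.2`
kills the span of the tail, and there `p.2 ∘ p.1` is the identity; so `p.1` is injective on this
span, its image meets the span in zero, and the dimension doubles. Anticommutation is needed only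
with later members of the list, which suits the triangular shape of the pivot elements. -/
theorem finrank_subwordSpan {e : M} (he : e ≠ 0) :
    ∀ L : List (Module.End K M × Module.End K M), (∀ p ∈ L, p.2 e = 0) →
      (∀ p ∈ L, ∀ m, p.2 (p.1 m) + p.1 (p.2 m) = m) →
      L.Pairwise (fun p q => ∀ m, p.2 (q.1 m) = -q.1 (p.2 m)) →
      Module.finrank K (subwordSpan e L) = 2 ^ L.length
  | [], _, _, _ => by
    rw [subwordSpan, finrank_span_singleton he, List.length_nil, pow_zero]
  | p :: L, h0, h1, h2 => by
    rw [List.pairwise_cons] at h2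
    have ih := finrank_subwordSpan he L (fun q hq => h0 q (List.mem_cons_of_mem _ hq))
      (fun q hq => h1 q (List.mem_cons_of_mem _ hq)) h2.2
    have hk := subwordSpan_le_ker (h0 p List.mem_cons_self) L h2.1
    have hx : ∀ m ∈ subwordSpan e L, p.2 (p.1 m) = m := fun m hm => by
      have := h1 p List.mem_cons_self m
      rwa [LinearMap.mem_ker.1 (hk hm), map_zero, add_zero] at this
    have hmap : Module.finrank K ((subwordSpan e L).map p.1) = 2 ^ L.length := by
      rw [← ih, ← LinearMap.range_domRestrict, LinearMap.finrank_range_of_inj]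
      intro m m' hmm
      have := congrArg p.2 hmm
      simp only [LinearMap.domRestrict_apply, hx _ m.2, hx _ m'.2] at this
      exact Subtype.ext this
    have hinf : subwordSpan e L ⊓ (subwordSpan e L).map p.1 = ⊥ := by
      rw [eq_bot_iff]
      rintro _ ⟨hm, m, hm', rfl⟩
      have := hx m hm'
      rw [LinearMap.mem_ker.1 (hk hm)] at this
      rw [← this, map_zero]
      exact Submodule.zero_mem _
    have := Submodule.finrank_sup_add_finrank_inf_eq (subwordSpan e L) ((subwordSpan e L).map p.1)
    rw [hinf, finrank_bot, add_zero, ih, hmap] at this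
    rw [subwordSpan, this, List.length_cons, pow_succ]
    ring

/-- On a finite-dimensional subspace a decreasing chain of kernels with zero intersection reaches
zero, so some `r n` is injective there. Thus a finite independent subset of W keeps its independence
in some image and has at most D elements. -/
theorem finrank_le_of_separating {M' : Type*} [AddCommGroup M'] [Module K M']
    (r : ℕ → M →ₗ[K] M') (hr : Antitone fun n => LinearMap.ker (r n))
    (hsep : ∀ m, (∀ n, r n m = 0) → m = 0) {W : Submodule K M} {D : ℕ}
    (hD : ∀ n, Module.Finite K (W.map (r n)) ∧ Module.finrank K (W.map (r n)) ≤ D) :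
    Module.Finite K W ∧ Module.finrank K W ≤ D := by
  have hrank : Module.rank K W ≤ D := by
    refine rank_le fun s hs => ?_
    let W' : Submodule K W := Submodule.span K (s : Set W)
    have : Module.Finite K W' := Module.Finite.span_finset K s
    let k : ℕ → Submodule K W' := fun n => LinearMap.ker (r n ∘ₗ W.subtype ∘ₗ W'.subtype)
    have hk : Antitone k := fun i j hij x hx => hr hij hx
    obtain ⟨n, hn⟩ := IsArtinian.monotone_stabilizes (⟨k, hk⟩ : ℕ →o (Submodule K W')ᵒᵈ)
    have hker : k n = ⊥ := by
      rw [eq_bot_iff]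
      intro x hx
      have hall : ∀ m, r m (x : W) = 0 := by
        intro m
        rcases le_total n m with h | h
        · have e : k n = k m := hn m h
          rw [e] at hx
          exact hx
        · exact hk h hx
      have := hsep _ hall
      exact (Submodule.mem_bot K).2 (Subtype.ext (Subtype.ext this))
    let g : W →ₗ[K] W.map (r n) := (r n).submoduleMap W
    have hind : LinearIndependent K (fun i : s => g (i : W)) := by
      refine hs.map (f := g) ?_
      rw [Submodule.disjoint_def]
      intro x hx hgx
      have hx' : x ∈ W' := by
        simpa [W', Subtype.range_coe_subtype] using hx
      have : (⟨x, hx'⟩ : W') ∈ k n := by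
        have := congrArg Subtype.val (LinearMap.mem_ker.1 hgx)
        exact this
      rw [hker, Submodule.mem_bot] at this
      exact congrArg Subtype.val this
    have := (hD n).1
    have hc := hind.fintype_card_le_finrank
    rw [Fintype.card_coe] at hc
    exact hc.trans (hD n).2
  have hlt : Module.rank K W < Cardinal.aleph0 := lt_of_le_of_lt hrank (Cardinal.natCast_lt_aleph0)
  have hfin : Module.Finite K W := Module.rank_lt_aleph0_iff.1 hlt
  refine ⟨hfin, ?_⟩
  rw [← Module.finrank_eq_rank] at hrank
  exact_mod_cast hrank

end Dimension

/-! ## Monomials in three consecutive pivot elements -/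

section Monomials

variable {K B : Type*} [Field K] [Ring B] [Algebra K B]

/-- Monomials, with their weights, in the elements `g k, g (k + 1), g (k + 2)`. -/
inductive WMon (br : B → B → B) (adm : B → Prop) (sq : B → B) (g : ℕ → B) (k : ℕ) : ℕ → B → Prop
  | zero (n : ℕ) : WMon br adm sq g k n 0
  | one : WMon br adm sq g k 0 1
  | gen (j : ℕ) : j ≤ 2 → WMon br adm sq g k (wt (k + j)) (g (k + j))
  | mul {m n : ℕ} {a b : B} : WMon br adm sq g k m a → WMon br adm sq g k n b →
      WMon br adm sq g k (m + n) (a * b)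
  | bracket {m n : ℕ} {a b : B} : WMon br adm sq g k m a → WMon br adm sq g k n b →
      WMon br adm sq g k (m + n) (br a b)
  | square {n : ℕ} {a : B} : adm a → WMon br adm sq g k n a → WMon br adm sq g k (2 * n) (sq a)

/-- The size of a finite set that contains all monomials in at most `n` letters. -/
def monCount : ℕ → ℕ
  | 0 => 2
  | n + 1 => 2 * monCount n + 3 + 2 * (monCount n * monCount n)

open Classical in
/-- A finite set that contains all monomials in at most `n` letters. -/
def monStage (br : B → B → B) (sq : B → B) (g : ℕ → B) (k : ℕ) : ℕ → Finset B
  | 0 => {0, 1}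
  | n + 1 => monStage br sq g k n ∪ (monStage br sq g k n).image sq ∪
      {g k, g (k + 1), g (k + 2)} ∪
      (Finset.image₂ (· * ·) (monStage br sq g k n) (monStage br sq g k n) ∪
      Finset.image₂ br (monStage br sq g k n) (monStage br sq g k n))

variable {br : B → B → B} {adm : B → Prop} {sq : B → B} {g : ℕ → B} {k : ℕ}

open Classical in
theorem card_monStage_le (n : ℕ) : (monStage br sq g k n).card ≤ monCount n := by
  induction n with
  | zero => exact Finset.card_le_two
  | succ n ih =>
    have h1 := Finset.card_image_le (s := monStage br sq g k n) (f := sq)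
    have h2 : ({g k, g (k + 1), g (k + 2)} : Finset B).card ≤ 3 := Finset.card_le_three
    have h3 := Finset.card_image₂_le (· * ·) (monStage br sq g k n) (monStage br sq g k n)
    have h4 := Finset.card_image₂_le br (monStage br sq g k n) (monStage br sq g k n)
    have h5 := Nat.mul_le_mul ih ih
    rw [monStage, monCount]
    refine (Finset.card_union_le _ _).trans ?_
    have h6 := (Finset.card_union_le (monStage br sq g k n ∪ (monStage br sq g k n).image sq)
      {g k, g (k + 1), g (k + 2)})
    have h7 := Finset.card_union_le (monStage br sq g k n) ((monStage br sq g k n).image sq)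
    have h8 := Finset.card_union_le
      (Finset.image₂ (· * ·) (monStage br sq g k n) (monStage br sq g k n))
      (Finset.image₂ br (monStage br sq g k n) (monStage br sq g k n))
    convert (add_le_add (h6.trans (add_le_add (h7.trans (add_le_add ih (h1.trans ih))) h2))
      (h8.trans (add_le_add (h3.trans h5) (h4.trans h5)))) using 1
    ring

open Classical in
theorem monStage_mono : Monotone (monStage br sq g k) := by
  refine monotone_nat_of_le_succ fun n x hx => ?_
  rw [monStage]
  simp [hx]

open Classical in
theorem zero_mem_monStage (n : ℕ) : 0 ∈ monStage br sq g k n :=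
  monStage_mono (Nat.zero_le n) (by simp [monStage])

open Classical in
-- Each generator weighs at least `wt k`, so the weight bounds the number of letters. The constants
-- 0 and 1 weigh nothing, but every operation absorbs them and they do not raise the stage; for this
-- the square of 1 must not be admissible.
theorem WMon.exists_mem_monStage (h0l : ∀ b, br 0 b = 0) (h0r : ∀ a, br a 0 = 0)
    (h1l : ∀ b, br 1 b = 0) (h1r : ∀ a, br a 1 = 0) (ha : ¬ adm 1) (hs : sq 0 = 0)
    {n : ℕ} {a : B} (h : WMon br adm sq g k n a) :
    ∃ l, l * wt k ≤ n ∧ a ∈ monStage br sq g k l := by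
  have bin : ∀ (op : B → B → B), (∀ l, ∀ a ∈ monStage br sq g k l, ∀ b ∈ monStage br sq g k l,
      op a b ∈ monStage br sq g k (l + 1)) → (∀ b, op 0 b = 0) → (∀ a, op a 0 = 0) →
      (∀ b, op 1 b = b ∨ op 1 b = 0) → (∀ a, op a 1 = a ∨ op a 1 = 0) →
      ∀ m n a b, (∃ l, l * wt k ≤ m ∧ a ∈ monStage br sq g k l) →
      (∃ l, l * wt k ≤ n ∧ b ∈ monStage br sq g k l) →
      ∃ l, l * wt k ≤ m + n ∧ op a b ∈ monStage br sq g k l := by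
    rintro op hop z1 z2 o1 o2 m n a b ⟨l1, hl1, ha⟩ ⟨l2, hl2, hb⟩
    rcases Nat.eq_zero_or_pos l1 with rfl | p1
    · refine ⟨l2, by omega, ?_⟩
      rw [monStage, Finset.mem_insert, Finset.mem_singleton] at ha
      rcases ha with rfl | rfl
      · rw [z1]; exact zero_mem_monStage _
      · rcases o1 b with e | e <;> rw [e]
        · exact hb
        · exact zero_mem_monStage _
    rcases Nat.eq_zero_or_pos l2 with rfl | p2
    · refine ⟨l1, by omega, ?_⟩
      rw [monStage, Finset.mem_insert, Finset.mem_singleton] at hb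
      rcases hb with rfl | rfl
      · rw [z2]; exact zero_mem_monStage _
      · rcases o2 a with e | e <;> rw [e]
        · exact ha
        · exact zero_mem_monStage _
    -- As neither stage is zero, both factors lie in stage l1 + l2 - 1, and one operation leads to
    -- stage l1 + l2.
    refine ⟨(l1 + l2 - 1) + 1, ?_, hop _ _ (monStage_mono (by omega) ha) _
      (monStage_mono (by omega) hb)⟩
    rw [show l1 + l2 - 1 + 1 = l1 + l2 by omega, add_mul]
    omega
  induction h with
  | zero n => exact ⟨0, by simp, zero_mem_monStage _⟩
  | one => exact ⟨0, by simp, by simp [monStage]⟩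
  | gen j hj =>
    refine ⟨1, by rw [one_mul]; exact wt_mono (Nat.le_add_right _ _), ?_⟩
    rw [monStage]
    interval_cases j <;> simp
  | mul _ _ ih1 ih2 =>
    refine bin (· * ·) ?_ zero_mul mul_zero (fun b => Or.inl (one_mul b))
      (fun b => Or.inl (mul_one b)) _ _ _ _ ih1 ih2
    intro l a ha b hb
    rw [monStage]
    exact Finset.mem_union_right _ (Finset.mem_union_left _ (Finset.mem_image₂_of_mem ha hb))
  | bracket _ _ ih1 ih2 =>
    refine bin br ?_ h0l h0r (fun b => Or.inr (h1l b)) (fun b => Or.inr (h1r b)) _ _ _ _ ih1 ih2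
    intro l a ha b hb
    rw [monStage]
    exact Finset.mem_union_right _ (Finset.mem_union_right _ (Finset.mem_image₂_of_mem ha hb))
  | @square n a had _ ih =>
    obtain ⟨l, hl, hm⟩ := ih
    rcases Nat.eq_zero_or_pos l with rfl | p
    · refine ⟨0, by simp, ?_⟩
      rw [monStage, Finset.mem_insert, Finset.mem_singleton] at hm
      rcases hm with rfl | rfl
      · rw [hs]; exact zero_mem_monStage _
      · exact (ha had).elim
    · refine ⟨(2 * l - 1) + 1, ?_, ?_⟩
      · rw [show 2 * l - 1 + 1 = 2 * l by omega, mul_assoc]; omega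
      · rw [monStage]
        refine Finset.mem_union_left _ (Finset.mem_union_left _ (Finset.mem_union_right _ ?_))
        exact Finset.mem_image_of_mem _ (monStage_mono (by omega) hm)

variable (K) in
/-- The span of the monomials of weight at most `w`. -/
def monSpan (br : B → B → B) (adm : B → Prop) (sq : B → B) (g : ℕ → B) (k : ℕ) (w : ℤ) :
    Submodule K B :=
  Submodule.span K {a | ∃ n : ℕ, (n : ℤ) ≤ w ∧ WMon br adm sq g k n a}

theorem WMon.mem_monSpan {n : ℕ} {a : B} (h : WMon br adm sq g k n a) {w : ℤ} (hw : (n : ℤ) ≤ w) :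
    a ∈ monSpan K br adm sq g k w := Submodule.subset_span ⟨n, hw, h⟩

theorem monSpan_mono : Monotone (monSpan K br adm sq g k) :=
  fun _ _ hab => Submodule.span_mono fun _ ⟨n, hn, h⟩ => ⟨n, hn.trans hab, h⟩

theorem monSpan_le {F : ℤ → Submodule K B} (hF : Monotone F)
    (h : ∀ n a, WMon br adm sq g k n a → a ∈ F n) (w : ℤ) : monSpan K br adm sq g k w ≤ F w :=
  Submodule.span_le.2 fun a ⟨n, hn, ha⟩ => hF hn (h n a ha)

-- The bound sees only the ratio of w to `wt k` and not k itself; hence the last stage of the upper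
-- bound contributes a constant.
open Classical in
theorem finrank_monSpan_le (h0l : ∀ b, br 0 b = 0) (h0r : ∀ a, br a 0 = 0)
    (h1l : ∀ b, br 1 b = 0) (h1r : ∀ a, br a 1 = 0) (ha : ¬ adm 1) (hs : sq 0 = 0) (w : ℤ) :
    Module.Finite K (monSpan K br adm sq g k w) ∧ ∀ l : ℕ, w ≤ l * wt k →
      Module.finrank K (monSpan K br adm sq g k w) ≤ monCount l := by
  have key : ∀ l : ℕ, w ≤ l * wt k →
      monSpan K br adm sq g k w ≤ Submodule.span K (monStage br sq g k l : Set B) := by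
    intro l hl
    refine Submodule.span_mono ?_
    rintro a ⟨n, hn, h⟩
    obtain ⟨l', hl', hm⟩ := h.exists_mem_monStage h0l h0r h1l h1r ha hs
    refine monStage_mono ?_ hm
    have : l' * wt k ≤ l * wt k := by
      have : ((l' * wt k : ℕ) : ℤ) ≤ ((l * wt k : ℕ) : ℤ) := by
        push_cast
        exact le_trans (by exact_mod_cast hl') (hn.trans hl)
      exact_mod_cast this
    exact Nat.le_of_mul_le_mul_right this (wt_pos k)
  refine ⟨?_, fun l hl => ?_⟩
  · have := Module.Finite.span_finset K (monStage br sq g k w.toNat)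
    refine Submodule.finiteDimensional_of_le (key w.toNat ?_)
    have h1 := wt_pos k
    have h2 := Int.self_le_toNat w
    nlinarith
  · have := Module.Finite.span_finset K (monStage br sq g k l)
    refine (Submodule.finrank_mono (key l hl)).trans ?_
    exact (finrank_span_finset_le_card _).trans (card_monStage_le l)

end Monomials

/-! ## Adjoining a letter to a filtered family of subspaces -/

section Families

variable {K B : Type*} [Field K] [Ring B] [Algebra K B]

/-- A filtered family of subspaces that contains the unit and is closed under the product. -/
structure MulFamily (F : ℤ → Submodule K B) : Prop where
  mono : Monotone F
  one_mem : 1 ∈ F 0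
  mul_mem : ∀ {u w : ℤ} {a b : B}, a ∈ F u → b ∈ F w → a * b ∈ F (u + w)

/-- Adjoining a letter `z` of weight `c`. -/
def adjLetter (z : B) (c : ℤ) (F : ℤ → Submodule K B) (w : ℤ) : Submodule K B :=
  F w ⊔ (F (w - c)).map (LinearMap.mulLeft K z)

theorem mem_adjLetter {z : B} {c : ℤ} {F : ℤ → Submodule K B} {w : ℤ} {a : B} :
    a ∈ adjLetter z c F w ↔ ∃ f ∈ F w, ∃ g ∈ F (w - c), a = f + z * g := by
  rw [adjLetter, Submodule.mem_sup]
  constructor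
  · rintro ⟨f, hf, _, ⟨g, hg, rfl⟩, rfl⟩
    exact ⟨f, hf, g, hg, rfl⟩
  · rintro ⟨f, hf, g, hg, rfl⟩
    exact ⟨f, hf, _, ⟨g, hg, rfl⟩, rfl⟩

theorem le_adjLetter (z : B) (c : ℤ) (F : ℤ → Submodule K B) (w : ℤ) : F w ≤ adjLetter z c F w :=
  le_sup_left

theorem letter_mul_mem_adjLetter {z : B} {c : ℤ} {F : ℤ → Submodule K B} {w : ℤ} {g : B}
    (hg : g ∈ F (w - c)) : z * g ∈ adjLetter z c F w :=
  (le_sup_right : _ ≤ adjLetter z c F w) ⟨g, hg, rfl⟩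

theorem adjLetter_mono {z : B} {c : ℤ} {F : ℤ → Submodule K B} (hF : Monotone F) :
    Monotone (adjLetter z c F) :=
  fun _ _ h => sup_le_sup (hF h) (Submodule.map_mono (hF (by omega)))

theorem MulFamily.letter_mem {F : ℤ → Submodule K B} (hF : MulFamily F) (z : B) (c : ℤ) :
    z ∈ adjLetter z c F c := by
  have := letter_mul_mem_adjLetter (z := z) (c := c) (F := F) (w := c) (g := 1)
    (by rw [sub_self]; exact hF.one_mem)
  rwa [mul_one] at this

/-- By `hc` the element z moves to the left past any coefficient, with an error that is free of z
and has the expected weight. As z squares to zero, every product can be rewritten as f + z g. -/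
theorem MulFamily.adjLetter {F : ℤ → Submodule K B} (hF : MulFamily F) {z : B} {c : ℤ}
    (hz : z * z = 0) (hc : ∀ w, ∀ a ∈ F w, ∃ b ∈ F w, a * z - z * b ∈ F (w + c)) :
    MulFamily (adjLetter z c F) where
  mono := adjLetter_mono hF.mono
  one_mem := le_adjLetter z c F 0 hF.one_mem
  mul_mem := by
    intro u w a b ha hb
    obtain ⟨f, hf, g, hg, rfl⟩ := mem_adjLetter.1 ha
    obtain ⟨f', hf', g', hg', rfl⟩ := mem_adjLetter.1 hb
    obtain ⟨p, hp, hp'⟩ := hc _ f hf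
    obtain ⟨q, hq, hq'⟩ := hc _ g hg
    have e : (f + z * g) * (f' + z * g') = (f * f' + (f * z - z * p) * g') +
        z * (g * f' + p * g' + (g * z - z * q) * g') + (z * z) * (q * g') := by noncomm_ring
    rw [e, hz, zero_mul, add_zero]
    refine mem_adjLetter.2 ⟨_, add_mem (hF.mul_mem hf hf') ?_, _,
      add_mem (add_mem ?_ ?_) ?_, rfl⟩
    · have := hF.mul_mem hp' hg'
      rwa [show u + c + (w - c) = u + w by ring] at this
    · have := hF.mul_mem hg hf'
      rwa [show u - c + w = u + w - c by ring] at this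
    · have := hF.mul_mem hp hg'
      rwa [show u + (w - c) = u + w - c by ring] at this
    · have := hF.mul_mem hq' hg'
      rwa [show u - c + c + (w - c) = u + w - c by ring] at this

instance adjLetter_finite {z : B} {c : ℤ} {F : ℤ → Submodule K B}
    [∀ w, Module.Finite K (F w)] (w : ℤ) : Module.Finite K (adjLetter z c F w) := by
  unfold adjLetter; infer_instance

theorem finrank_adjLetter_le {z : B} {c : ℤ} {F : ℤ → Submodule K B}
    [∀ w, Module.Finite K (F w)] (w : ℤ) : Module.finrank K (adjLetter z c F w) ≤
      Module.finrank K (F w) + Module.finrank K (F (w - c)) := by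
  refine (Submodule.finrank_add_le_finrank_add_finrank _ _).trans ?_
  exact Nat.add_le_add_left (Submodule.finrank_map_le _ _) _

/-- The two letters give four coefficients, of weights u, u, u + wt(k) and u - wt(k); each is
bounded by the dimension at u + wt(k). -/
theorem finrank_le_four_pow {E : ℕ → ℤ → Submodule K B} [∀ k w, Module.Finite K (E k w)]
    (hE : ∀ k, Monotone (E k)) {x y : ℕ → B}
    (h : ∀ k w, E k w ≤ adjLetter (y k) (wt k) (adjLetter (x k) (-wt k) (E (k + 1))) w)
    (k : ℕ) (w : ℤ) :
    Module.finrank K (E 0 w) ≤ 4 ^ k * Module.finrank K (E k (w + wtSum k)) := by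
  induction k generalizing w with
  | zero =>
    have e : w + (wtSum 0 : ℤ) = w := by simp [wtSum]
    rw [e, pow_zero, one_mul]
  | succ k ih =>
    refine (ih w).trans ?_
    rw [pow_succ, mul_assoc]
    refine Nat.mul_le_mul_left _ ?_
    set u : ℤ := w + wtSum k
    have e : w + (wtSum (k + 1) : ℤ) = u + wt k := by
      rw [wtSum_succ]; push_cast; ring
    rw [e]
    refine (Submodule.finrank_mono (h k u)).trans ?_
    have h1 := finrank_adjLetter_le (z := y k) (c := wt k) (F := adjLetter (x k) (-wt k) (E (k + 1))) u
    have h2 := finrank_adjLetter_le (z := x k) (c := -wt k) (F := E (k + 1)) u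
    have h3 := finrank_adjLetter_le (z := x k) (c := -wt k) (F := E (k + 1)) (u - wt k)
    have hm : ∀ v, v ≤ u + wt k →
        Module.finrank K (E (k + 1) v) ≤ Module.finrank K (E (k + 1) (u + wt k)) :=
      fun v hv => Submodule.finrank_mono (hE (k + 1) hv)
    have m1 := hm u (by omega)
    have m2 := hm (u - -wt k) (by omega)
    have m3 := hm (u - wt k) (by omega)
    have m4 := hm (u - wt k - -wt k) (by omega)
    omega

/-- After k steps the weight is at most n + `wtSum k` ≤ 4 `wt k`, and the coefficient of the
adjoined letter has weight larger by `wt k`. So at most five letters remain, whence `monCount 5`;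
the factor 2 accounts for the adjoined letter. -/
theorem finrank_adjLetter_monSpan_le {br : B → B → B} {adm : B → Prop} {sq : B → B} {g x y : ℕ → B}
    (h0l : ∀ b, br 0 b = 0) (h0r : ∀ a, br a 0 = 0)
    (h1l : ∀ b, br 1 b = 0) (h1r : ∀ a, br a 1 = 0) (ha : ¬ adm 1) (hs : sq 0 = 0)
    (h : ∀ k w, adjLetter (x k) (-wt k) (monSpan K br adm sq g k) w ≤
      adjLetter (y k) (wt k) (adjLetter (x k) (-wt k)
        (adjLetter (x (k + 1)) (-wt (k + 1)) (monSpan K br adm sq g (k + 1)))) w)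
    {n k : ℕ} (hn : n ≤ wt k) :
    Module.Finite K (monSpan K br adm sq g 0 n) ∧
      Module.finrank K (monSpan K br adm sq g 0 n) ≤ 2 * monCount 5 * 4 ^ k := by
  have hfin : ∀ k w, Module.Finite K (monSpan K br adm sq g k w) :=
    fun k w => (finrank_monSpan_le h0l h0r h1l h1r ha hs w).1
  refine ⟨hfin _ _, ?_⟩
  refine (Submodule.finrank_mono
    (le_adjLetter (x 0) (-wt 0) (monSpan K br adm sq g 0) n)).trans ?_
  refine (finrank_le_four_pow (E := fun k => adjLetter (x k) (-wt k) (monSpan K br adm sq g k))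
    (fun k => adjLetter_mono monSpan_mono) h k n).trans ?_
  rw [mul_comm]
  refine Nat.mul_le_mul_right _ ((finrank_adjLetter_le _).trans ?_)
  have hS := wtSum_le k
  have b1 := (finrank_monSpan_le (K := K) (g := g) (k := k) h0l h0r h1l h1r ha hs
    ((n : ℤ) + wtSum k)).2 5 (by push_cast; omega)
  have b2 := (finrank_monSpan_le (K := K) (g := g) (k := k) h0l h0r h1l h1r ha hs
    ((n : ℤ) + wtSum k - -wt k)).2 5 (by push_cast; omega)
  omega

end Families

end FractalSuper

end

noncomputable section

namespace FractalSuper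

open Gr

/-! ## The truncated Poisson bracket -/

section TruncatedBracket

variable {K : Type*} [Field K]

/-- The letter `x_i` as a series. -/
def sx (K : Type*) [Field K] (i : ℕ) : Gr K Letter := letter K (lx i)

/-- The letter `y_i` as a series. -/
def sy (K : Type*) [Field K] (i : ℕ) : Gr K Letter := letter K (ly i)

/-- The pivot element as an element of the ring of Grassmann series. -/
def piv (K : Type*) [Field K] (i : ℕ) : Gr K Letter := V K i

/-- The Poisson bracket with respect to the letters with indices below `M`. -/
def br (M : ℕ) (f g : Gr K Letter) : Gr K Letter :=
  ∑ i ∈ Finset.range M, (par (der (lx i) f) * der (ly i) g + par (der (ly i) f) * der (lx i) g)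

/-- The formal square with respect to the letters with indices below `M`. -/
def sq (M : ℕ) (f : Gr K Letter) : Gr K Letter :=
  ∑ i ∈ Finset.range M, der (lx i) f * der (ly i) f

/-- The truncated Poisson bracket as a bilinear map. -/
def brL (M : ℕ) : Gr K Letter →ₗ[K] Gr K Letter →ₗ[K] Gr K Letter :=
  LinearMap.mk₂ K (br M)
    (fun f g h => by
      simp only [br, map_add, add_mul, ← Finset.sum_add_distrib]
      exact Finset.sum_congr rfl fun _ _ => by abel)
    (fun c f g => by
      simp only [br, map_smul, smul_mul_assoc, Finset.smul_sum, smul_add])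
    (fun f g h => by
      simp only [br, map_add, mul_add, ← Finset.sum_add_distrib]
      exact Finset.sum_congr rfl fun _ _ => by abel)
    (fun c f g => by
      simp only [br, map_smul, mul_smul_comm, Finset.smul_sum, smul_add])

theorem br_add_left (M : ℕ) (f g h : Gr K Letter) : br M (f + g) h = br M f h + br M g h :=
  LinearMap.map_add₂ (brL M) f g h

theorem br_add_right (M : ℕ) (f g h : Gr K Letter) : br M f (g + h) = br M f g + br M f h :=
  map_add (brL M f) g h

theorem br_neg_left (M : ℕ) (f g : Gr K Letter) : br M (-f) g = -br M f g :=
  LinearMap.map_neg₂ (brL M) f g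

theorem br_zero_left (M : ℕ) (g : Gr K Letter) : br M 0 g = 0 := LinearMap.map_zero₂ (brL M) g

theorem br_zero_right (M : ℕ) (f : Gr K Letter) : br M f 0 = 0 := map_zero (brL M f)

theorem br_one_left (M : ℕ) (g : Gr K Letter) : br M 1 g = 0 := by simp [br, der_one]

theorem br_one_right (M : ℕ) (f : Gr K Letter) : br M f 1 = 0 := by simp [br, der_one]

theorem sq_zero (M : ℕ) : sq M (0 : Gr K Letter) = 0 := by simp [sq]

theorem der_par (i : Letter) (f : Gr K Letter) : der i (par f) = -par (der i f) := by
  rw [par_der, neg_neg]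

theorem der_br (l : Letter) (M : ℕ) (f g : Gr K Letter) :
    der l (br M f g) = br M (der l f) g + br M (par f) (der l g) := by
  simp only [br, map_sum, ← Finset.sum_add_distrib]
  refine Finset.sum_congr rfl fun i _ => ?_
  simp only [map_add, der_mul, par_par, der_par, der_der l, map_neg, neg_neg]
  noncomm_ring

theorem der_sq (l : Letter) (M : ℕ) (f : Gr K Letter) : der l (sq M f) =
    -∑ i ∈ Finset.range M,
      (der (lx i) (der l f) * der (ly i) f + par (der (lx i) f) * der (ly i) (der l f)) := by
  rw [sq, map_sum, ← Finset.sum_neg_distrib]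
  refine Finset.sum_congr rfl fun i _ => ?_
  rw [der_mul, der_der l, der_der l]
  noncomm_ring

theorem der_letter_mul (i l : Letter) (g : Gr K Letter) :
    der i (letter K l * g) = (if i = l then g else 0) - letter K l * der i g := by
  rw [der_mul, der_letter, par_letter]
  split_ifs <;> noncomm_ring

theorem br_letter (l : Letter) (M : ℕ) (f : Gr K Letter) : br M (letter K l) f =
    ∑ i ∈ Finset.range M, ((if lx i = l then der (ly i) f else 0) +
      (if ly i = l then der (lx i) f else 0)) := by
  refine Finset.sum_congr rfl fun i _ => ?_
  rw [der_letter, der_letter]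
  split_ifs <;> simp [par_one]

theorem lx_inj {i j : ℕ} : lx i = lx j ↔ i = j :=
  ⟨fun h => by cases h; rfl, fun h => h ▸ rfl⟩

theorem br_sx (k M : ℕ) (f : Gr K Letter) :
    br M (sx K k) f = if k < M then der (ly k) f else 0 := by
  rw [sx, br_letter]
  simp only [lx_inj, (lx_ne_ly _ _).symm, if_false, add_zero, Finset.sum_ite_eq', Finset.mem_range]

theorem br_sy (k M : ℕ) (f : Gr K Letter) :
    br M (sy K k) f = if k < M then der (lx k) f else 0 := by
  rw [sy, br_letter]
  simp only [ly_inj, lx_ne_ly, if_false, zero_add, Finset.sum_ite_eq', Finset.mem_range]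

theorem br_letter_mul (l : Letter) (M : ℕ) (g f : Gr K Letter) :
    br M (letter K l * g) f = par g * br M (letter K l) f + letter K l * br M g f := by
  rw [br_letter, br, br, Finset.mul_sum, Finset.mul_sum, ← Finset.sum_add_distrib]
  refine Finset.sum_congr rfl fun i _ => ?_
  rw [der_letter_mul, der_letter_mul]
  simp only [map_sub, par_mul, par_letter]
  split_ifs <;> (try simp only [map_zero]) <;> noncomm_ring

theorem mul_letter' (l : Letter) (f g : Gr K Letter) :
    f * (letter K l * g) = letter K l * (par f * g) := by
  rw [← mul_assoc, mul_letter, mul_assoc]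

theorem br_mul_letter (l : Letter) (M : ℕ) (f g : Gr K Letter) :
    br M f (letter K l * g) = par (br M (letter K l) f) * g + letter K l * br M (par f) g := by
  rw [br_letter, br, br, map_sum, Finset.mul_sum, Finset.sum_mul, ← Finset.sum_add_distrib]
  refine Finset.sum_congr rfl fun i _ => ?_
  simp only [der_letter_mul, mul_sub, mul_letter', par_par, der_par, map_neg, map_add]
  split_ifs <;> (try simp only [map_zero]) <;> noncomm_ring

theorem br_letter_self (l : Letter) (M : ℕ) : br M (letter K l) (letter K l) = 0 := by
  rw [br_letter]
  refine Finset.sum_eq_zero fun i _ => ?_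
  rw [der_letter, der_letter]
  by_cases h1 : lx i = l
  · subst h1
    simp [(lx_ne_ly i i).symm]
  · simp [h1]

theorem Gr.IsHom.br {p q : ZMod 2} {f g : Gr K Letter} (M : ℕ) (hf : IsHom p f) (hg : IsHom q g) :
    IsHom (p + q) (br M f g) := by
  refine IsHom.sum fun i _ => ?_
  have e : p + q = (p + 1) + (q + 1) := by
    rw [add_add_add_comm, show (1 + 1 : ZMod 2) = 0 from rfl, add_zero]
  rw [e]
  exact IsHom.add ((hf.der _).par.mul (hg.der _)) ((hf.der _).par.mul (hg.der _))

theorem Gr.IsHom.sq {p : ZMod 2} {f : Gr K Letter} (M : ℕ) (hf : IsHom p f) :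
    IsHom (p + p) (sq M f) := by
  refine IsHom.sum fun i _ => ?_
  have e : p + p = (p + 1) + (p + 1) := by
    rw [add_add_add_comm, show (1 + 1 : ZMod 2) = 0 from rfl, add_zero]
  rw [e]
  exact (hf.der _).mul (hf.der _)

/-! ### The formal square in characteristic 2. -/

section CharTwo

variable (h2 : (2 : K) = 0)
include h2

theorem sq_add (M : ℕ) (f g : Gr K Letter) : sq M (f + g) = sq M f + sq M g + br M f g := by
  simp only [sq, br, ← Finset.sum_add_distrib]
  refine Finset.sum_congr rfl fun i _ => ?_
  rw [par_eq_self h2, par_eq_self h2, mul_comm_of_two h2 (der (ly i) f)]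
  simp only [map_add]
  noncomm_ring

theorem sq_letter_mul (M : ℕ) (l : Letter) (g : Gr K Letter) :
    sq M (letter K l * g) = letter K l * (g * br M (letter K l) g) := by
  rw [br_letter, sq, Finset.mul_sum, Finset.mul_sum]
  refine Finset.sum_congr rfl fun i _ => ?_
  have e : ∀ a b : Gr K Letter, letter K l * a * (letter K l * b) = 0 := fun a b => by
    rw [mul_comm_of_two h2 _ a, mul_assoc, ← mul_assoc (letter K l), letter_sq, zero_mul, mul_zero]
  rw [der_letter_mul, der_letter_mul]
  by_cases hx : lx i = l
  · have hy : ly i ≠ l := fun hy => lx_ne_ly i i (hx.trans hy.symm)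
    rw [if_pos hx, if_neg hy, if_pos hx, if_neg hy, sub_mul, zero_sub, mul_neg, mul_neg, e,
      neg_zero, sub_zero, add_zero, neg_eq_self h2, mul_letter', par_eq_self h2]
  · rw [if_neg hx, if_neg hx, zero_sub, zero_add, neg_mul, mul_sub, e, sub_zero, neg_eq_self h2]
    split_ifs
    · rw [mul_assoc, mul_comm_of_two h2 g]
    · simp

theorem der_sq_of_two (l : Letter) (M : ℕ) (f : Gr K Letter) :
    der l (sq M f) = br M f (der l f) := by
  rw [der_sq, neg_eq_self h2]
  refine Finset.sum_congr rfl fun i _ => ?_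
  rw [par_eq_self h2, par_eq_self h2, mul_comm_of_two h2 (der (ly i) f), add_comm]

end CharTwo

theorem sq_smul (M : ℕ) (c : K) (f : Gr K Letter) : sq M (c • f) = c • c • sq M f := by
  simp only [sq, map_smul, smul_mul_assoc, mul_smul_comm, Finset.smul_sum]

end TruncatedBracket

/-! ## Pivot elements -/

section Pivot

variable {K : Type*} [Field K]

theorem pivotLetters_zero (n : ℕ) : pivotLetters n 0 = {ly n} := by simp [pivotLetters]

theorem pivotLetters_succ (n l : ℕ) :
    pivotLetters n (l + 1) = insert (lx n) (insert (lx (n + 1)) (pivotLetters (n + 3) l)) := by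
  have e : ∀ j, n + 3 * (j + 1) = n + 3 + 3 * j := fun j => by ring
  ext s
  simp only [pivotLetters, Finset.mem_insert, Finset.mem_biUnion, Finset.mem_range,
    Finset.mem_singleton, e]
  constructor
  · rintro (h | ⟨j, hj, h⟩)
    · exact Or.inr (Or.inr (Or.inl h))
    · rcases j with _ | j
      · rcases h with h | h
        · exact Or.inl (by simpa using h)
        · exact Or.inr (Or.inl (by simpa using h))
      · rw [e] at h
        exact Or.inr (Or.inr (Or.inr ⟨j, by omega, h⟩))
  · rintro (h | h | h | ⟨j, hj, h⟩)
    · exact Or.inr ⟨0, by omega, Or.inl (by simpa using h)⟩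
    · exact Or.inr ⟨0, by omega, Or.inr (by simpa using h)⟩
    · exact Or.inl h
    · exact Or.inr ⟨j + 1, by omega, by rwa [e]⟩

theorem le_of_mem_pivotLetters {n l : ℕ} : ∀ i, lx i ∈ pivotLetters n l ∨ ly i ∈ pivotLetters n l →
    n ≤ i := by
  induction l generalizing n with
  | zero =>
    intro i
    rw [pivotLetters_zero, Finset.mem_singleton, Finset.mem_singleton, ly_inj]
    rintro (h | h)
    · exact (lx_ne_ly _ _ h).elim
    · omega
  | succ l ih =>
    intro i
    simp only [pivotLetters_succ, Finset.mem_insert, lx_inj, (lx_ne_ly _ _).symm, false_or]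
    have := @ih (n + 3) i
    rintro ((h | h | h) | h)
    · omega
    · omega
    · have := this (Or.inl h); omega
    · have := this (Or.inr h); omega

theorem lx_notMem_pivotLetters {n l i : ℕ} (h : i < n) : lx i ∉ pivotLetters n l :=
  fun h' => absurd (le_of_mem_pivotLetters i (Or.inl h')) (by omega)

theorem ly_notMem_pivotLetters {n l i : ℕ} (h : i < n) : ly i ∉ pivotLetters n l :=
  fun h' => absurd (le_of_mem_pivotLetters i (Or.inr h')) (by omega)

theorem lx_notMem_insert_pivotLetters (n l : ℕ) :
    lx n ∉ insert (lx (n + 1)) (pivotLetters (n + 3) l) := by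
  rw [Finset.mem_insert, lx_inj]
  rintro (h | h)
  · omega
  · exact lx_notMem_pivotLetters (by omega) h

theorem card_pivotLetters (n l : ℕ) : (pivotLetters n l).card = 2 * l + 1 := by
  induction l generalizing n with
  | zero => rw [pivotLetters_zero]; simp
  | succ l ih =>
    rw [pivotLetters_succ, Finset.card_insert_of_notMem (lx_notMem_insert_pivotLetters n l),
      Finset.card_insert_of_notMem (lx_notMem_pivotLetters (by omega)), ih]
    ring

theorem piv_apply_pivotLetters (n l : ℕ) : piv K n (pivotLetters n l) = 1 := by
  classical
  exact if_pos ⟨l, rfl⟩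

theorem exists_of_piv_ne {n : ℕ} {S : Finset Letter} (h : piv K n S ≠ 0) :
    ∃ l, S = pivotLetters n l := by
  classical
  by_contra hc
  exact h (if_neg hc)

theorem piv_isHom (n : ℕ) : IsHom 1 (piv K n) := by
  intro S h
  obtain ⟨l, rfl⟩ := exists_of_piv_ne h
  rw [card_pivotLetters, ← odd_iff_cast]
  exact ⟨l, rfl⟩

theorem par_piv (n : ℕ) : par (piv K n) = -piv K n := by
  rw [par_eq, (piv_isHom n).oddPart_one, two_smul]
  abel

theorem lx_lt_iff {i j : ℕ} : lx i < lx j ↔ i < j := by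
  simp [lx]

theorem lx_lt_ly (i j : ℕ) : lx i < ly j := by
  simp [lx, ly]

theorem letter_cases (s : Letter) : (∃ i, s = lx i) ∨ ∃ i, s = ly i := by
  rcases h : ofLex s with i | i
  · exact Or.inl ⟨i, by rw [lx, ← h]; rfl⟩
  · exact Or.inr ⟨i, by rw [ly, ← h]; rfl⟩

theorem lt_of_mem_pivotLetters {n l i : ℕ} (h : i < n) : ∀ s ∈ pivotLetters n l, lx i < s := by
  intro s hs
  rcases letter_cases s with ⟨j, rfl⟩ | ⟨j, rfl⟩
  · have := le_of_mem_pivotLetters j (Or.inl hs)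
    exact lx_lt_iff.2 (by omega)
  · exact lx_lt_ly i j

/-- The self-similarity on which both bounds rest. No sign appears because x_n and x_{n+1} precede
all letters of V_{n+3} in the chosen order. -/
theorem piv_eq (n : ℕ) : piv K n = sy K n + sx K n * (sx K (n + 1) * piv K (n + 3)) := by
  have hz : ∀ l, (sx K n * (sx K (n + 1) * piv K (n + 3))) (pivotLetters n (l + 1)) = 1 := by
    intro l
    rw [pivotLetters_succ]
    refine (letter_mul_apply_of_lt (fun s => Finset.mem_insert) ?_).trans
      ((letter_mul_apply_of_lt (fun s => Finset.mem_insert)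
        (lt_of_mem_pivotLetters (by omega))).trans (piv_apply_pivotLetters _ _))
    intro s hs
    rcases Finset.mem_insert.1 hs with rfl | hs
    · exact lx_lt_iff.2 (by omega)
    · exact lt_of_mem_pivotLetters (by omega) s hs
  have hn : ∀ U, (sx K n * (sx K (n + 1) * piv K (n + 3))) U ≠ 0 →
      ∃ l, U = pivotLetters n (l + 1) := by
    intro U h
    obtain ⟨T, hT, h⟩ := exists_of_letter_mul_ne h
    obtain ⟨T', hT', h⟩ := exists_of_letter_mul_ne h
    obtain ⟨l, rfl⟩ := exists_of_piv_ne h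
    refine ⟨l, ?_⟩
    rw [pivotLetters_succ]
    ext s
    rw [hT, hT', Finset.mem_insert, Finset.mem_insert]
  ext U
  rw [Gr.add_apply, sy, letter_apply]
  by_cases h : ∃ l, U = pivotLetters n l
  · obtain ⟨l, rfl⟩ := h
    rw [piv_apply_pivotLetters]
    rcases l with _ | l
    · rw [if_pos (pivotLetters_zero n)]
      by_cases h0 : (sx K n * (sx K (n + 1) * piv K (n + 3))) (pivotLetters n 0) = 0
      · rw [h0, add_zero]
      · obtain ⟨l, hl⟩ := hn _ h0
        have := congrArg Finset.card hl
        rw [card_pivotLetters, card_pivotLetters] at this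
        omega
    · rw [hz, if_neg, zero_add]
      intro hl
      have := congrArg Finset.card hl
      rw [card_pivotLetters, Finset.card_singleton] at this
      omega
  · rw [if_neg fun hU => h ⟨0, hU.trans (pivotLetters_zero n).symm⟩, zero_add]
    have e1 : piv K n U = 0 := by
      by_contra hc
      exact h (exists_of_piv_ne hc)
    rw [e1]
    by_contra hc
    obtain ⟨l, hl⟩ := hn U (Ne.symm hc)
    exact h ⟨_, hl⟩

theorem der_piv_of_notMem {n : ℕ} {s : Letter} (h : ∀ l, s ∉ pivotLetters n l) :
    der s (piv K n) = 0 := by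
  ext S
  by_contra hc
  obtain ⟨U, hU, hne⟩ := exists_of_der_ne hc
  obtain ⟨l, rfl⟩ := exists_of_piv_ne hne
  exact h l ((hU s).2 (Or.inl rfl))

theorem der_lx_piv {i n : ℕ} (h : i < n) : der (lx i) (piv K n) = 0 :=
  der_piv_of_notMem fun _ => lx_notMem_pivotLetters h

theorem der_ly_piv {i n : ℕ} (h : i < n) : der (ly i) (piv K n) = 0 :=
  der_piv_of_notMem fun _ => ly_notMem_pivotLetters h

theorem der_ly_piv_self (n : ℕ) : der (ly n) (piv K n) = 1 := by
  rw [piv_eq, map_add, sy, der_letter, if_pos rfl, sx, der_letter_mul, if_neg (lx_ne_ly _ _).symm,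
    sx, der_letter_mul, if_neg (lx_ne_ly _ _).symm, der_ly_piv (by omega)]
  simp

end Pivot

end FractalSuper

end

noncomputable section

namespace FractalSuper

open Gr

/-! ## Filtered families closed under the Poisson operations -/

section PoissonFamilies

variable {K : Type*} [Field K]

/-- A filtered family of subspaces closed under the operations of a Poisson superalgebra. -/
structure PoissonFamily (M : ℕ) (F : ℤ → Submodule K (Gr K Letter)) : Prop extends
    MulFamily F where
  br_mem : ∀ {u w : ℤ} {a b : Gr K Letter}, a ∈ F u → b ∈ F w → br M a b ∈ F (u + w)
  sq_mem : ∀ {w : ℤ} {a : Gr K Letter}, (2 : K) = 0 → a ∈ F w → oddPart a = a →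
    sq M a ∈ F (2 * w)
  odd_mem : ∀ {w : ℤ} {a : Gr K Letter}, a ∈ F w → oddPart a ∈ F w

theorem PoissonFamily.par_mem {M : ℕ} {F : ℤ → Submodule K (Gr K Letter)}
    (hF : PoissonFamily M F) {w : ℤ} {a : Gr K Letter} (ha : a ∈ F w) : par a ∈ F w := by
  rw [par_eq]
  exact sub_mem ha (Submodule.smul_mem _ _ (hF.odd_mem ha))

/-- The bracket with the letter l maps the family to itself with shift c, so the Leibniz rule brings
every bracket to the form f + l g. In characteristic 2 the square of f + l g is f^[2] + l g {l, g} +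
{f, l g}. -/
theorem PoissonFamily.adjLetter {M : ℕ} {F : ℤ → Submodule K (Gr K Letter)}
    (hF : PoissonFamily M F) {l : Letter} {c : ℤ}
    (hc : ∀ w, ∀ a ∈ F w, br M (letter K l) a ∈ F (w + c)) :
    PoissonFamily M (adjLetter (letter K l) c F) := by
  have hmul : MulFamily (FractalSuper.adjLetter (letter K l) c F) :=
    hF.toMulFamily.adjLetter (letter_sq l) fun w a ha =>
      ⟨par a, hF.par_mem ha, by rw [mul_letter, sub_self]; exact zero_mem _⟩
  have hbr : ∀ {u w : ℤ} {a b : Gr K Letter}, a ∈ FractalSuper.adjLetter (letter K l) c F u →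
      b ∈ FractalSuper.adjLetter (letter K l) c F w →
      br M a b ∈ FractalSuper.adjLetter (letter K l) c F (u + w) := by
    intro u w a b ha hb
    obtain ⟨f, hf, g, hg, rfl⟩ := mem_adjLetter.1 ha
    obtain ⟨f', hf', g', hg', rfl⟩ := mem_adjLetter.1 hb
    have e : br M (f + letter K l * g) (f' + letter K l * g') =
        (br M f f' + par g * br M (letter K l) f' + par (br M (letter K l) f) * g') +
        letter K l * (br M g f' + br M (par f) g' - g * br M (letter K l) g' +
          par (br M (letter K l) g) * g') := by
      rw [br_add_left, br_add_right, br_add_right, br_mul_letter, br_letter_mul, br_letter_mul,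
        br_mul_letter, br_mul_letter, br_letter_self, par_letter, br_neg_left]
      simp only [map_zero, zero_mul, zero_add, mul_neg, mul_add, mul_sub, mul_letter', par_par]
      simp only [← mul_assoc, par_letter, neg_mul, mul_neg, letter_sq, zero_mul, neg_zero, add_zero]
      abel
    rw [e]
    refine mem_adjLetter.2 ⟨_, add_mem (add_mem (hF.br_mem hf hf') ?_) ?_, _,
      add_mem (sub_mem (add_mem ?_ ?_) ?_) ?_, rfl⟩
    · have := hF.mul_mem (hF.par_mem hg) (hc _ _ hf')
      rwa [show u - c + (w + c) = u + w by ring] at this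
    · have := hF.mul_mem (hF.par_mem (hc _ _ hf)) hg'
      rwa [show u + c + (w - c) = u + w by ring] at this
    · have := hF.br_mem hg hf'
      rwa [show u - c + w = u + w - c by ring] at this
    · have := hF.br_mem (hF.par_mem hf) hg'
      rwa [show u + (w - c) = u + w - c by ring] at this
    · have := hF.mul_mem hg (hc _ _ hg')
      rwa [show u - c + (w - c + c) = u + w - c by ring] at this
    · have := hF.mul_mem (hF.par_mem (hc _ _ hg)) hg'
      rwa [show u - c + c + (w - c) = u + w - c by ring] at this
  refine { hmul with br_mem := hbr, sq_mem := ?_, odd_mem := ?_ }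
  · intro w a h2 ha hodd
    obtain ⟨f, hf, g, hg, rfl⟩ := mem_adjLetter.1 ha
    rw [map_add, oddPart_letter_mul] at hodd
    -- As the sum is odd, f may be replaced by its odd part and g by its even part; then the square
    -- of f is available in the family.
    rw [← hodd, sq_add h2, sq_letter_mul h2]
    have hg1 := sub_mem hg (hF.odd_mem hg)
    refine add_mem (add_mem ?_ ?_) ?_
    · exact le_adjLetter _ _ _ _ (hF.sq_mem h2 (hF.odd_mem hf) (oddPart_oddPart f))
    · refine letter_mul_mem_adjLetter ?_
      have := hF.mul_mem hg1 (hc _ _ hg1)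
      rwa [show w - c + (w - c + c) = 2 * w - c by ring] at this
    · have := hbr (le_adjLetter (letter K l) c F w (hF.odd_mem hf))
        (letter_mul_mem_adjLetter (z := letter K l) hg1)
      rwa [← two_mul] at this
  · intro w a ha
    obtain ⟨f, hf, g, hg, rfl⟩ := mem_adjLetter.1 ha
    rw [map_add, oddPart_letter_mul]
    exact mem_adjLetter.2 ⟨_, hF.odd_mem hf, _, sub_mem hg (hF.odd_mem hg), rfl⟩

/-- The elements whose formal squares are available: odd elements in characteristic 2. -/
def SqAdm (f : Gr K Letter) : Prop := (2 : K) = 0 ∧ IsOddSeries (K := K) (I := Letter) f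

theorem not_sqAdm_one : ¬ SqAdm (1 : Gr K Letter) := by
  rintro ⟨-, h⟩
  have := h ∅ (by simp [one_def, gone])
  simp at this

variable (K) in
/-- The span of the Poisson monomials in `V_k, V_{k+1}, V_{k+2}` of weight at most `w`. -/
def pivSpan (M k : ℕ) (w : ℤ) : Submodule K (Gr K Letter) :=
  monSpan K (br M) SqAdm (sq M) (piv K) k w

theorem WMon.isHom {M k n : ℕ} {f : Gr K Letter}
    (h : WMon (br M) SqAdm (sq M) (piv K) k n f) : ∃ p, IsHom p f := by
  induction h with
  | zero n => exact ⟨0, IsHom.zero 0⟩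
  | one => exact ⟨0, IsHom.one⟩
  | gen j _ => exact ⟨1, piv_isHom _⟩
  | mul _ _ ih1 ih2 =>
    obtain ⟨p, hp⟩ := ih1
    obtain ⟨q, hq⟩ := ih2
    exact ⟨_, hp.mul hq⟩
  | bracket _ _ ih1 ih2 =>
    obtain ⟨p, hp⟩ := ih1
    obtain ⟨q, hq⟩ := ih2
    exact ⟨_, hp.br M hq⟩
  | square _ _ ih =>
    obtain ⟨p, hp⟩ := ih
    exact ⟨_, hp.sq M⟩

theorem Gr.IsHom.oddPart_eq {p : ZMod 2} {f : Gr K Letter} (h : IsHom p f) :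
    oddPart f = f ∨ oddPart f = 0 := by
  fin_cases p
  · exact Or.inr h.oddPart_zero
  · exact Or.inl h.oddPart_one

theorem bilinear_mem_of_span {B : Type*} [AddCommGroup B] [Module K B] (T : B →ₗ[K] B →ₗ[K] B)
    {S S' : Set B} {W : Submodule K B} (h : ∀ a ∈ S, ∀ b ∈ S', T a b ∈ W) {a b : B}
    (ha : a ∈ Submodule.span K S) (hb : b ∈ Submodule.span K S') : T a b ∈ W := by
  have : Submodule.map₂ T (Submodule.span K S) (Submodule.span K S') ≤ W := by
    rw [Submodule.map₂_span_span, Submodule.span_le]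
    rintro _ ⟨a, ha, b, hb, rfl⟩
    exact h a ha b hb
  exact this (Submodule.apply_mem_map₂ T ha hb)

theorem monSpan_mulFamily {B : Type*} [Ring B] [Algebra K B] (br : B → B → B) (adm : B → Prop)
    (sq : B → B) (g : ℕ → B) (k : ℕ) : MulFamily (monSpan K br adm sq g k) where
  mono := monSpan_mono
  one_mem := WMon.one.mem_monSpan (by simp)
  mul_mem := by
    intro u w a b ha hb
    refine bilinear_mem_of_span (LinearMap.mul K B) ?_ ha hb
    rintro a ⟨m, hm, ha⟩ b ⟨n, hn, hb⟩
    exact (ha.mul hb).mem_monSpan (by push_cast; omega)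

/-- Monomials are homogeneous, so taking the odd part of a combination only drops terms. The formal
square is quadratic with the bracket as polar form, hence it is controlled by its values on odd
monomials. -/
theorem pivSpan_family (M k : ℕ) : PoissonFamily M (pivSpan K M k) := by
  have hbr : ∀ {u w : ℤ} {a b : Gr K Letter}, a ∈ pivSpan K M k u → b ∈ pivSpan K M k w →
      br M a b ∈ pivSpan K M k (u + w) := by
    intro u w a b ha hb
    refine bilinear_mem_of_span (brL M) ?_ ha hb
    rintro a ⟨m, hm, ha⟩ b ⟨n, hn, hb⟩
    exact (ha.bracket hb).mem_monSpan (by push_cast; omega)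
  have hodd : ∀ {w : ℤ} {a : Gr K Letter}, a ∈ pivSpan K M k w →
      oddPart a ∈ pivSpan K M k w := by
    intro w a ha
    have : pivSpan K M k w ≤ (pivSpan K M k w).comap oddPart := by
      refine Submodule.span_le.2 ?_
      rintro a ⟨n, hn, ha⟩
      obtain ⟨p, hp⟩ := ha.isHom
      rw [SetLike.mem_coe, Submodule.mem_comap]
      rcases hp.oddPart_eq with e | e <;> rw [e]
      · exact ha.mem_monSpan hn
      · exact zero_mem _
    exact this ha
  refine { monSpan_mulFamily _ _ _ _ _ with br_mem := hbr, sq_mem := ?_, odd_mem := hodd }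
  intro w a h2 ha hoa
  have key : ∀ a ∈ pivSpan K M k w, sq M (oddPart a) ∈ pivSpan K M k (2 * w) := by
    intro a ha
    induction ha using Submodule.span_induction with
    | mem a h =>
      obtain ⟨n, hn, ha⟩ := h
      obtain ⟨p, hp⟩ := ha.isHom
      rcases hp.oddPart_eq with e | e
      · have := (oddPart_eq_self_iff a).1 e
        rw [e]
        exact (WMon.square ⟨h2, this⟩ ha).mem_monSpan (by push_cast; omega)
      · rw [e, sq_zero]
        exact zero_mem _
    | zero => rw [map_zero, sq_zero]; exact zero_mem _
    | add a b ha hb iha ihb =>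
      rw [map_add, sq_add h2]
      refine add_mem (add_mem iha ihb) ?_
      have := hbr (hodd ha) (hodd hb)
      rwa [← two_mul] at this
    | smul c a _ iha =>
      rw [map_smul, sq_smul]
      exact Submodule.smul_mem _ _ (Submodule.smul_mem _ _ iha)
  rw [← hoa]
  exact key a ha

/-- This derivation sends V_k to 1, kills the later pivot elements, and obeys the Leibniz rule for
products and brackets; so it erases one occurrence of V_k at a time. It is the bracket with x_k,
which allows x_k to be adjoined. -/
theorem der_ly_mem_pivSpan {M k : ℕ} {w : ℤ} {f : Gr K Letter} (hf : f ∈ pivSpan K M k w) :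
    der (ly k) f ∈ pivSpan K M k (w - wt k) := by
  have hF := pivSpan_family (K := K) M k
  have key : ∀ n f, WMon (br M) SqAdm (sq M) (piv K) k n f →
      der (ly k) f ∈ pivSpan K M k ((n : ℤ) - wt k) := by
    intro n f h
    induction h with
    | zero n => rw [map_zero]; exact zero_mem _
    | one => rw [der_one]; exact zero_mem _
    | gen j hj =>
      rcases Nat.eq_zero_or_pos j with rfl | p
      · rw [add_zero, der_ly_piv_self, sub_self]
        exact hF.one_mem
      · rw [der_ly_piv (by omega)]
        exact zero_mem _
    | @mul m n a b ha hb ih1 ih2 =>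
      rw [der_mul]
      have h1 := hF.mul_mem ih1 (hb.mem_monSpan le_rfl)
      have h2 := hF.mul_mem (hF.par_mem (ha.mem_monSpan le_rfl)) ih2
      refine add_mem ?_ ?_
      · rwa [show (m : ℤ) - wt k + n = (m + n : ℕ) - wt k by push_cast; ring] at h1
      · rwa [show (m : ℤ) + (n - wt k) = (m + n : ℕ) - wt k by push_cast; ring] at h2
    | @bracket m n a b ha hb ih1 ih2 =>
      rw [der_br]
      have h1 := hF.br_mem ih1 (hb.mem_monSpan le_rfl)
      have h2 := hF.br_mem (hF.par_mem (ha.mem_monSpan le_rfl)) ih2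
      refine add_mem ?_ ?_
      · rwa [show (m : ℤ) - wt k + n = (m + n : ℕ) - wt k by push_cast; ring] at h1
      · rwa [show (m : ℤ) + (n - wt k) = (m + n : ℕ) - wt k by push_cast; ring] at h2
    | @square n a had ha ih =>
      rw [der_sq_of_two had.1]
      have h1 := hF.br_mem (ha.mem_monSpan le_rfl) ih
      rwa [show (n : ℤ) + (n - wt k) = (2 * n : ℕ) - wt k by push_cast; ring] at h1
  refine (monSpan_le (F := fun w => (pivSpan K M k (w - wt k)).comap (der (ly k))) ?_ key w) hf
  intro u v huv
  exact Submodule.comap_mono (hF.mono (by omega))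

theorem pivSpan_le_ker {M k : ℕ} {s : Letter} (hs : ∀ n, k ≤ n → der s (piv K n) = 0) (w : ℤ) :
    pivSpan K M k w ≤ LinearMap.ker (der s) := by
  refine Submodule.span_le.2 ?_
  rintro a ⟨n, hn, ha⟩
  clear hn
  rw [SetLike.mem_coe, LinearMap.mem_ker]
  induction ha with
  | zero => exact map_zero _
  | one => exact der_one s
  | gen j hj => exact hs _ (Nat.le_add_right k j)
  | mul _ _ ih1 ih2 => rw [der_mul, ih1, ih2, zero_mul, mul_zero, add_zero]
  | bracket _ _ ih1 ih2 => rw [der_br, ih1, ih2, br_zero_left, br_zero_right, add_zero]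
  | square _ _ ih => rw [der_sq, ih]; simp

variable (K) in
/-- The span of the Poisson monomials in `V_k, V_{k+1}, V_{k+2}`, with the letter `x_k` adjoined. -/
def pivSpanAdj (M k : ℕ) : ℤ → Submodule K (Gr K Letter) :=
  adjLetter (sx K k) (-wt k) (pivSpan K M k)

theorem pivSpanAdj_family (M k : ℕ) : PoissonFamily M (pivSpanAdj K M k) := by
  refine (pivSpan_family M k).adjLetter fun w a ha => ?_
  have := br_sx k M a
  rw [sx] at this
  rw [this]
  split_ifs
  · exact der_ly_mem_pivSpan ha
  · exact zero_mem _

theorem pivSpanAdj_le_ker {M k : ℕ} {s : Letter} (hs : ∀ n, k ≤ n → der s (piv K n) = 0)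
    (hs' : s ≠ lx k) (w : ℤ) : pivSpanAdj K M k w ≤ LinearMap.ker (der s) := by
  intro a ha
  obtain ⟨f, hf, g, hg, rfl⟩ := mem_adjLetter.1 ha
  rw [LinearMap.mem_ker, map_add, sx, der_letter_mul, if_neg hs',
    LinearMap.mem_ker.1 (pivSpan_le_ker hs _ hf), LinearMap.mem_ker.1 (pivSpan_le_ker hs _ hg)]
  simp

theorem der_lx_pivSpanAdj {M k : ℕ} {w : ℤ} {a : Gr K Letter} (ha : a ∈ pivSpanAdj K M (k + 1) w) :
    der (lx k) a = 0 :=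
  pivSpanAdj_le_ker (fun _ h => der_lx_piv h) (by rw [Ne, lx_inj]; omega) w ha

theorem der_ly_pivSpanAdj {M k : ℕ} {w : ℤ} {a : Gr K Letter} (ha : a ∈ pivSpanAdj K M (k + 1) w) :
    der (ly k) a = 0 :=
  pivSpanAdj_le_ker (fun _ h => der_ly_piv h) (lx_ne_ly _ _).symm w ha

/-- The recursive step of the upper bound. The letters x_k and y_k have zero bracket with everything
built from x_{k+1} and the later pivot elements, and {y_k, x_k} = 1 has weight 0, so both can be
adjoined. Since V_k involves x_{k+1}, each family must carry its own letter. -/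
theorem pivSpanAdj_le (M k : ℕ) (w : ℤ) : pivSpanAdj K M k w ≤
    adjLetter (sy K k) (wt k) (adjLetter (sx K k) (-wt k) (pivSpanAdj K M (k + 1))) w := by
  have hE := pivSpanAdj_family (K := K) M (k + 1)
  have h1 : PoissonFamily M (adjLetter (sx K k) (-wt k) (pivSpanAdj K M (k + 1))) := by
    refine hE.adjLetter fun w a ha => ?_
    have := br_sx k M a
    rw [sx] at this
    rw [this, der_ly_pivSpanAdj ha, ite_self]
    exact zero_mem _
  have hT : PoissonFamily M
      (adjLetter (sy K k) (wt k) (adjLetter (sx K k) (-wt k) (pivSpanAdj K M (k + 1)))) := by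
    refine h1.adjLetter fun w a ha => ?_
    have := br_sy k M a
    rw [sy] at this
    rw [this]
    split_ifs
    · obtain ⟨f, hf, g, hg, rfl⟩ := mem_adjLetter.1 ha
      rw [map_add, sx, der_letter_mul, if_pos rfl, der_lx_pivSpanAdj hf, der_lx_pivSpanAdj hg,
        mul_zero, sub_zero, zero_add]
      refine le_adjLetter _ _ _ _ ?_
      rwa [sub_neg_eq_add] at hg
    · exact zero_mem _
  have hup : ∀ w, pivSpanAdj K M (k + 1) w ≤
      adjLetter (sy K k) (wt k) (adjLetter (sx K k) (-wt k) (pivSpanAdj K M (k + 1))) w :=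
    fun w => (le_adjLetter _ _ _ w).trans (le_adjLetter _ _ _ w)
  have hgen : ∀ j, k + 1 ≤ j → j ≤ k + 3 → piv K j ∈ pivSpanAdj K M (k + 1) (wt j) := by
    intro j h1 h2
    obtain ⟨i, rfl⟩ : ∃ i, j = k + 1 + i := ⟨j - (k + 1), by omega⟩
    exact le_adjLetter _ _ _ _ ((WMon.gen i (by omega)).mem_monSpan le_rfl)
  have hx : sx K k ∈
      adjLetter (sy K k) (wt k) (adjLetter (sx K k) (-wt k) (pivSpanAdj K M (k + 1))) (-wt k) :=
    le_adjLetter _ _ _ _ (hE.toMulFamily.letter_mem _ _)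
  have hmon : ∀ n a, WMon (br M) SqAdm (sq M) (piv K) k n a → a ∈
      adjLetter (sy K k) (wt k) (adjLetter (sx K k) (-wt k) (pivSpanAdj K M (k + 1))) n := by
    intro n a ha
    induction ha with
    | zero n => exact zero_mem _
    | one => exact_mod_cast hT.one_mem
    | gen j hj =>
      rcases Nat.eq_zero_or_pos j with rfl | p
      · rw [add_zero, piv_eq]
        refine add_mem (h1.toMulFamily.letter_mem _ _) ?_
        refine le_adjLetter _ _ _ _ (letter_mul_mem_adjLetter ?_)
        -- The weight of x_{k+1} V_{k+3} is wt(k+3) - wt(k+1) = 2 wt(k); the factor x_k reduces it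
        -- to wt(k), the weight of V_k. Here the recursion for `wt` is used.
        have := hE.mul_mem ((pivSpan_family (K := K) M (k + 1)).toMulFamily.letter_mem
          (sx K (k + 1)) (-wt (k + 1))) (hgen (k + 3) (by omega) le_rfl)
        rwa [wt_add_three, show -(wt (k + 1) : ℤ) + (wt (k + 1) + 2 * wt k : ℕ) =
          (wt k : ℤ) - -wt k by push_cast; ring] at this
      · exact hup _ (hgen _ (by omega) (by omega))
    | mul _ _ ih1 ih2 => exact_mod_cast hT.mul_mem ih1 ih2
    | bracket _ _ ih1 ih2 => exact_mod_cast hT.br_mem ih1 ih2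
    | square had _ ih =>
      exact_mod_cast hT.sq_mem had.1 ih ((oddPart_eq_self_iff _).2 had.2)
  have hG := monSpan_le hT.mono hmon
  intro a ha
  obtain ⟨f, hf, g, hg, rfl⟩ := mem_adjLetter.1 ha
  refine add_mem (hG _ hf) ?_
  have := hT.mul_mem hx (hG _ hg)
  rwa [show -(wt k : ℤ) + (w - -wt k) = w by ring] at this

theorem finrank_pivSpan_le (M : ℕ) {n k : ℕ} (hn : n ≤ wt k) :
    Module.Finite K (pivSpan K M 0 n) ∧
      Module.finrank K (pivSpan K M 0 n) ≤ 2 * monCount 5 * 4 ^ k :=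
  finrank_adjLetter_monSpan_le (x := sx K) (y := sy K) (br_zero_left M) (br_zero_right M)
    (br_one_left M) (br_one_right M) not_sqAdm_one (sq_zero M) (fun k w => pivSpanAdj_le M k w) hn

end PoissonFamilies

/-! ## Restriction to the letters with bounded indices -/

section Restriction

variable {K : Type*} [Field K]

/-- All letters of `U` have indices below `M`. -/
def Below (M : ℕ) (U : Finset Letter) : Prop := ∀ i, lx i ∈ U ∨ ly i ∈ U → i < M

theorem Below.mono {M N : ℕ} (h : M ≤ N) {U : Finset Letter} (hU : Below M U) : Below N U :=
  fun i hi => (hU i hi).trans_le h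

theorem Below.subset {M : ℕ} {U T : Finset Letter} (hU : Below M U) (h : T ⊆ U) : Below M T :=
  fun i hi => hU i (hi.imp (@h _) (@h _))

theorem exists_below (U : Finset Letter) : ∃ M, Below M U := by
  induction U using Finset.induction with
  | empty => exact ⟨0, fun i hi => by simp at hi⟩
  | insert s U _ ih =>
    obtain ⟨M, hM⟩ := ih
    rcases letter_cases s with ⟨j, rfl⟩ | ⟨j, rfl⟩
    · refine ⟨max M (j + 1), fun i hi => ?_⟩
      simp only [Finset.mem_insert, lx_inj, (lx_ne_ly _ _).symm, false_or] at hi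
      have := hM i
      have : i = j ∨ i < M := by tauto
      omega
    · refine ⟨max M (j + 1), fun i hi => ?_⟩
      simp only [Finset.mem_insert, ly_inj, lx_ne_ly, false_or] at hi
      have := hM i
      have : i = j ∨ i < M := by tauto
      omega

/-- Two series have the same coefficients at the monomials in the letters with indices
below `M`. -/
def Agree (M : ℕ) (f g : Gr K Letter) : Prop := ∀ U, Below M U → f U = g U

theorem Agree.mul {M : ℕ} {f f' g g' : Gr K Letter} (hf : Agree M f f') (hg : Agree M g g') :
    Agree M (f * g) (f' * g') := by
  intro U hU
  rw [mul_apply, mul_apply]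
  refine Finset.sum_congr rfl fun S hS => ?_
  exact congrArg₂ (fun a b => sgn K S (U \ S) * a * b)
    (hf _ (hU.subset (Finset.mem_powerset.1 hS))) (hg _ (hU.subset Finset.sdiff_subset))

theorem Agree.add {M : ℕ} {f f' g g' : Gr K Letter} (hf : Agree M f f') (hg : Agree M g g') :
    Agree M (f + g) (f' + g') := fun U hU => congrArg₂ (· + ·) (hf U hU) (hg U hU)

theorem Agree.par {M : ℕ} {f f' : Gr K Letter} (hf : Agree M f f') :
    Agree M (par f) (par f') := fun U hU => congrArg (fun t => (-1) ^ U.card * t) (hf U hU)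

theorem Agree.sum {M : ℕ} {J : Type*} {s : Finset J} {f f' : J → Gr K Letter}
    (h : ∀ j ∈ s, Agree M (f j) (f' j)) : Agree M (∑ j ∈ s, f j) (∑ j ∈ s, f' j) := by
  intro U hU
  rw [Gr.sum_apply, Gr.sum_apply]
  exact Finset.sum_congr rfl fun j hj => h j hj U hU

theorem Agree.der {M : ℕ} {s : Letter} (hs : Below M {s}) {f f' : Gr K Letter}
    (hf : Agree M f f') : Agree M (der s f) (der s f') := by
  intro U hU
  rw [der_apply, der_apply]
  split_ifs
  · rfl
  · rw [hf]
    intro i hi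
    simp only [Finset.mem_insert] at hi
    have h1 := hs i
    have h2 := hU i
    simp only [Finset.mem_singleton] at h1
    tauto

theorem below_lx {M i : ℕ} (h : i < M) : Below M {lx i} := by
  intro j hj
  simp only [Finset.mem_singleton, lx_inj, (lx_ne_ly _ _).symm, or_false] at hj
  omega

theorem below_ly {M i : ℕ} (h : i < M) : Below M {ly i} := by
  intro j hj
  simp only [Finset.mem_singleton, ly_inj, lx_ne_ly, false_or] at hj
  omega

theorem Agree.br {M : ℕ} {f f' g g' : Gr K Letter} (hf : Agree M f f') (hg : Agree M g g') :
    Agree M (br M f g) (br M f' g') := by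
  refine Agree.sum fun i hi => ?_
  have h1 := below_lx (Finset.mem_range.1 hi)
  have h2 := below_ly (Finset.mem_range.1 hi)
  exact ((hf.der h1).par.mul (hg.der h2)).add ((hf.der h2).par.mul (hg.der h1))

theorem Agree.sq {M : ℕ} {f f' : Gr K Letter} (hf : Agree M f f') : Agree M (sq M f) (sq M f') := by
  refine Agree.sum fun i hi => ?_
  exact (hf.der (below_lx (Finset.mem_range.1 hi))).mul (hf.der (below_ly (Finset.mem_range.1 hi)))

/-- In `Htilde` the i-th term of the bracket has nonzero coefficients only at monomials that contain
some y_j with j > i. So at a monomial with indices below M the terms with i ≥ M vanish. -/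
theorem bracket_agree (M : ℕ) {f g : Gr K Letter} (hf : (f : Ser K) ∈ Htilde K)
    (hg : (g : Ser K) ∈ Htilde K) : Agree M (bracket f g : Ser K) (br M f g) := by
  intro U hU
  have e : ∀ i : ℕ, (gmul (gder (lx i) (gpar f)) (gder (ly i) g) U
      + gmul (gder (ly i) (gpar f)) (gder (lx i) g) U : K) =
      -(par (der (lx i) f) * der (ly i) g + par (der (ly i) f) * der (lx i) g) U := by
    intro i
    have : (der (lx i) (par f) * der (ly i) g + der (ly i) (par f) * der (lx i) g) =
        -(par (der (lx i) f) * der (ly i) g + par (der (ly i) f) * der (lx i) g) := by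
      rw [der_par, der_par]
      noncomm_ring
    exact congrFun this U
  change -∑ᶠ i : ℕ, (gmul (gder (lx i) (gpar f)) (gder (ly i) g) U
      + gmul (gder (ly i) (gpar f)) (gder (lx i) g) U : K) = _
  rw [finsum_eq_sum_of_support_subset (s := Finset.range M), FractalSuper.br, Gr.sum_apply,
    ← Finset.sum_neg_distrib]
  · refine Finset.sum_congr rfl fun i _ => ?_
    rw [e, neg_neg]
  · intro i hi
    obtain ⟨⟨j, hj, hm⟩, -⟩ := bracket_bound hf hg hi
    have := hU j (Or.inr hm)
    simp only [Finset.coe_range, Set.mem_Iio]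
    omega

theorem fsquare_agree (M : ℕ) {f : Gr K Letter} (hf : (f : Ser K) ∈ Htilde K) :
    Agree M (fsquare f : Ser K) (sq M f) := by
  intro U hU
  change (∑ᶠ i : ℕ, gmul (gder (lx i) f) (gder (ly i) f) U : K) = _
  rw [finsum_eq_sum_of_support_subset (s := Finset.range M), FractalSuper.sq, Gr.sum_apply]
  · rfl
  · intro i hi
    obtain ⟨⟨j, hj, hm⟩, -⟩ := xy_bound hf hf hi
    have := hU j (Or.inr hm)
    simp only [Finset.coe_range, Set.mem_Iio]
    omega

/-! ### Poisson monomials and their truncated counterparts. -/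

theorem isPoissonClosed_poissonAlg : IsPoissonClosed (poissonAlg K) where
  one_mem := Submodule.mem_sInf.2 fun _ h => h.one_mem
  gen_mem f hf := Submodule.mem_sInf.2 fun _ h => h.gen_mem f hf
  mul_mem f hf g hg := Submodule.mem_sInf.2 fun P h => h.mul_mem f (Submodule.mem_sInf.1 hf P h) g
    (Submodule.mem_sInf.1 hg P h)
  bracket_mem f hf g hg := Submodule.mem_sInf.2 fun P h => h.bracket_mem f
    (Submodule.mem_sInf.1 hf P h) g (Submodule.mem_sInf.1 hg P h)
  square_mem h2 f hf ho := Submodule.mem_sInf.2 fun P h => h.square_mem h2 f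
    (Submodule.mem_sInf.1 hf P h) ho

theorem PoissonMonomial.mem_poissonAlg {n : ℕ} {f : Ser K} (h : PoissonMonomial K n f) :
    f ∈ poissonAlg K := by
  have hc := isPoissonClosed_poissonAlg (K := K)
  induction h with
  | one => exact hc.one_mem
  | gen h => exact hc.gen_mem _ h
  | mul _ _ ih1 ih2 => exact hc.mul_mem _ ih1 _ ih2
  | bracket _ _ ih1 ih2 => exact hc.bracket_mem _ ih1 _ ih2
  | square h2 _ ho ih => exact hc.square_mem h2 _ ih ho

theorem PoissonMonomial.mem_Htilde {n : ℕ} {f : Ser K} (h : PoissonMonomial K n f) :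
    f ∈ Htilde K := poissonAlg_le_Htilde K h.mem_poissonAlg

theorem PoissonMonomial.exists_agree (M : ℕ) {n : ℕ} {f : Ser K} (h : PoissonMonomial K n f) :
    ∃ f' : Gr K Letter, WMon (FractalSuper.br M) SqAdm (FractalSuper.sq M) (piv K) 0 n f' ∧
      Agree M f f' := by
  induction h with
  | one => exact ⟨1, WMon.one, fun _ _ => rfl⟩
  | gen h =>
    rcases h with rfl | rfl | rfl
    · exact ⟨piv K 0, WMon.gen (k := 0) 0 (by omega), fun _ _ => rfl⟩
    · exact ⟨piv K 1, WMon.gen (k := 0) 1 (by omega), fun _ _ => rfl⟩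
    · exact ⟨piv K 2, WMon.gen (k := 0) 2 (by omega), fun _ _ => rfl⟩
  | mul _ _ ih1 ih2 =>
    obtain ⟨f', hf', ha⟩ := ih1
    obtain ⟨g', hg', hb⟩ := ih2
    exact ⟨f' * g', hf'.mul hg', ha.mul hb⟩
  | bracket h1 h2 ih1 ih2 =>
    obtain ⟨f', hf', ha⟩ := ih1
    obtain ⟨g', hg', hb⟩ := ih2
    exact ⟨_, hf'.bracket hg', fun U hU =>
      (bracket_agree M h1.mem_Htilde h2.mem_Htilde U hU).trans (ha.br hb U hU)⟩
  | @square n f h2 h1 ho ih =>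
    obtain ⟨f', hf', ha⟩ := ih
    have hs := fsquare_agree M h1.mem_Htilde
    obtain ⟨p, hp⟩ := hf'.isHom
    rcases hp.oddPart_eq with e | e
    · exact ⟨_, WMon.square ⟨h2, (oddPart_eq_self_iff f').1 e⟩ hf', fun U hU =>
        (hs U hU).trans (ha.sq U hU)⟩
    -- An odd series with an even counterpart has no coefficients below M, so its square is
    -- represented by zero. This is why `WMon` admits zero with every weight.
    · refine ⟨0, WMon.zero _, fun U hU => (hs U hU).trans ?_⟩
      have h0 : Agree M f (0 : Gr K Letter) := by
        intro T hT
        by_contra hc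
        have hodd := ho T hc
        have e' : oddPart f' T = f' T := if_pos hodd
        rw [e] at e'
        exact hc ((ha T hT).trans e'.symm)
      rw [h0.sq U hU, sq_zero]

variable (K) in
open Classical in
/-- Restriction of series to the monomials in the letters with indices below `M`. -/
def restrict (M : ℕ) : Ser K →ₗ[K] Ser K where
  toFun f U := if Below M U then f U else 0
  map_add' f g := by
    funext U
    simp only [Pi.add_apply]
    split_ifs <;> simp
  map_smul' c f := by
    funext U
    simp only [Pi.smul_apply, RingHom.id_apply]
    split_ifs <;> simp

theorem restrict_eq {M : ℕ} {f g : Gr K Letter} (h : Agree M f g) :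
    restrict K M f = restrict K M g := by
  classical
  funext U
  change (if Below M U then f U else 0) = (if Below M U then g U else 0)
  split_ifs with hU
  · exact h U hU
  · rfl

theorem agree_of_restrict_eq_zero {M : ℕ} {f : Ser K} (h : restrict K M f = 0) :
    Agree M f (0 : Gr K Letter) := by
  classical
  intro U hU
  have := congrFun h U
  change (if Below M U then f U else 0) = 0 at this
  rwa [if_pos hU] at this

/-- The bound for the truncated monomials does not depend on M, and the restrictions separate
series. -/
theorem finrank_poissonFiltration_le {n k : ℕ} (hn : n ≤ wt k) :
    Module.Finite K (poissonFiltration K n) ∧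
      Module.finrank K (poissonFiltration K n) ≤ 2 * monCount 5 * 4 ^ k := by
  refine finrank_le_of_separating (restrict K) ?_ ?_ fun M => ?_
  · intro M N hMN f hf
    have h := agree_of_restrict_eq_zero (LinearMap.mem_ker.1 hf)
    exact LinearMap.mem_ker.2 ((restrict_eq (g := 0) fun U hU => h U (hU.mono hMN)).trans
      (map_zero (restrict K M)))
  · intro f hf
    funext U
    obtain ⟨M, hM⟩ := exists_below U
    exact agree_of_restrict_eq_zero (hf M) U hM
  · obtain ⟨hfin, hrank⟩ := finrank_pivSpan_le (K := K) M hn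
    let W : Submodule K (Ser K) := pivSpan K M 0 n
    have hfin' : Module.Finite K W := hfin
    have hle : (poissonFiltration K n).map (restrict K M) ≤ W.map (restrict K M) := by
      rw [Submodule.map_le_iff_le_comap]
      refine Submodule.span_le.2 ?_
      rintro f ⟨m, hm, hf⟩
      obtain ⟨f', hf', ha⟩ := hf.exists_agree M
      exact ⟨f', hf'.mem_monSpan (by exact_mod_cast hm), (restrict_eq ha).symm⟩
    refine ⟨Submodule.finiteDimensional_of_le hle, ?_⟩
    exact (Submodule.finrank_mono hle).trans ((Submodule.finrank_map_le _ _).trans hrank)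

end Restriction

end FractalSuper

end

noncomputable section

namespace FractalSuper

open Gr

/-! ## Products of letters -/

section LetterProducts

variable {K B : Type*} [Field K] [Ring B] [Algebra K B]

variable (K) in
/-- The span of the products of subsequences of a sequence of elements `x j`. -/
def prodSpan (x : ℕ → B) : List ℕ → Submodule K B
  | [] => Submodule.span K {1}
  | j :: L => prodSpan x L ⊔ (prodSpan x L).map (LinearMap.mulLeft K (x j))

theorem mem_prodSpan_cons {x : ℕ → B} {j : ℕ} {L : List ℕ} {u : B} :
    u ∈ prodSpan K x (j :: L) ↔ ∃ a ∈ prodSpan K x L, ∃ b ∈ prodSpan K x L, u = a + x j * b := by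
  rw [prodSpan, Submodule.mem_sup]
  constructor
  · rintro ⟨a, ha, _, ⟨b, hb, rfl⟩, rfl⟩
    exact ⟨a, ha, b, hb, rfl⟩
  · rintro ⟨a, ha, b, hb, rfl⟩
    exact ⟨a, ha, _, ⟨b, hb, rfl⟩, rfl⟩

theorem one_mem_prodSpan (x : ℕ → B) : ∀ L, 1 ∈ prodSpan K x L
  | [] => Submodule.mem_span_singleton_self 1
  | _ :: L => Submodule.mem_sup_left (one_mem_prodSpan x L)

/-- An inductive principle for the spans of products. -/
theorem prodSpan_induction {x : ℕ → B} {P : B → Prop} {L : List ℕ} (h1 : ∀ c : K, P (c • 1))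
    (hadd : ∀ a b, P a → P b → P (a + b)) (hmul : ∀ j ∈ L, ∀ a, P a → P (x j * a)) :
    ∀ u ∈ prodSpan K x L, P u := by
  induction L with
  | nil =>
    intro u hu
    obtain ⟨c, rfl⟩ := Submodule.mem_span_singleton.1 hu
    exact h1 c
  | cons j L ih =>
    intro u hu
    have ih' := ih fun i hi => hmul i (List.mem_cons_of_mem _ hi)
    obtain ⟨a, ha, b, hb, rfl⟩ := mem_prodSpan_cons.1 hu
    exact hadd _ _ (ih' a ha) (hmul j List.mem_cons_self _ (ih' b hb))

theorem map_mem_prodSpan {x : ℕ → B} {s : B →ₗ[K] B} (h1 : s 1 = 1)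
    (hx : ∀ j b, s (x j * b) = -(x j * s b)) :
    ∀ L, ∀ u ∈ prodSpan K x L, s u ∈ prodSpan K x L
  | [], u, hu => by
    obtain ⟨c, rfl⟩ := Submodule.mem_span_singleton.1 hu
    rw [map_smul, h1]
    exact hu
  | j :: L, u, hu => by
    obtain ⟨a, ha, b, hb, rfl⟩ := mem_prodSpan_cons.1 hu
    rw [map_add, hx, ← mul_neg]
    exact mem_prodSpan_cons.2 ⟨_, map_mem_prodSpan h1 hx L a ha, _,
      neg_mem (map_mem_prodSpan h1 hx L b hb), rfl⟩

theorem subwordSpan_le_prodSpan (x : ℕ → B) (D : ℕ → Module.End K B) (e : B) :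
    ∀ L : List ℕ, subwordSpan e (L.map fun j => (LinearMap.mulLeft K (x j), D j)) ≤
      (prodSpan K x L).map (LinearMap.mulRight K e)
  | [] => by
    rw [List.map_nil, subwordSpan, Submodule.span_singleton_le_iff_mem]
    exact ⟨1, one_mem_prodSpan x [], one_mul e⟩
  | j :: L => by
    have ih := subwordSpan_le_prodSpan x D e L
    rw [List.map_cons, subwordSpan]
    refine sup_le (ih.trans (Submodule.map_mono le_sup_left)) ?_
    rintro _ ⟨m, hm, rfl⟩
    obtain ⟨u, hu, rfl⟩ := ih hm
    exact ⟨x j * u, Submodule.mem_sup_right ⟨u, hu, rfl⟩, mul_assoc _ _ _⟩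

/-- The indices of the letters that may multiply the `N`-th pivot element. -/
def headIndices : ℕ → List ℕ
  | 0 => []
  | 1 => []
  | 2 => []
  | N + 3 => N :: (if 3 ≤ N then (N - 3) :: headIndices (N + 1) else headIndices (N + 1))

/-- The gap matters: `headIndices (m + 1)` contains neither m nor m - 3, so the two indices added in
passing to `headIndices (m + 3)` are new. -/
theorem mem_headIndices {N : ℕ} : ∀ j ∈ headIndices N, j + 3 = N ∨ j + 5 ≤ N := by
  induction N using Nat.strong_induction_on with
  | _ N ih =>
    match N with
    | 0 => simp [headIndices]
    | 1 => simp [headIndices]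
    | 2 => simp [headIndices]
    | N + 3 =>
      intro j hj
      have := ih (N + 1) (by omega) j
      rw [headIndices, List.mem_cons] at hj
      rcases hj with rfl | hj
      · exact Or.inl rfl
      · split_ifs at hj
        · rcases List.mem_cons.1 hj with rfl | hj
          · omega
          · have := this hj; omega
        · have := this hj; omega

theorem nodup_headIndices (N : ℕ) : (headIndices N).Nodup := by
  induction N using Nat.strong_induction_on with
  | _ N ih =>
    match N with
    | 0 => simp [headIndices]
    | 1 => simp [headIndices]
    | 2 => simp [headIndices]
    | N + 3 =>
      have h := ih (N + 1) (by omega)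
      have hm := @mem_headIndices (N + 1)
      have h1 : N ∉ headIndices (N + 1) := fun hc => by have := hm _ hc; omega
      rw [headIndices]
      split_ifs with h3
      · have h2 : N - 3 ∉ headIndices (N + 1) := fun hc => by have := hm _ hc; omega
        refine List.nodup_cons.2 ⟨?_, List.nodup_cons.2 ⟨h2, h⟩⟩
        rw [List.mem_cons]
        rintro (hc | hc)
        · omega
        · exact h1 hc
      · exact List.nodup_cons.2 ⟨h1, h⟩

/-- Passing from N + 1 to N + 3 adds two indices, apart from small cases, so the defect never
exceeds 3. -/
theorem le_length_headIndices (N : ℕ) : N ≤ (headIndices N).length + 3 := by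
  induction N using Nat.strong_induction_on with
  | _ N ih =>
    match N with
    | 0 => simp
    | 1 => simp
    | 2 => simp
    | N + 3 =>
      have h := ih (N + 1) (by omega)
      rw [headIndices]
      split_ifs with h3
      · simp only [List.length_cons]; omega
      · have : N = 2 → 1 ≤ (headIndices (N + 1)).length := by
          rintro rfl
          simp [headIndices]
        simp only [List.length_cons]; omega

theorem four_pow_le (N : ℕ) : 4 ^ N ≤ 8 * 2 ^ (N + (headIndices N).length) := by
  have : 4 ^ N = 2 ^ (N + N) := by rw [show 4 = 2 ^ 2 by rfl, ← pow_mul, two_mul]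
  rw [this, show 8 = 2 ^ 3 by rfl, ← pow_add]
  exact Nat.pow_le_pow_right (by norm_num) (by have := le_length_headIndices N; omega)

theorem sum_map_wt_range (N : ℕ) : ((List.range N).map wt).sum = wtSum N := by
  induction N with
  | zero => simp [wtSum]
  | succ N ih => rw [List.range_succ, List.map_append, List.sum_append, ih, wtSum_succ]; simp

end LetterProducts

/-! ## The filtration of the Poisson superalgebra -/

section PoissonFiltration

variable {K : Type*} [Field K]

theorem poissonFiltration_mono : Monotone (poissonFiltration K) :=
  fun _ _ h => Submodule.span_mono fun _ ⟨m, hm, hf⟩ => ⟨m, hm.trans h, hf⟩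

theorem PoissonMonomial.mem_filtration {m n : ℕ} {f : Ser K} (h : PoissonMonomial K m f)
    (hmn : m ≤ n) : f ∈ poissonFiltration K n := Submodule.subset_span ⟨m, hmn, h⟩

theorem poissonFiltration_le (n : ℕ) : poissonFiltration K n ≤ poissonAlg K :=
  Submodule.span_le.2 fun _ ⟨_, _, hf⟩ => hf.mem_poissonAlg

theorem mem_Htilde_of_mem {n : ℕ} {f : Ser K} (h : f ∈ poissonFiltration K n) : f ∈ Htilde K :=
  poissonAlg_le_Htilde K (poissonFiltration_le n h)

theorem bracket_eq_of_br {f g h : Gr K Letter} (hf : (f : Ser K) ∈ Htilde K)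
    (hg : (g : Ser K) ∈ Htilde K) (N : ℕ) (H : ∀ M, N ≤ M → br M f g = h) :
    (bracket f g : Ser K) = h := by
  funext U
  obtain ⟨M, hM⟩ := exists_below U
  have := bracket_agree (max M N) hf hg U (hM.mono (le_max_left _ _))
  rw [H _ (le_max_right _ _)] at this
  exact this

/-- Membership in `Htilde` makes the sums over i finite. Elsewhere a `finsum` of infinite support
defaults to zero, so additivity cannot be expected; hence bilinearity is asserted only on a
subspace. -/
theorem bracket_add_left {f f' g : Ser K} (hf : f ∈ Htilde K) (hf' : f' ∈ Htilde K)
    (hg : g ∈ Htilde K) : bracket (f + f') g = bracket f g + bracket f' g := by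
  funext U
  obtain ⟨M, hM⟩ := exists_below U
  rw [Pi.add_apply]
  refine (bracket_agree M (add_mem hf hf') hg U hM).trans ?_
  refine Eq.trans ?_ (congrArg₂ (· + ·) (bracket_agree M hf hg U hM)
    (bracket_agree M hf' hg U hM)).symm
  exact congrFun (br_add_left M (f : Gr K Letter) f' g) U

theorem bracket_add_right {f g g' : Ser K} (hf : f ∈ Htilde K) (hg : g ∈ Htilde K)
    (hg' : g' ∈ Htilde K) : bracket f (g + g') = bracket f g + bracket f g' := by
  funext U
  obtain ⟨M, hM⟩ := exists_below U
  rw [Pi.add_apply]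
  refine (bracket_agree M hf (add_mem hg hg') U hM).trans ?_
  refine Eq.trans ?_ (congrArg₂ (· + ·) (bracket_agree M hf hg U hM)
    (bracket_agree M hf hg' U hM)).symm
  exact congrFun (br_add_right M (f : Gr K Letter) g g') U

theorem bracket_smul_left {f g : Ser K} (c : K) (hf : f ∈ Htilde K) (hg : g ∈ Htilde K) :
    bracket (c • f) g = c • bracket f g := by
  funext U
  obtain ⟨M, hM⟩ := exists_below U
  refine (bracket_agree M (Submodule.smul_mem _ c hf) hg U hM).trans ?_
  refine Eq.trans ?_ (congrArg (c * ·) (bracket_agree M hf hg U hM)).symm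
  exact congrFun (LinearMap.map_smul₂ (brL M) c (f : Gr K Letter) g) U

theorem bracket_smul_right {f g : Ser K} (c : K) (hf : f ∈ Htilde K) (hg : g ∈ Htilde K) :
    bracket f (c • g) = c • bracket f g := by
  funext U
  obtain ⟨M, hM⟩ := exists_below U
  refine (bracket_agree M hf (Submodule.smul_mem _ c hg) U hM).trans ?_
  refine Eq.trans ?_ (congrArg (c * ·) (bracket_agree M hf hg U hM)).symm
  exact congrFun (map_smul (brL M (f : Gr K Letter)) c g) U

/-- The map `T` is bilinear on the subspace `H`. -/
structure IsBilinearOn {E : Type*} [AddCommGroup E] [Module K E] (H : Submodule K E)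
    (T : E → E → E) : Prop where
  add_left : ∀ {a a' b}, a ∈ H → a' ∈ H → b ∈ H → T (a + a') b = T a b + T a' b
  add_right : ∀ {a b b'}, a ∈ H → b ∈ H → b' ∈ H → T a (b + b') = T a b + T a b'
  smul_left : ∀ (c : K) {a b}, a ∈ H → b ∈ H → T (c • a) b = c • T a b
  smul_right : ∀ (c : K) {a b}, a ∈ H → b ∈ H → T a (c • b) = c • T a b

namespace IsBilinearOn

variable {E : Type*} [AddCommGroup E] [Module K E] {H : Submodule K E} {T : E → E → E}

theorem zero_left (hT : IsBilinearOn H T) {b : E} (hb : b ∈ H) : T 0 b = 0 := by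
  have := hT.smul_left 0 (zero_mem H) hb
  rwa [zero_smul, zero_smul] at this

theorem zero_right (hT : IsBilinearOn H T) {a : E} (ha : a ∈ H) : T a 0 = 0 := by
  have := hT.smul_right 0 ha (zero_mem H)
  rwa [zero_smul, zero_smul] at this

/-- The products of spans lie in any subspace that contains the products of the generators. -/
theorem mem_of_span (hT : IsBilinearOn H T) {S S' : Set E} {W : Submodule K E} (hS : S ⊆ H)
    (hS' : S' ⊆ H) (h : ∀ a ∈ S, ∀ b ∈ S', T a b ∈ W) {a b : E}
    (ha : a ∈ Submodule.span K S) (hb : b ∈ Submodule.span K S') : T a b ∈ W := by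
  have hb' : ∀ b ∈ Submodule.span K S', b ∈ H := Submodule.span_le.2 hS'
  have ha' : ∀ b ∈ Submodule.span K S, b ∈ H := Submodule.span_le.2 hS
  induction ha using Submodule.span_induction with
  | mem a ha =>
    induction hb using Submodule.span_induction with
    | mem b hb => exact h a ha b hb
    | zero => rw [hT.zero_right (hS ha)]; exact zero_mem _
    | add b c hb hc ihb ihc =>
      rw [hT.add_right (hS ha) (hb' b hb) (hb' c hc)]
      exact add_mem ihb ihc
    | smul c b hb ihb =>
      rw [hT.smul_right c (hS ha) (hb' b hb)]
      exact Submodule.smul_mem _ _ ihb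
  | zero => rw [hT.zero_left (hb' b hb)]; exact zero_mem _
  | add a c ha hc iha ihc =>
    rw [hT.add_left (ha' a ha) (ha' c hc) (hb' b hb)]
    exact add_mem iha ihc
  | smul c a ha iha =>
    rw [hT.smul_left c (ha' a ha) (hb' b hb)]
    exact Submodule.smul_mem _ _ iha

end IsBilinearOn

theorem isBilinearOn_bracket : IsBilinearOn (Htilde K) bracket where
  add_left := bracket_add_left
  add_right := bracket_add_right
  smul_left := fun c _ _ => bracket_smul_left c
  smul_right := fun c _ _ => bracket_smul_right c

theorem bracket_mem_filtration {m n : ℕ} {f g : Ser K} (hf : f ∈ poissonFiltration K m)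
    (hg : g ∈ poissonFiltration K n) : bracket f g ∈ poissonFiltration K (m + n) := by
  refine isBilinearOn_bracket.mem_of_span (fun _ h => h.choose_spec.2.mem_Htilde)
    (fun _ h => h.choose_spec.2.mem_Htilde) ?_ hf hg
  rintro a ⟨i, hi, ha⟩ b ⟨j, hj, hb⟩
  exact (ha.bracket hb).mem_filtration (by omega)

theorem gmul_mem_filtration {m n : ℕ} {f g : Ser K} (hf : f ∈ poissonFiltration K m)
    (hg : g ∈ poissonFiltration K n) : gmul f g ∈ poissonFiltration K (m + n) := by
  refine bilinear_mem_of_span (B := Gr K Letter) (W := poissonFiltration K (m + n))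
    (LinearMap.mul K (Gr K Letter)) ?_ hf hg
  rintro a ⟨i, hi, ha⟩ b ⟨j, hj, hb⟩
  exact (ha.mul hb).mem_filtration (by omega)

theorem Gr.IsHom.bracket {p q : ZMod 2} {f g : Ser K} (hf : f ∈ Htilde K) (hg : g ∈ Htilde K)
    (h1 : IsHom p (f : Gr K Letter)) (h2 : IsHom q (g : Gr K Letter)) :
    IsHom (p + q) (bracket f g : Gr K Letter) := by
  intro U hU
  obtain ⟨M, hM⟩ := exists_below U
  refine h1.br M h2 U fun h0 => hU ?_
  exact (bracket_agree M hf hg U hM).trans h0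

theorem PoissonMonomial.isHom {n : ℕ} {f : Ser K} (h : PoissonMonomial K n f) :
    ∃ p, IsHom p (f : Gr K Letter) := by
  induction h with
  | one => exact ⟨0, IsHom.one⟩
  | gen h =>
    refine ⟨1, ?_⟩
    rcases h with rfl | rfl | rfl <;> exact piv_isHom _
  | mul _ _ ih1 ih2 =>
    obtain ⟨p, hp⟩ := ih1
    obtain ⟨q, hq⟩ := ih2
    exact ⟨_, hp.mul hq⟩
  | bracket h1 h2 ih1 ih2 =>
    obtain ⟨p, hp⟩ := ih1
    obtain ⟨q, hq⟩ := ih2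
    exact ⟨_, Gr.IsHom.bracket h1.mem_Htilde h2.mem_Htilde hp hq⟩
  | @square n f _ h1 _ ih =>
    obtain ⟨p, hp⟩ := ih
    refine ⟨p + p, fun U hU => ?_⟩
    obtain ⟨M, hM⟩ := exists_below U
    refine hp.sq M U fun h0 => hU ?_
    exact (fsquare_agree M h1.mem_Htilde U hM).trans h0

/-- The odd component of a series. -/
def oddSer : Ser K →ₗ[K] Ser K := (oddPart : Gr K Letter →ₗ[K] Gr K Letter)

theorem oddSer_eq_self {f : Ser K} (hf : IsOddSeries f) : oddSer f = f :=
  (oddPart_eq_self_iff (f : Gr K Letter)).2 hf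

theorem isOddSeries_of_oddSer {f : Ser K} (hf : oddSer f = f) : IsOddSeries f :=
  (oddPart_eq_self_iff (f : Gr K Letter)).1 hf

theorem PoissonMonomial.oddSer_eq {n : ℕ} {f : Ser K} (h : PoissonMonomial K n f) :
    oddSer f = f ∨ oddSer f = 0 := by
  obtain ⟨p, hp⟩ := h.isHom
  exact hp.oddPart_eq

theorem gpar_eq (f : Ser K) : gpar f = f - (2 : K) • oddSer f := par_eq (f : Gr K Letter)

theorem oddSer_mem_filtration {n : ℕ} {f : Ser K} (hf : f ∈ poissonFiltration K n) :
    oddSer f ∈ poissonFiltration K n := by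
  have : poissonFiltration K n ≤ (poissonFiltration K n).comap oddSer := by
    refine Submodule.span_le.2 ?_
    rintro a ⟨m, hm, ha⟩
    rw [SetLike.mem_coe, Submodule.mem_comap]
    rcases ha.oddSer_eq with e | e <;> rw [e]
    · exact ha.mem_filtration hm
    · exact zero_mem _
  exact this hf

theorem gpar_mem_filtration {n : ℕ} {f : Ser K} (hf : f ∈ poissonFiltration K n) :
    gpar f ∈ poissonFiltration K n := by
  rw [gpar_eq]
  exact sub_mem hf (Submodule.smul_mem _ _ (oddSer_mem_filtration hf))

theorem fsquare_add (h2 : (2 : K) = 0) {f g : Ser K} (hf : f ∈ Htilde K) (hg : g ∈ Htilde K) :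
    fsquare (f + g) = fsquare f + fsquare g + bracket f g := by
  funext U
  obtain ⟨M, hM⟩ := exists_below U
  refine (fsquare_agree M (add_mem hf hg) U hM).trans ?_
  refine Eq.trans ?_ (congrArg₂ (· + ·) (congrArg₂ (· + ·) (fsquare_agree M hf U hM)
    (fsquare_agree M hg U hM)) (bracket_agree M hf hg U hM)).symm
  exact congrFun (sq_add h2 M (f : Gr K Letter) g) U

theorem fsquare_smul (c : K) {f : Ser K} (hf : f ∈ Htilde K) :
    fsquare (c • f) = c • c • fsquare f := by
  funext U
  obtain ⟨M, hM⟩ := exists_below U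
  refine (fsquare_agree M (Submodule.smul_mem _ c hf) U hM).trans ?_
  refine Eq.trans ?_ (congrArg (fun t => c * (c * t)) (fsquare_agree M hf U hM)).symm
  exact congrFun (sq_smul M c (f : Gr K Letter)) U

theorem fsquare_zero : fsquare (0 : Ser K) = 0 := by
  have := fsquare_smul (0 : K) (zero_mem (Htilde K))
  rwa [zero_smul, zero_smul] at this

theorem fsquare_mem_filtration (h2 : (2 : K) = 0) {n : ℕ} {f : Ser K}
    (hf : f ∈ poissonFiltration K n) (ho : IsOddSeries f) :
    fsquare f ∈ poissonFiltration K (2 * n) := by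
  have key : ∀ f ∈ poissonFiltration K n, fsquare (oddSer f) ∈ poissonFiltration K (2 * n) := by
    intro f hf
    induction hf using Submodule.span_induction with
    | mem f h =>
      obtain ⟨m, hm, hf⟩ := h
      rcases hf.oddSer_eq with e | e
      · rw [e]
        exact (hf.square h2 (isOddSeries_of_oddSer e)).mem_filtration (by omega)
      · rw [e, fsquare_zero]
        exact zero_mem _
    | zero =>
      rw [map_zero, fsquare_zero]
      exact zero_mem _
    | add f g hf hg ihf ihg =>
      have hf' := oddSer_mem_filtration hf
      have hg' := oddSer_mem_filtration hg
      rw [map_add, fsquare_add h2 (mem_Htilde_of_mem hf') (mem_Htilde_of_mem hg')]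
      refine add_mem (add_mem ihf ihg) ?_
      rw [two_mul]
      exact bracket_mem_filtration hf' hg'
    | smul c f hf ihf =>
      rw [map_smul, fsquare_smul c (mem_Htilde_of_mem (oddSer_mem_filtration hf))]
      exact Submodule.smul_mem _ _ (Submodule.smul_mem _ _ ihf)
  have := key f hf
  rwa [oddSer_eq_self ho] at this

theorem iSup_poissonFiltration : iSup (poissonFiltration K) = poissonAlg K := by
  have hdir : Directed (· ≤ ·) (poissonFiltration K) := poissonFiltration_mono.directed_le
  have hmem : ∀ f, f ∈ iSup (poissonFiltration K) ↔ ∃ n, f ∈ poissonFiltration K n :=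
    fun f => Submodule.mem_iSup_of_directed _ hdir
  refine le_antisymm (iSup_le poissonFiltration_le) (sInf_le ⟨?_, ?_, ?_, ?_, ?_⟩)
  · exact (hmem _).2 ⟨0, PoissonMonomial.one.mem_filtration le_rfl⟩
  · exact fun f hf => (hmem _).2 ⟨1, (PoissonMonomial.gen hf).mem_filtration le_rfl⟩
  · intro f hf g hg
    obtain ⟨m, hm⟩ := (hmem f).1 hf
    obtain ⟨n, hn⟩ := (hmem g).1 hg
    exact (hmem _).2 ⟨m + n, gmul_mem_filtration hm hn⟩
  · intro f hf g hg
    obtain ⟨m, hm⟩ := (hmem f).1 hf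
    obtain ⟨n, hn⟩ := (hmem g).1 hg
    exact (hmem _).2 ⟨m + n, bracket_mem_filtration hm hn⟩
  · intro h2 f hf ho
    obtain ⟨n, hn⟩ := (hmem f).1 hf
    exact (hmem _).2 ⟨2 * n, fsquare_mem_filtration h2 hn ho⟩

end PoissonFiltration

/-! ## Many independent elements of the Poisson superalgebra -/

section PoissonLower

variable {K : Type*} [Field K]

/-! ### Brackets of letters and pivot elements. -/

theorem sx_mul_sx_mul (i : ℕ) (f : Gr K Letter) : sx K i * (sx K i * f) = 0 := by
  rw [← mul_assoc, sx, letter_sq, zero_mul]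

theorem mul_sx (i : ℕ) (f g : Gr K Letter) : f * (sx K i * g) = sx K i * (par f * g) :=
  mul_letter' _ _ _

theorem br_sx_mul (M i : ℕ) (f g : Gr K Letter) :
    br M (sx K i * f) g = par f * br M (sx K i) g + sx K i * br M f g := br_letter_mul _ _ _ _

theorem br_mul_sx (M i : ℕ) (f g : Gr K Letter) :
    br M f (sx K i * g) = par (br M (sx K i) f) * g + sx K i * br M (par f) g :=
  br_mul_letter _ _ _ _

theorem br_sx_piv {i n : ℕ} (M : ℕ) (h : i < n) : br M (sx K i) (piv K n) = 0 := by
  rw [br_sx, der_ly_piv h, ite_self]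

theorem br_sx_piv_self {n M : ℕ} (h : n < M) : br M (sx K n) (piv K n) = 1 := by
  rw [br_sx, if_pos h, der_ly_piv_self]

theorem br_sy_right (M i : ℕ) (f : Gr K Letter) : br M f (sy K i) = par (br M (sy K i) f) := by
  have := br_mul_letter (ly i) M f 1
  rwa [mul_one, mul_one, br_one_right, mul_zero, add_zero] at this

/-- As g has zero derivatives in x_i and y_i, its bracket with y_i vanishes, and what remains of the
bracket with the rest of V_i contains the factor x_i. -/
theorem sx_mul_br_piv {i : ℕ} {g : Gr K Letter} (M : ℕ) (hx : der (lx i) g = 0)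
    (hy : der (ly i) g = 0) : sx K i * br M (piv K i) g = 0 := by
  rw [piv_eq, br_add_left, br_sx_mul, br_sx, br_sy, hx, hy, ite_self, mul_zero, zero_add,
    zero_add, sx_mul_sx_mul]

/-- The letter x_{i+1} of V_i pairs with y_{i+1} in V_{i+1}. Nothing else survives, since {V_{i+1},
V_{i+3}} occurs with the factor x_{i+1}. -/
theorem br_piv_succ_piv {i M : ℕ} (h : i + 1 < M) :
    br M (piv K (i + 1)) (piv K i) = -(sx K i * piv K (i + 3)) := by
  have e : sx K (i + 1) * br M (piv K (i + 1)) (piv K (i + 3)) = 0 :=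
    sx_mul_br_piv M (der_lx_piv (by omega)) (der_ly_piv (by omega))
  rw [piv_eq i, br_add_right, br_sy_right, br_sy, der_lx_piv (by omega), ite_self, map_zero,
    zero_add, br_mul_sx, br_sx_piv M (by omega), map_zero, zero_mul, zero_add, par_piv, br_neg_left,
    br_mul_sx, br_sx_piv_self h, par_one, one_mul, par_piv, br_neg_left, mul_neg (sx K (i + 1)), e,
    neg_zero, add_zero, mul_neg]

theorem par_mem_prodSpan (L : List ℕ) {u : Gr K Letter} (hu : u ∈ prodSpan K (sx K) L) :
    par u ∈ prodSpan K (sx K) L :=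
  map_mem_prodSpan par_one (fun j b => by rw [par_mul, sx, par_letter, neg_mul]) L u hu

theorem br_mul_of_mem_prodSpan {L : List ℕ} {u g : Gr K Letter} (M : ℕ)
    (hu : u ∈ prodSpan K (sx K) L) (hL : ∀ j ∈ L, br M (sx K j) g = 0) (f : Gr K Letter) :
    br M (u * f) g = u * br M f g := by
  refine prodSpan_induction (P := fun u => br M (u * f) g = u * br M f g) ?_ ?_ ?_ u hu
  · intro c
    rw [smul_mul_assoc, one_mul, smul_mul_assoc, one_mul]
    exact LinearMap.map_smul₂ (brL M) c f g
  · intro a b ha hb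
    rw [add_mul, br_add_left, ha, hb, add_mul]
  · intro j hj a ha
    rw [mul_assoc, br_sx_mul, hL j hj, mul_zero, zero_add, ha, mul_assoc]

theorem der_mul_of_mem_prodSpan {L : List ℕ} {u : Gr K Letter} {s : Letter}
    (hu : u ∈ prodSpan K (sx K) L) (hL : ∀ j ∈ L, s ≠ lx j) : der s u = 0 := by
  refine prodSpan_induction (P := fun u => der s u = 0) ?_ ?_ ?_ u hu
  · intro c
    rw [map_smul, der_one, smul_zero]
  · intro a b ha hb
    rw [map_add, ha, hb, add_zero]
  · intro j hj a ha
    rw [sx, der_letter_mul, if_neg (hL j hj), ha, mul_zero, sub_zero]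

/-- The filtration of the Poisson superalgebra, inside the ring of Grassmann series. -/
def pFil (K : Type*) [Field K] (n : ℕ) : Submodule K (Gr K Letter) := poissonFiltration K n

theorem pFil_mono {m n : ℕ} (h : m ≤ n) : pFil K m ≤ pFil K n := poissonFiltration_mono h

theorem br_mem_pFil {m n N : ℕ} {f g h : Gr K Letter} (hf : f ∈ pFil K m) (hg : g ∈ pFil K n)
    (H : ∀ M, N ≤ M → br M f g = h) : h ∈ pFil K (m + n) := by
  have := bracket_eq_of_br (mem_Htilde_of_mem hf) (mem_Htilde_of_mem hg) N H
  have h2 : bracket f g ∈ poissonFiltration K (m + n) := bracket_mem_filtration hf hg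
  rw [this] at h2
  exact h2

/-- Two brackets with V_m turn u V_{m+1} into u V_{m+3}, at total length wt(m+1) + 2 wt(m) =
wt(m+3). Letters on V_{m+1} are carried along, x_{m-3} comes in with the first V_m, and x_m is
present before the second bracket removes it. -/
theorem prodSpan_mul_piv_mem (N : ℕ) :
    ∀ u ∈ prodSpan K (sx K) (headIndices N), u * piv K N ∈ pFil K (wt N) := by
  induction N using Nat.strong_induction_on with
  | _ N ih =>
    have base : ∀ n, piv K n ∈ poissonGens K → ∀ u ∈ prodSpan K (sx K) [],
        u * piv K n ∈ pFil K 1 := by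
      intro n hn u hu
      obtain ⟨c, rfl⟩ := Submodule.mem_span_singleton.1 hu
      rw [smul_mul_assoc, one_mul]
      exact Submodule.smul_mem _ _ ((PoissonMonomial.gen hn).mem_filtration le_rfl)
    match N with
    | 0 => exact base 0 (Or.inl rfl)
    | 1 => exact base 1 (Or.inr (Or.inl rfl))
    | 2 => exact base 2 (Or.inr (Or.inr rfl))
    | m + 3 =>
      have hV : piv K m ∈ pFil K (wt m) := by
        have := ih m (by omega) 1 (one_mem_prodSpan _ _)
        rwa [one_mul] at this
      have h1 := ih (m + 1) (by omega)
      have hlt : ∀ j ∈ headIndices (m + 1), j < m := fun j hj => by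
        have := mem_headIndices j hj; omega
      -- One bracket: u passes through because its letters have zero bracket with V_m; `par u` is
      -- used so that x_m ends up in front.
      have stepA : ∀ u ∈ prodSpan K (sx K) (headIndices (m + 1)),
          sx K m * (u * piv K (m + 3)) ∈ pFil K (wt (m + 1) + wt m) := by
        intro u hu
        have := br_mem_pFil (N := m + 2) (h := -(sx K m * (u * piv K (m + 3))))
          (h1 _ (par_mem_prodSpan _ hu)) hV fun M hM => by
            rw [br_mul_of_mem_prodSpan M (par_mem_prodSpan _ hu)
              (fun j hj => br_sx_piv M (hlt j hj)), br_piv_succ_piv (by omega), mul_neg, mul_sx,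
              par_par]
        rwa [neg_mem_iff] at this
      set L := (if 3 ≤ m then (m - 3) :: headIndices (m + 1) else headIndices (m + 1)) with hLdef
      have hL : ∀ j ∈ L, j < m := by
        intro j hj
        rw [hLdef] at hj
        split_ifs at hj
        · rcases List.mem_cons.1 hj with rfl | hj
          · omega
          · exact hlt j hj
        · exact hlt j hj
      -- The letter x_{m-3} enters when V_m is replaced by x_{m-3} V_m, which also has length `wt
      -- m`.
      have stepB : ∀ u ∈ prodSpan K (sx K) L,
          sx K m * (u * piv K (m + 3)) ∈ pFil K (wt (m + 1) + wt m) := by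
        intro u hu
        rw [hLdef] at hu
        split_ifs at hu with h3
        · obtain ⟨a, ha, b, hb, rfl⟩ := mem_prodSpan_cons.1 hu
          rw [add_mul, mul_add]
          refine add_mem (stepA a ha) ?_
          have hz : sx K (m - 3) * piv K m ∈ pFil K (wt m) := by
            have hm : m - 3 ∈ headIndices m := by
              obtain ⟨i, rfl⟩ : ∃ i, m = i + 3 := ⟨m - 3, by omega⟩
              rw [headIndices]
              exact List.mem_cons_self
            have : sx K (m - 3) * 1 ∈ prodSpan K (sx K) (headIndices m) := by
              obtain ⟨i, rfl⟩ : ∃ i, m = i + 3 := ⟨m - 3, by omega⟩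
              rw [headIndices]
              exact Submodule.mem_sup_right ⟨1, one_mem_prodSpan _ _, rfl⟩
            have := ih m (by omega) _ this
            rwa [mul_one] at this
          refine br_mem_pFil (N := m + 2) (neg_mem (h1 b hb)) hz fun M hM => ?_
          rw [br_neg_left, br_mul_of_mem_prodSpan M hb]
          · rw [br_mul_sx, br_sx_piv M (by omega), map_zero, zero_mul, zero_add, par_piv,
              br_neg_left, br_piv_succ_piv (by omega), neg_neg, mul_sx, mul_sx, mul_sx, par_par,
              sx, sx, par_letter, neg_mul, mul_neg, neg_neg, mul_assoc]
          · intro j hj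
            have hj' := hlt j hj
            rw [br_mul_sx, show par (sx K j) = -sx K j from par_letter _, br_neg_left,
              br_sx_piv M hj', neg_zero, mul_zero, add_zero]
            rw [br_sx, sx, der_letter, if_neg (lx_ne_ly _ _).symm, ite_self, map_zero, zero_mul]
        · exact stepA u hu
      -- The second bracket with V_m strikes out x_m, as {x_m, V_m} = 1.
      have stepC : ∀ u ∈ prodSpan K (sx K) L, u * piv K (m + 3) ∈ pFil K (wt (m + 3)) := by
        intro u hu
        have e : wt (m + 3) = wt m + (wt (m + 1) + wt m) := by rw [wt_add_three]; ring
        rw [e]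
        refine br_mem_pFil (N := m + 1) hV (stepB u hu) fun M hM => ?_
        have e1 : der (lx m) (u * piv K (m + 3)) = 0 := by
          rw [der_mul, der_lx_piv (by omega), der_mul_of_mem_prodSpan hu
            (fun j hj => by rw [Ne, lx_inj]; have := hL j hj; omega)]
          simp
        have e2 : der (ly m) (u * piv K (m + 3)) = 0 := by
          rw [der_mul, der_ly_piv (by omega), der_mul_of_mem_prodSpan hu
            (fun j hj => (lx_ne_ly _ _).symm)]
          simp
        rw [br_mul_sx, br_sx_piv_self (by omega), par_one, one_mul, par_piv, br_neg_left, mul_neg,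
          sx_mul_br_piv M e1 e2, neg_zero, add_zero]
      intro u hu
      rw [headIndices] at hu
      obtain ⟨a, ha, b, hb, rfl⟩ := mem_prodSpan_cons.1 hu
      rw [add_mul, mul_assoc]
      refine add_mem (stepC a ha) (pFil_mono ?_ (stepB b hb))
      rw [wt_add_three]; omega

theorem piv_mem_pFil (n : ℕ) : piv K n ∈ pFil K (wt n) := by
  have := prodSpan_mul_piv_mem (K := K) n 1 (one_mem_prodSpan _ _)
  rwa [one_mul] at this

/-- Multiplication by V_k is dual to ∂/∂y_k and multiplication by x_j to ∂/∂x_j. The pivot elements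
after V_k do not contain y_k, so increasing order gives the triangular pattern required by
`finrank_subwordSpan`. The lengths add up to at most `wtSum N + wt N` ≤ 4 `wt N`. -/
theorem four_pow_le_finrank_poissonFiltration {N n : ℕ} (hn : 4 * wt N ≤ n) :
    4 ^ N ≤ 8 * Module.finrank K (poissonFiltration K n) := by
  let A : List (Module.End K (Gr K Letter) × Module.End K (Gr K Letter)) :=
    (headIndices N).map fun j => (LinearMap.mulLeft K (sx K j), der (lx j))
  let p : ℕ → Module.End K (Gr K Letter) × Module.End K (Gr K Letter) :=
    fun k => (LinearMap.mulLeft K (piv K k), der (ly k))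
  have hle : ∀ J : List ℕ, subwordSpan (piv K N) (J.map p ++ A) ≤
      pFil K (wt N + (J.map wt).sum) := by
    intro J
    induction J with
    | nil =>
      refine (subwordSpan_le_prodSpan _ _ _ _).trans ?_
      rintro _ ⟨u, hu, rfl⟩
      exact prodSpan_mul_piv_mem N u hu
    | cons k J ihJ =>
      rw [List.map_cons, List.cons_append, subwordSpan, List.map_cons, List.sum_cons]
      refine sup_le (ihJ.trans (pFil_mono (by omega))) ?_
      rintro _ ⟨m, hm, rfl⟩
      have := gmul_mem_filtration (piv_mem_pFil (K := K) k) (ihJ hm)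
      rwa [show wt k + (wt N + (J.map wt).sum) = wt N + (wt k + (J.map wt).sum) by ring] at this
  have hne : piv K N ≠ 0 := by
    intro h0
    have h1 := piv_apply_pivotLetters (K := K) N 0
    rw [h0] at h1
    exact zero_ne_one h1
  have hlt : ∀ j ∈ headIndices N, j < N := fun j hj => by
    have := mem_headIndices j hj; omega
  have hdim : Module.finrank K (subwordSpan (piv K N) ((List.range N).map p ++ A)) =
      2 ^ ((List.range N).map p ++ A).length := by
    refine finrank_subwordSpan hne _ ?_ ?_ ?_
    · intro q hq
      rcases List.mem_append.1 hq with hq | hq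
      · obtain ⟨k, hk, rfl⟩ := List.mem_map.1 hq
        exact der_ly_piv (List.mem_range.1 hk)
      · obtain ⟨k, hk, rfl⟩ := List.mem_map.1 hq
        exact der_lx_piv (hlt k hk)
    · intro q hq m
      rcases List.mem_append.1 hq with hq | hq
      · obtain ⟨k, hk, rfl⟩ := List.mem_map.1 hq
        change der (ly k) (piv K k * m) + piv K k * der (ly k) m = m
        rw [der_mul, der_ly_piv_self, par_piv]
        noncomm_ring
      · obtain ⟨k, hk, rfl⟩ := List.mem_map.1 hq
        change der (lx k) (sx K k * m) + sx K k * der (lx k) m = m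
        rw [sx, der_letter_mul, if_pos rfl, sub_add_cancel]
    · have hx : ∀ (s : Letter) (j : ℕ), s ≠ lx j → ∀ m : Gr K Letter,
          der s (sx K j * m) = -(sx K j * der s m) := fun s j h m => by
        rw [sx, der_letter_mul, if_neg h, zero_sub]
      refine List.pairwise_append.2 ⟨?_, ?_, ?_⟩
      · rw [List.pairwise_map]
        refine List.Pairwise.imp ?_ List.pairwise_lt_range
        intro i j hij m
        change der (ly i) (piv K j * m) = -(piv K j * der (ly i) m)
        rw [der_mul, der_ly_piv hij, par_piv, zero_mul, zero_add, neg_mul]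
      · rw [List.pairwise_map]
        refine List.Pairwise.imp ?_ (nodup_headIndices N)
        intro i j hij m
        exact hx _ _ (by rwa [Ne, lx_inj]) m
      · intro q hq q' hq' m
        obtain ⟨k, hk, rfl⟩ := List.mem_map.1 hq
        obtain ⟨j, hj, rfl⟩ := List.mem_map.1 hq'
        exact hx _ _ (lx_ne_ly _ _).symm m
  have hfin : Module.Finite K (pFil K n) :=
    (finrank_poissonFiltration_le (K := K) (le_wt n)).1
  have hS := wtSum_le N
  have hsub := (hle (List.range N)).trans (pFil_mono (K := K) (n := n) (by
    rw [sum_map_wt_range]; omega))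
  have := Submodule.finrank_mono hsub
  rw [hdim, List.length_append, List.length_map, List.length_range, List.length_map] at this
  exact (four_pow_le N).trans (Nat.mul_le_mul_left 8 this)

end PoissonLower

end FractalSuper

end

noncomputable section

namespace FractalSuper

/-! ## Algebras with letters, derivations and pivot elements -/

/-- Elements `x_i`, `p_i` and `v_i` of an algebra with a parity automorphism, which satisfy the
relations between the letters, the derivations and the pivot elements of the Grassmann algebra. -/
structure PivotSystem (K B : Type*) [Field K] [Ring B] [Algebra K B] where
  x : ℕ → B
  p : ℕ → B
  v : ℕ → B
  sig : B →ₗ[K] B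
  x_sq : ∀ i, x i * x i = 0
  x_mul_x : ∀ i j, x i * x j = -(x j * x i)
  p_mul_x : ∀ i j, p i * x j = (if i = j then 1 else 0) - x j * p i
  p_mul_p_self : ∀ i, p i * p i = 0
  v_eq : ∀ n, v n = p n + x n * (x (n + 1) * v (n + 3))
  v_mul_x : ∀ {i j}, i < j → v j * x i = -(x i * v j)
  v_mul_p : ∀ {i j}, i < j → v j * p i = -(p i * v j)
  sig_one : sig 1 = 1
  sig_mul : ∀ a b, sig (a * b) = sig a * sig b
  sig_sig : ∀ a, sig (sig a) = a
  sig_x : ∀ i, sig (x i) = -x i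
  sig_v : ∀ i, sig (v i) = -v i

namespace PivotSystem

variable {K B : Type*} [Field K] [Ring B] [Algebra K B] (S : PivotSystem K B)

/-! ### Anticommutators of pivot elements. -/

theorem x_mul_x_mul (i : ℕ) (a : B) : S.x i * (S.x i * a) = 0 := by
  rw [← mul_assoc, S.x_sq, zero_mul]

theorem x_mul_v (n : ℕ) : S.x n * S.v n = S.x n * S.p n := by
  rw [S.v_eq, mul_add, S.x_mul_x_mul, add_zero]

theorem v_mul_x_self (n : ℕ) : S.v n * S.x n = 1 - S.x n * S.v n := by
  rw [S.x_mul_v]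
  conv_lhs => rw [S.v_eq, add_mul, S.p_mul_x, if_pos rfl, mul_assoc, mul_assoc,
    S.v_mul_x (show n < n + 3 by omega), mul_neg, mul_neg, ← mul_assoc (S.x (n + 1)),
    S.x_mul_x (n + 1) n, neg_mul, mul_neg, neg_neg, mul_assoc, S.x_mul_x_mul, add_zero]

/-- After multiplication by x_n, v_n may be replaced by p_n, which anticommutes with v_j; without
this factor v_n and v_j need not anticommute. It plays the part of `sx_mul_br_piv`. -/
theorem x_mul_v_mul_v {n j : ℕ} (h : n < j) :
    S.x n * (S.v n * S.v j) = -(S.x n * (S.v j * S.v n)) := by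
  have e1 : S.p n * S.v j = -(S.v j * S.p n) := by rw [S.v_mul_p h, neg_neg]
  have e2 : S.x n * S.v j = -(S.v j * S.x n) := by rw [S.v_mul_x h, neg_neg]
  rw [← mul_assoc, S.x_mul_v, mul_assoc, e1, mul_neg, neg_inj, ← mul_assoc, e2, neg_mul, mul_assoc,
    ← S.x_mul_v, ← mul_assoc, ← neg_mul, ← e2, mul_assoc]

/-- The operator form of `br_piv_succ_piv`, with the anticommutator for the bracket. -/
theorem v_succ_mul_v (i : ℕ) :
    S.v (i + 1) * S.v i + S.v i * S.v (i + 1) = -(S.x i * S.v (i + 3)) := by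
  have e := S.x_mul_v_mul_v (show i + 1 < i + 3 by omega)
  have h1 : S.v (i + 1) * (S.x i * (S.x (i + 1) * S.v (i + 3))) =
      -(S.x i * S.v (i + 3)) - S.x i * (S.x (i + 1) * (S.v (i + 3) * S.v (i + 1))) := by
    rw [← mul_assoc, S.v_mul_x (by omega), neg_mul, mul_assoc, ← mul_assoc (S.v (i + 1)),
      S.v_mul_x_self, sub_mul, one_mul, mul_assoc (S.x (i + 1)), e]
    noncomm_ring
  rw [S.v_eq i, mul_add, add_mul, S.v_mul_p (by omega), h1]
  noncomm_ring

/-! ## Upper bounds for the hull -/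

/-- The span of the associative monomials in `v_k, v_{k+1}, v_{k+2}` of weight at most `w`. -/
def opSpan (k : ℕ) (w : ℤ) : Submodule K B :=
  monSpan K (fun _ _ => 0) (fun _ => False) id S.v k w

theorem opSpan_family (k : ℕ) : MulFamily (S.opSpan k) := monSpan_mulFamily _ _ _ _ _

/-- An induction principle for the spans of monomials. -/
theorem opSpan_le {k : ℕ} {F : ℤ → Submodule K B} (hF : Monotone F)
    (h1 : 1 ∈ F 0) (hg : ∀ j ≤ 2, S.v (k + j) ∈ F (wt (k + j)))
    (hm : ∀ (m n : ℕ) (a b), a ∈ S.opSpan k m → b ∈ S.opSpan k n → a ∈ F m → b ∈ F n →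
      a * b ∈ F (m + n : ℕ)) (w : ℤ) : S.opSpan k w ≤ F w := by
  refine monSpan_le hF ?_ w
  intro n a ha
  induction ha with
  | zero => exact zero_mem _
  | one => exact h1
  | gen j hj => exact hg j hj
  | mul ha hb ih1 ih2 => exact hm _ _ _ _ (ha.mem_monSpan le_rfl) (hb.mem_monSpan le_rfl) ih1 ih2
  | bracket => exact zero_mem _
  | square h => exact h.elim

theorem sig_mem_opSpan {k : ℕ} {w : ℤ} {a : B} (ha : a ∈ S.opSpan k w) :
    S.sig a ∈ S.opSpan k w := by
  have hF := S.opSpan_family k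
  refine S.opSpan_le (F := fun w => (S.opSpan k w).comap S.sig)
    (fun _ _ h => Submodule.comap_mono (hF.mono h)) ?_ ?_ ?_ w ha
  · rw [Submodule.mem_comap, S.sig_one]
    exact hF.one_mem
  · intro j hj
    rw [Submodule.mem_comap, S.sig_v]
    exact neg_mem ((WMon.gen j hj).mem_monSpan le_rfl)
  · intro m n a b _ _ ha hb
    rw [Submodule.mem_comap, S.sig_mul]
    exact_mod_cast hF.mul_mem ha hb

/-- The supercommutator `a z - z a` with an odd operator `z`, up to sign. -/
def twist (z : B) : B →ₗ[K] B :=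
  LinearMap.mulRight K z - LinearMap.mulLeft K z ∘ₗ S.sig

theorem twist_apply (z a : B) : S.twist z a = a * z - z * S.sig a := rfl

theorem twist_one (z : B) : S.twist z 1 = 0 := by
  rw [S.twist_apply, S.sig_one, one_mul, mul_one, sub_self]

theorem twist_mul (z a b : B) :
    S.twist z (a * b) = a * S.twist z b + S.twist z a * S.sig b := by
  simp only [S.twist_apply, S.sig_mul]
  noncomm_ring

/-- Supercommutation with x_k plays the part of ∂/∂y_k: it sends v_k to 1 and the later generators
to zero, and a twisted Leibniz rule extends this to monomials. -/
theorem twist_x_mem {k : ℕ} {w : ℤ} {a : B} (ha : a ∈ S.opSpan k w) :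
    S.twist (S.x k) a ∈ S.opSpan k (w + -wt k) := by
  have hF := S.opSpan_family k
  refine S.opSpan_le (F := fun w => (S.opSpan k (w + -wt k)).comap (S.twist (S.x k)))
    (fun _ _ h => Submodule.comap_mono (hF.mono (by omega))) ?_ ?_ ?_ w ha
  · rw [Submodule.mem_comap, S.twist_one]
    exact zero_mem _
  · intro j hj
    rw [Submodule.mem_comap, S.twist_apply, S.sig_v]
    rcases Nat.eq_zero_or_pos j with rfl | p
    · rw [add_zero, S.v_mul_x_self, mul_neg, sub_neg_eq_add, sub_add_cancel, add_neg_cancel]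
      exact hF.one_mem
    · rw [S.v_mul_x (by omega), mul_neg, sub_self]
      exact zero_mem _
  · intro m n a b ha hb iha ihb
    rw [Submodule.mem_comap, S.twist_mul]
    refine add_mem ?_ ?_
    · have := hF.mul_mem ha ihb
      rwa [show (m : ℤ) + (n + -wt k) = (m + n : ℕ) + -wt k by push_cast; ring] at this
    · have := hF.mul_mem iha (S.sig_mem_opSpan hb)
      rwa [show (m : ℤ) + -wt k + n = (m + n : ℕ) + -wt k by push_cast; ring] at this

theorem twist_eq_zero {k : ℕ} {z : B}
    (hz : ∀ n, k ≤ n → S.v n * z = -(z * S.v n)) {w : ℤ} {a : B}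
    (ha : a ∈ S.opSpan k w) : S.twist z a = 0 := by
  refine S.opSpan_le (F := fun _ => LinearMap.ker (S.twist z)) (fun _ _ _ => le_rfl) ?_ ?_ ?_ w ha
  · exact S.twist_one z
  · intro j _
    rw [LinearMap.mem_ker, S.twist_apply, S.sig_v, hz _ (by omega), mul_neg, sub_self]
  · intro m n a b _ _ ha hb
    rw [LinearMap.mem_ker] at *
    rw [S.twist_mul, ha, hb, mul_zero, zero_mul, add_zero]

/-- The span of the monomials in `v_k, v_{k+1}, v_{k+2}`, with the letter `x_k` adjoined. -/
def opSpanAdj (k : ℕ) : ℤ → Submodule K B :=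
  adjLetter (S.x k) (-wt k) (S.opSpan k)

theorem opSpanAdj_family (k : ℕ) : MulFamily (S.opSpanAdj k) :=
  (S.opSpan_family k).adjLetter (S.x_sq k) fun _ a ha =>
    ⟨S.sig a, S.sig_mem_opSpan ha, S.twist_x_mem ha⟩

theorem sig_mem_opSpanAdj {k : ℕ} {w : ℤ} {a : B}
    (ha : a ∈ S.opSpanAdj k w) : S.sig a ∈ S.opSpanAdj k w := by
  obtain ⟨f, hf, g, hg, rfl⟩ := mem_adjLetter.1 ha
  rw [map_add, S.sig_mul, S.sig_x, neg_mul, ← mul_neg]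
  exact mem_adjLetter.2 ⟨_, S.sig_mem_opSpan hf, _, neg_mem (S.sig_mem_opSpan hg), rfl⟩

theorem mul_eq_of_mem_opSpanAdj {k : ℕ} {z : B}
    (hz : ∀ n, k ≤ n → S.v n * z = -(z * S.v n)) (hz' : S.x k * z = -(z * S.x k)) {w : ℤ}
    {a : B} (ha : a ∈ S.opSpanAdj k w) : a * z = z * S.sig a := by
  obtain ⟨f, hf, g, hg, rfl⟩ := mem_adjLetter.1 ha
  have h1 := sub_eq_zero.1 (S.twist_eq_zero hz hf)
  have h2 := sub_eq_zero.1 (S.twist_eq_zero hz hg)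
  simp only [LinearMap.mulRight_apply, LinearMap.comp_apply, LinearMap.mulLeft_apply] at h1 h2
  rw [map_add, S.sig_mul, S.sig_x, add_mul, mul_assoc, h1, h2, ← mul_assoc, hz']
  noncomm_ring

/-- The analogue of `pivSpanAdj_le` with p_k in place of y_k: monomials are put in normal order,
with p_k and then x_k on the left. -/
theorem opSpanAdj_le (k : ℕ) (w : ℤ) : S.opSpanAdj k w ≤
    adjLetter (S.p k) (wt k) (adjLetter (S.x k) (-wt k) (S.opSpanAdj (k + 1))) w := by
  have hE := S.opSpanAdj_family (k + 1)
  have h1 : MulFamily (adjLetter (S.x k) (-wt k) (S.opSpanAdj (k + 1))) := by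
    refine hE.adjLetter (S.x_sq k) fun w a ha => ⟨S.sig a, S.sig_mem_opSpanAdj ha, ?_⟩
    rw [S.mul_eq_of_mem_opSpanAdj (fun n hn => S.v_mul_x (by omega)) (S.x_mul_x _ _) ha, sub_self]
    exact zero_mem _
  have hT : MulFamily
      (adjLetter (S.p k) (wt k) (adjLetter (S.x k) (-wt k) (S.opSpanAdj (k + 1)))) := by
    refine h1.adjLetter (S.p_mul_p_self k) fun w a ha => ?_
    obtain ⟨f, hf, g, hg, rfl⟩ := mem_adjLetter.1 ha
    have hz : S.x (k + 1) * S.p k = -(S.p k * S.x (k + 1)) := by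
      rw [S.p_mul_x, if_neg (by omega), zero_sub, neg_neg]
    have e : ∀ w, ∀ b ∈ S.opSpanAdj (k + 1) w, b * S.p k = S.p k * S.sig b := fun w b hb =>
      S.mul_eq_of_mem_opSpanAdj (fun n hn => S.v_mul_p (by omega)) hz hb
    have e2 : S.x k * S.p k = 1 - S.p k * S.x k := by
      rw [S.p_mul_x, if_pos rfl, sub_sub_cancel]
    -- Moving p_k to the left past x_k g flips the sign of that term and leaves the error `sig g`,
    -- whose weight w + `wt k` is just what is allowed.
    refine ⟨S.sig f + S.x k * -S.sig g, mem_adjLetter.2 ⟨_, S.sig_mem_opSpanAdj hf, _,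
      neg_mem (S.sig_mem_opSpanAdj hg), rfl⟩, ?_⟩
    have : (f + S.x k * g) * S.p k - S.p k * (S.sig f + S.x k * -S.sig g) = S.sig g := by
      rw [add_mul, mul_assoc, e _ f hf, e _ g hg, ← mul_assoc (S.x k), e2]
      noncomm_ring
    rw [this]
    refine le_adjLetter _ _ _ _ ?_
    have := S.sig_mem_opSpanAdj hg
    rwa [sub_neg_eq_add] at this
  have hup : ∀ w, S.opSpanAdj (k + 1) w ≤
      adjLetter (S.p k) (wt k) (adjLetter (S.x k) (-wt k) (S.opSpanAdj (k + 1))) w :=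
    fun w => (le_adjLetter _ _ _ w).trans (le_adjLetter _ _ _ w)
  have hgen : ∀ j, k + 1 ≤ j → j ≤ k + 3 → S.v j ∈ S.opSpanAdj (k + 1) (wt j) := by
    intro j h1 h2
    obtain ⟨i, rfl⟩ : ∃ i, j = k + 1 + i := ⟨j - (k + 1), by omega⟩
    exact le_adjLetter _ _ _ _ ((WMon.gen i (by omega)).mem_monSpan le_rfl)
  have hG : ∀ w, S.opSpan k w ≤
      adjLetter (S.p k) (wt k) (adjLetter (S.x k) (-wt k) (S.opSpanAdj (k + 1))) w := by
    refine S.opSpan_le hT.mono hT.one_mem ?_ fun m n a b _ _ ha hb => ?_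
    · intro j hj
      rcases Nat.eq_zero_or_pos j with rfl | p
      · rw [add_zero, S.v_eq]
        refine add_mem (h1.letter_mem _ _) ?_
        refine le_adjLetter _ _ _ _ (letter_mul_mem_adjLetter ?_)
        have := hE.mul_mem ((S.opSpan_family (k + 1)).letter_mem
          (S.x (k + 1)) (-wt (k + 1))) (hgen (k + 3) (by omega) le_rfl)
        rwa [wt_add_three, show -(wt (k + 1) : ℤ) + (wt (k + 1) + 2 * wt k : ℕ) =
          (wt k : ℤ) - -wt k by push_cast; ring] at this
      · exact hup _ (hgen _ (by omega) (by omega))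
    · exact_mod_cast hT.mul_mem ha hb
  have hxm : S.x k ∈
      adjLetter (S.p k) (wt k) (adjLetter (S.x k) (-wt k) (S.opSpanAdj (k + 1))) (-wt k) :=
    le_adjLetter _ _ _ _ (hE.letter_mem _ _)
  intro a ha
  obtain ⟨f, hf, g, hg, rfl⟩ := mem_adjLetter.1 ha
  refine add_mem (hG _ hf) ?_
  have := hT.mul_mem hxm (hG _ hg)
  rwa [show -(wt k : ℤ) + (w - -wt k) = w by ring] at this

/-- The generators `v_0, v_1, v_2`. -/
def gens : Set B := {S.v 0, S.v 1, S.v 2}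

/-- The span of the associative monomials of length at most `n` in `v_0, v_1, v_2`. -/
def words (n : ℕ) : Submodule K B :=
  Submodule.span K {w | ∃ l : List B, (∀ a ∈ l, a ∈ S.gens) ∧ 1 ≤ l.length ∧ l.length ≤ n ∧
    w = l.prod}

theorem mem_words {l : List (B)} (h : ∀ a ∈ l, a ∈ S.gens)
    (h1 : 1 ≤ l.length) {n : ℕ} (hn : l.length ≤ n) : l.prod ∈ S.words n :=
  Submodule.subset_span ⟨l, h, h1, hn, rfl⟩

theorem words_le_opSpan (n : ℕ) : S.words n ≤ S.opSpan 0 n := by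
  refine Submodule.span_le.2 ?_
  rintro _ ⟨l, hl, -, hn, rfl⟩
  have : WMon (fun _ _ => 0) (fun _ => False) id (S.v) 0 l.length l.prod := by
    clear hn
    induction l with
    | nil => exact WMon.one
    | cons a l ih =>
      rw [List.prod_cons, List.length_cons, add_comm]
      refine WMon.mul ?_ (ih fun b hb => hl b (List.mem_cons_of_mem _ hb))
      rcases hl a List.mem_cons_self with rfl | rfl | rfl
      · exact WMon.gen (k := 0) 0 (by omega)
      · exact WMon.gen (k := 0) 1 (by omega)
      · exact WMon.gen (k := 0) 2 (by omega)
  exact this.mem_monSpan (by exact_mod_cast hn)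

/-- A zero bracket and no admissible squares reduce the nonzero monomials of `WMon` to associative
words. -/
theorem finrank_words_le {n k : ℕ} (hn : n ≤ wt k) :
    Module.Finite K (S.words n) ∧
      Module.finrank K (S.words n) ≤ 2 * monCount 5 * 4 ^ k := by
  obtain ⟨h1, h2⟩ := finrank_adjLetter_monSpan_le (br := fun _ _ => 0)
    (adm := fun _ => False) (sq := id) (g := S.v) (x := S.x) (y := S.p) (fun _ => rfl)
    (fun _ => rfl) (fun _ => rfl) (fun _ => rfl) not_false rfl (fun k w => S.opSpanAdj_le k w) hn
  have hle := S.words_le_opSpan n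
  have hfin : Module.Finite K (S.opSpan 0 n) := h1
  exact ⟨Submodule.finiteDimensional_of_le hle, (Submodule.finrank_mono hle).trans h2⟩

/-! ## Many independent elements of the hull -/

theorem words_mono : Monotone (S.words) :=
  fun _ _ h => Submodule.span_mono fun _ ⟨l, h1, h2, h3, h4⟩ => ⟨l, h1, h2, h3.trans h, h4⟩

theorem mul_mem_words {m n : ℕ} {a b : B}
    (ha : a ∈ S.words m) (hb : b ∈ S.words n) :
    a * b ∈ S.words (m + n) := by
  refine bilinear_mem_of_span (LinearMap.mul K (B)) ?_ ha hb
  rintro _ ⟨l, hl, h1, h2, rfl⟩ _ ⟨l', hl', h1', h2', rfl⟩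
  rw [LinearMap.mul_apply', ← List.prod_append]
  refine S.mem_words ?_ ?_ ?_
  · intro c hc
    rcases List.mem_append.1 hc with hc | hc
    · exact hl c hc
    · exact hl' c hc
  · rw [List.length_append]; omega
  · rw [List.length_append]; omega

theorem sig_mem_prodSpan (L : List ℕ) {u : B}
    (hu : u ∈ prodSpan K (S.x) L) : S.sig u ∈ prodSpan K (S.x) L :=
  map_mem_prodSpan S.sig_one (fun j b => by rw [S.sig_mul, S.sig_x, neg_mul]) L u hu

theorem mul_eq_of_mem_prodSpan {L : List ℕ} {u z : B}
    (hu : u ∈ prodSpan K (S.x) L) (hL : ∀ j ∈ L, z * S.x j = -(S.x j * z)) :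
    z * u = S.sig u * z := by
  refine prodSpan_induction (P := fun u => z * u = S.sig u * z) ?_ ?_ ?_ u hu
  · intro c
    rw [map_smul, S.sig_one, mul_smul_comm, smul_mul_assoc, mul_one, one_mul]
  · intro a b ha hb
    rw [mul_add, ha, hb, map_add, add_mul]
  · intro j hj a ha
    rw [← mul_assoc, hL j hj, neg_mul, mul_assoc, ha, S.sig_mul, S.sig_x]
    noncomm_ring

theorem x_mul_mem_prodSpan {L : List ℕ} {u : B} (i : ℕ)
    (hu : u ∈ prodSpan K (S.x) L) : S.x i * u = S.sig u * S.x i :=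
  S.mul_eq_of_mem_prodSpan hu fun _ _ => S.x_mul_x _ _

/-- The scheme of `prodSpan_mul_piv_mem`, with each bracket replaced by a signed sum of two
products; `sig u` records the sign of moving an odd operator past u. -/
theorem prodSpan_mul_v_mem (N : ℕ) :
    ∀ u ∈ prodSpan K (S.x) (headIndices N), u * S.v N ∈ S.words (wt N) := by
  induction N using Nat.strong_induction_on with
  | _ N ih =>
    have base : ∀ n, S.v n ∈ S.gens → ∀ u ∈ prodSpan K (S.x) [],
        u * S.v n ∈ S.words 1 := by
      intro n hn u hu
      obtain ⟨c, rfl⟩ := Submodule.mem_span_singleton.1 hu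
      rw [smul_mul_assoc, one_mul]
      have := S.mem_words (l := [S.v n]) (by simpa using hn) le_rfl le_rfl
      rw [List.prod_cons, List.prod_nil, mul_one] at this
      exact Submodule.smul_mem _ _ this
    match N with
    | 0 => exact base 0 (Or.inl rfl)
    | 1 => exact base 1 (Or.inr (Or.inl rfl))
    | 2 => exact base 2 (Or.inr (Or.inr rfl))
    | m + 3 =>
      have hV : S.v m ∈ S.words (wt m) := by
        have := ih m (by omega) 1 (one_mem_prodSpan _ _)
        rwa [one_mul] at this
      have h1 := ih (m + 1) (by omega)
      have hlt : ∀ j ∈ headIndices (m + 1), j < m := fun j hj => by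
        have := mem_headIndices j hj; omega
      have stepA : ∀ u ∈ prodSpan K (S.x) (headIndices (m + 1)),
          S.x m * (u * S.v (m + 3)) ∈ S.words (wt (m + 1) + wt m) := by
        intro u hu
        have hu' := S.sig_mem_prodSpan _ hu
        have hc := S.mul_mem_words hV (h1 _ hu)
        rw [add_comm] at hc
        have := add_mem (S.mul_mem_words (h1 _ hu') hV) hc
        have e : S.sig u * S.v (m + 1) * S.v m + S.v m * (u * S.v (m + 1)) =
            -(S.x m * (u * S.v (m + 3))) := by
          rw [← mul_assoc (S.v m), S.mul_eq_of_mem_prodSpan hu fun j hj => S.v_mul_x (hlt j hj),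
            mul_assoc, mul_assoc, ← mul_add, S.v_succ_mul_v, ← mul_assoc (S.x m),
            S.x_mul_mem_prodSpan m hu, mul_neg, mul_assoc]
        rwa [e, neg_mem_iff] at this
      set L := (if 3 ≤ m then (m - 3) :: headIndices (m + 1) else headIndices (m + 1)) with hLdef
      have hL : ∀ j ∈ L, j < m := by
        intro j hj
        rw [hLdef] at hj
        split_ifs at hj
        · rcases List.mem_cons.1 hj with rfl | hj
          · omega
          · exact hlt j hj
        · exact hlt j hj
      have stepB : ∀ u ∈ prodSpan K (S.x) L,
          S.x m * (u * S.v (m + 3)) ∈ S.words (wt (m + 1) + wt m) := by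
        intro u hu
        rw [hLdef] at hu
        split_ifs at hu with h3
        · obtain ⟨a, ha, b, hb, rfl⟩ := mem_prodSpan_cons.1 hu
          rw [add_mul, mul_add]
          refine add_mem (stepA a ha) ?_
          have hz : S.x (m - 3) * S.v m ∈ S.words (wt m) := by
            have : S.x (m - 3) * 1 ∈ prodSpan K (S.x) (headIndices m) := by
              obtain ⟨i, rfl⟩ : ∃ i, m = i + 3 := ⟨m - 3, by omega⟩
              rw [headIndices]
              exact Submodule.mem_sup_right ⟨1, one_mem_prodSpan _ _, rfl⟩
            have := ih m (by omega) _ this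
            rwa [mul_one] at this
          have hc := S.mul_mem_words hz (h1 _ hb)
          rw [add_comm] at hc
          have := sub_mem hc (S.mul_mem_words (h1 _ hb) hz)
          have e0 : b * S.x (m - 3) = S.x (m - 3) * S.sig b := by
            have := S.x_mul_mem_prodSpan (m - 3) (S.sig_mem_prodSpan _ hb)
            rw [this, S.sig_sig]
          have e1 : S.x (m - 3) * S.v m * (b * S.v (m + 1)) =
              b * S.x (m - 3) * (S.v m * S.v (m + 1)) := by
            rw [mul_assoc, ← mul_assoc (S.v m),
              S.mul_eq_of_mem_prodSpan hb fun j hj => S.v_mul_x (hlt j hj), e0]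
            noncomm_ring
          have e2 : b * S.v (m + 1) * (S.x (m - 3) * S.v m) =
              -(b * S.x (m - 3) * (S.v (m + 1) * S.v m)) := by
            rw [mul_assoc, ← mul_assoc (S.v (m + 1)), S.v_mul_x (by omega)]
            noncomm_ring
          have e : S.x (m - 3) * S.v m * (b * S.v (m + 1)) -
              b * S.v (m + 1) * (S.x (m - 3) * S.v m) =
              S.x m * (S.x (m - 3) * b * S.v (m + 3)) := by
            rw [e1, e2, sub_neg_eq_add, ← mul_add, add_comm, S.v_succ_mul_v, e0, mul_neg, mul_assoc,
              ← mul_assoc (S.sig b), ← S.x_mul_mem_prodSpan m hb, ← mul_assoc, ← mul_assoc,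
              S.x_mul_x]
            noncomm_ring
          rwa [e] at this
        · exact stepA u hu
      have stepC : ∀ u ∈ prodSpan K (S.x) L, u * S.v (m + 3) ∈ S.words (wt (m + 3)) := by
        intro u hu
        have hu' := S.sig_mem_prodSpan _ hu
        have hc := S.mul_mem_words (stepB _ hu') hV
        have hc' := S.mul_mem_words hV (stepB u hu)
        rw [add_comm] at hc'
        have := sub_mem hc' hc
        have e0 : S.x m * S.sig u = u * S.x m := by
          rw [S.x_mul_mem_prodSpan m hu', S.sig_sig]
        -- In the first product v_m x_m = 1 - x_m v_m. The 1 gives the desired element, and the rest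
        -- cancels against the second product by `x_mul_v_mul_v`.
        have e : S.v m * (S.x m * (u * S.v (m + 3))) - S.x m * (S.sig u * S.v (m + 3)) * S.v m =
            u * S.v (m + 3) := by
          have e1 : S.x m * (S.v m * (u * S.v (m + 3))) =
              -(S.x m * (S.sig u * S.v (m + 3)) * S.v m) := by
            rw [← mul_assoc (S.v m), S.mul_eq_of_mem_prodSpan hu fun j hj => S.v_mul_x (hL j hj),
              ← mul_assoc (S.x m), ← mul_assoc (S.x m), e0, mul_assoc, mul_assoc, ← mul_assoc (S.x m),
              ← mul_assoc (S.x m) _ (S.v (m + 3)), e0]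
            rw [mul_assoc (S.x m), S.x_mul_v_mul_v (by omega)]
            noncomm_ring
          rw [← mul_assoc (S.v m), S.v_mul_x_self, sub_mul, one_mul, mul_assoc (S.x m) (S.v m), e1]
          noncomm_ring
        rw [e] at this
        convert this using 2
        rw [wt_add_three]; ring
      intro u hu
      rw [headIndices] at hu
      obtain ⟨a, ha, b, hb, rfl⟩ := mem_prodSpan_cons.1 hu
      rw [add_mul, mul_assoc]
      refine add_mem (stepC a ha) (S.words_mono ?_ (stepB b hb))
      rw [wt_add_three]; omega

theorem v_mem_words (n : ℕ) : S.v n ∈ S.words (wt n) := by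
  have := S.prodSpan_mul_v_mem n 1 (one_mem_prodSpan _ _)
  rwa [one_mul] at this

/-- The supercommutator `z a - a z` with an odd operator `z`, up to sign. -/
def superComm (z : B) : Module.End K B :=
  LinearMap.mulLeft K z - LinearMap.mulRight K z ∘ₗ S.sig

/-- A supercommutator is a superderivation. So relations between z and a in the algebra become the
relations between `superComm z` and left multiplication by a that `finrank_subwordSpan` demands. -/
theorem superComm_mul (z : B) {a : B} (ha : S.sig a = -a)
    (b : B) :
    S.superComm z (a * b) + a * S.superComm z b = (z * a + a * z) * b := by
  change z * (a * b) - S.sig (a * b) * z + a * (z * b - S.sig b * z) = _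
  rw [S.sig_mul, ha]
  noncomm_ring

theorem superComm_eq_zero {z a : B} (ha : S.sig a = -a)
    (h : a * z = -(z * a)) : S.superComm z a = 0 := by
  change z * a - S.sig a * z = 0
  rw [ha, neg_mul, h]
  noncomm_ring

theorem superComm_mul_anti {z a : B} (ha : S.sig a = -a)
    (h : a * z = -(z * a)) (b : B) :
    S.superComm z (a * b) = -(a * S.superComm z b) := by
  rw [← add_eq_zero_iff_eq_neg, S.superComm_mul z ha, h, add_neg_cancel, zero_mul]

/-- Left multiplication by v_k is dual to the supercommutator with x_k, and left multiplication by
x_j to that with p_j. -/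
theorem four_pow_le_finrank_words [Nontrivial B] {N n : ℕ} (hn : 4 * wt N ≤ n) :
    4 ^ N ≤ 8 * Module.finrank K (S.words n) := by
  let A : List (Module.End K B × Module.End K B) :=
    (headIndices N).map fun j => (LinearMap.mulLeft K (S.x j), S.superComm (S.p j))
  let p : ℕ → Module.End K B × Module.End K B :=
    fun k => (LinearMap.mulLeft K (S.v k), S.superComm (S.x k))
  have hle : ∀ J : List ℕ, subwordSpan (S.v N) (J.map p ++ A) ≤
      S.words (wt N + (J.map wt).sum) := by
    intro J
    induction J with
    | nil =>
      refine (subwordSpan_le_prodSpan _ _ _ _).trans ?_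
      rintro _ ⟨u, hu, rfl⟩
      exact S.prodSpan_mul_v_mem N u hu
    | cons k J ihJ =>
      rw [List.map_cons, List.cons_append, subwordSpan, List.map_cons, List.sum_cons]
      refine sup_le (ihJ.trans (S.words_mono (by omega))) ?_
      rintro _ ⟨m, hm, rfl⟩
      have := S.mul_mem_words (S.v_mem_words k) (ihJ hm)
      rwa [show wt k + (wt N + (J.map wt).sum) = wt N + (wt k + (J.map wt).sum) by ring] at this
  have hne : S.v N ≠ 0 := by
    intro h0
    have h1 := S.v_mul_x_self N
    rw [h0, zero_mul, mul_zero, sub_zero] at h1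
    exact zero_ne_one h1
  have hlt : ∀ j ∈ headIndices N, j < N := fun j hj => by
    have := mem_headIndices j hj; omega
  have hdim : Module.finrank K (subwordSpan (S.v N) ((List.range N).map p ++ A)) =
      2 ^ ((List.range N).map p ++ A).length := by
    refine finrank_subwordSpan hne _ ?_ ?_ ?_
    · intro q hq
      rcases List.mem_append.1 hq with hq | hq
      · obtain ⟨k, hk, rfl⟩ := List.mem_map.1 hq
        exact S.superComm_eq_zero (S.sig_v N) (S.v_mul_x (List.mem_range.1 hk))
      · obtain ⟨k, hk, rfl⟩ := List.mem_map.1 hq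
        exact S.superComm_eq_zero (S.sig_v N) (S.v_mul_p (hlt k hk))
    · intro q hq m
      rcases List.mem_append.1 hq with hq | hq
      · obtain ⟨k, hk, rfl⟩ := List.mem_map.1 hq
        refine (S.superComm_mul _ (S.sig_v k) m).trans ?_
        rw [S.v_mul_x_self, add_sub_cancel, one_mul]
      · obtain ⟨k, hk, rfl⟩ := List.mem_map.1 hq
        refine (S.superComm_mul _ (S.sig_x k) m).trans ?_
        rw [S.p_mul_x, if_pos rfl, sub_add_cancel, one_mul]
    · refine List.pairwise_append.2 ⟨?_, ?_, ?_⟩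
      · rw [List.pairwise_map]
        refine List.Pairwise.imp ?_ List.pairwise_lt_range
        intro i j hij m
        exact S.superComm_mul_anti (S.sig_v j) (S.v_mul_x hij) m
      · rw [List.pairwise_map]
        refine List.Pairwise.imp ?_ (nodup_headIndices N)
        intro i j hij m
        refine S.superComm_mul_anti (S.sig_x j) ?_ m
        rw [S.p_mul_x, if_neg hij, zero_sub, neg_neg]
      · intro q hq q' hq' m
        obtain ⟨k, hk, rfl⟩ := List.mem_map.1 hq
        obtain ⟨j, hj, rfl⟩ := List.mem_map.1 hq'
        exact S.superComm_mul_anti (S.sig_x j) (S.x_mul_x _ _) m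
  have hfin : Module.Finite K (S.words n) :=
    (S.finrank_words_le (le_wt n)).1
  have hS := wtSum_le N
  have hsub : subwordSpan (S.v N) ((List.range N).map p ++ A) ≤ S.words n :=
    (hle (List.range N)).trans (S.words_mono (by rw [sum_map_wt_range]; omega))
  have := Submodule.finrank_mono hsub
  rw [hdim, List.length_append, List.length_map, List.length_range, List.length_map] at this
  exact (four_pow_le N).trans (Nat.mul_le_mul_left 8 this)

end PivotSystem

end FractalSuper

end

noncomputable section

namespace FractalSuper

/-! ## Relations between the operators on the Grassmann algebra -/

section HullRelations

variable {K : Type*} [Field K]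

theorem pd_gx_mul (i j : ℕ) (f : Lam K) :
    pd K i (gx K j * f) = (if i = j then f else 0) - gx K j * pd K i f := by
  have := CliffordAlgebra.contractLeft_ι_mul (Q := (0 : QuadraticForm K (ℕ →₀ K)))
    (d := Finsupp.lapply i) (Finsupp.single j 1) f
  refine this.trans ?_
  congr 1
  rw [Finsupp.lapply_apply, Finsupp.single_apply]
  by_cases h : i = j
  · rw [if_pos h, if_pos h.symm, one_smul]
  · rw [if_neg h, if_neg (Ne.symm h), zero_smul]

theorem gx_mul_gx (i j : ℕ) : gx K i * gx K j = -(gx K j * gx K i) :=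
  eq_neg_of_add_eq_zero_left (ExteriorAlgebra.ι_add_mul_swap _ _)

theorem gx_sq (i : ℕ) : gx K i * gx K i = 0 := ExteriorAlgebra.ι_sq_zero _

theorem pd_pd (i j : ℕ) (f : Lam K) : pd K i (pd K j f) = -pd K j (pd K i f) :=
  CliffordAlgebra.contractLeft_comm _ _ _

theorem pd_sq (i : ℕ) (f : Lam K) : pd K i (pd K i f) = 0 :=
  CliffordAlgebra.contractLeft_contractLeft _ _

theorem tailProd_succ' (n l : ℕ) :
    tailProd K n (l + 1) = gx K n * (gx K (n + 1) * tailProd K (n + 3) l) := by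
  induction l with
  | zero => simp [tailProd]
  | succ l ih =>
    rw [tailProd, ih, tailProd, show n + 3 * (l + 1) = n + 3 + 3 * l by ring]
    simp only [mul_assoc]

theorem v_apply (n : ℕ) (f : Lam K) :
    v K n f = ∑ᶠ l : ℕ, tailProd K n l * pd K (n + 3 * l) f := rfl

theorem v_apply_eq (n : ℕ) (f : Lam K) :
    v K n f = pd K n f + gx K n * (gx K (n + 1) * v K (n + 3) f) := by
  have hfin : ∀ n, ∃ N, ∀ L, N ≤ L →
      v K n f = ∑ l ∈ Finset.range L, tailProd K n l * pd K (n + 3 * l) f := by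
    intro n
    obtain ⟨N, hN⟩ := (pivot_support_finite K n f).bddAbove
    refine ⟨N + 1, fun L hL => ?_⟩
    rw [v_apply, finsum_eq_sum_of_support_subset]
    intro l hl
    have := hN hl
    simp only [Finset.coe_range, Set.mem_Iio]
    omega
  obtain ⟨N, hN⟩ := hfin n
  obtain ⟨N', hN'⟩ := hfin (n + 3)
  rw [hN (max N N' + 1) (by omega), hN' (max N N') (by omega), Finset.sum_range_succ', add_comm,
    Finset.mul_sum, Finset.mul_sum]
  congr 1
  · simp [tailProd]
  · refine Finset.sum_congr rfl fun l _ => ?_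
    rw [tailProd_succ', show n + 3 * (l + 1) = n + 3 + 3 * l by ring]
    simp only [mul_assoc]

theorem v_apply_eq_zero {n : ℕ} {f : Lam K} (h : ∀ i, n ≤ i → pd K i f = 0) : v K n f = 0 := by
  rw [v_apply]
  refine (finsum_congr fun l => ?_).trans finsum_zero
  rw [h _ (by omega), mul_zero]

theorem exists_pd_eq_zero (f : Lam K) : ∃ M, ∀ i, M ≤ i → pd K i f = 0 := by
  obtain ⟨N, hN⟩ := (pd_support_finite K f).bddAbove
  refine ⟨N + 1, fun i hi => ?_⟩
  by_contra hc
  have := hN hc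
  omega

/-- To check an identity for all `v_n`, it suffices to deal with large `n` and to descend. -/
theorem descend {P : ℕ → Prop} {M k : ℕ} (hM : ∀ n, M ≤ n → P n)
    (hd : ∀ n, k ≤ n → P (n + 3) → P n) (n : ℕ) (hn : k ≤ n) : P n := by
  by_cases h : M ≤ n
  · exact hM n h
  · exact hd n hn (descend hM hd (n + 3) (by omega))
termination_by M - n

/-- As f involves finitely many letters, both sides vanish for large indices; the self-similarity of
v descends from n + 3 to n. -/
theorem v_gx_mul {i j : ℕ} (h : i < j) (f : Lam K) : v K j (gx K i * f) = -(gx K i * v K j f) := by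
  obtain ⟨M, hM⟩ := exists_pd_eq_zero f
  refine descend (P := fun j => v K j (gx K i * f) = -(gx K i * v K j f)) (M := max M (i + 1))
    (k := i + 1) (fun n hn => ?_) (fun n hn ih => ?_) j h
  · rw [v_apply_eq_zero, v_apply_eq_zero (f := f), mul_zero, neg_zero]
    · exact fun m hm => hM m (by omega)
    · intro m hm
      rw [pd_gx_mul, if_neg (by omega), hM m (by omega), mul_zero, sub_zero]
  · rw [v_apply_eq, ih, pd_gx_mul, if_neg (by omega), v_apply_eq n f, mul_add]
    simp only [mul_neg, ← mul_assoc]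
    rw [mul_assoc (gx K n), gx_mul_gx (n + 1) i, mul_neg, ← mul_assoc, gx_mul_gx n i]
    noncomm_ring

theorem v_pd {i j : ℕ} (h : i < j) (f : Lam K) : v K j (pd K i f) = -pd K i (v K j f) := by
  obtain ⟨M, hM⟩ := exists_pd_eq_zero f
  refine descend (P := fun j => v K j (pd K i f) = -pd K i (v K j f)) (M := M)
    (k := i + 1) (fun n hn => ?_) (fun n hn ih => ?_) j h
  · rw [v_apply_eq_zero, v_apply_eq_zero (f := f), map_zero, neg_zero]
    · exact fun m hm => hM m (by omega)
    · intro m hm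
      rw [pd_pd, hM m (by omega), map_zero, neg_zero]
  · rw [v_apply_eq, ih, v_apply_eq n f, map_add, pd_gx_mul, pd_gx_mul, if_neg (by omega),
      if_neg (by omega), pd_pd]
    noncomm_ring

/-- The parity automorphism of the Grassmann algebra. -/
def grading (K : Type*) [Field K] : Module.End K (Lam K) :=
  (CliffordAlgebra.involute (Q := (0 : QuadraticForm K (ℕ →₀ K)))).toLinearMap

theorem grading_grading (f : Lam K) : grading K (grading K f) = f :=
  CliffordAlgebra.involute_involute f

theorem grading_gx_mul (i : ℕ) (f : Lam K) :
    grading K (gx K i * f) = -(gx K i * grading K f) := by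
  have h1 : grading K (gx K i * f) = grading K (gx K i) * grading K f :=
    map_mul (CliffordAlgebra.involute (Q := (0 : QuadraticForm K (ℕ →₀ K)))) _ _
  have h2 : grading K (gx K i) = -gx K i := CliffordAlgebra.involute_ι _
  rw [h1, h2, neg_mul]

theorem grading_pd (i : ℕ) (f : Lam K) : grading K (pd K i f) = -pd K i (grading K f) := by
  have hι : ∀ (m : ℕ →₀ K) (f : Lam K), grading K (CliffordAlgebra.ι _ m * f) =
      -(CliffordAlgebra.ι _ m * grading K f) := by
    intro m f
    have h1 : grading K (CliffordAlgebra.ι _ m * f) =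
        grading K (CliffordAlgebra.ι _ m) * grading K f :=
      map_mul (CliffordAlgebra.involute (Q := (0 : QuadraticForm K (ℕ →₀ K)))) _ _
    have h2 : grading K (CliffordAlgebra.ι _ m) = -CliffordAlgebra.ι _ m :=
      CliffordAlgebra.involute_ι _
    rw [h1, h2, neg_mul]
  have hp : ∀ (m : ℕ →₀ K) (f : Lam K), pd K i (CliffordAlgebra.ι _ m * f) =
      m i • f - CliffordAlgebra.ι _ m * pd K i f := fun m f =>
    CliffordAlgebra.contractLeft_ι_mul _ _ _
  induction f using CliffordAlgebra.left_induction with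
  | algebraMap r =>
    have h1 : pd K i (algebraMap K _ r) = 0 := CliffordAlgebra.contractLeft_algebraMap _ _ _
    have h2 : grading K (algebraMap K _ r) = algebraMap K _ r :=
      AlgHom.commutes (CliffordAlgebra.involute (Q := (0 : QuadraticForm K (ℕ →₀ K)))) r
    rw [h2, h1, map_zero, neg_zero]
  | add a b ha hb => rw [map_add, map_add, ha, hb, map_add, map_add]; abel
  | ι_mul a m ha =>
    rw [hp, map_sub, map_smul, hι, hι, ha, map_neg, hp]
    noncomm_ring

theorem grading_v (n : ℕ) (f : Lam K) : grading K (v K n f) = -v K n (grading K f) := by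
  obtain ⟨M, hM⟩ := exists_pd_eq_zero f
  refine descend (P := fun n => grading K (v K n f) = -v K n (grading K f)) (M := M)
    (k := 0) (fun n hn => ?_) (fun n hn ih => ?_) n (Nat.zero_le n)
  · rw [v_apply_eq_zero, v_apply_eq_zero (f := grading K f), map_zero, neg_zero]
    · intro m hm
      rw [← neg_eq_zero, ← grading_pd, hM m (by omega), map_zero]
    · exact fun m hm => hM m (by omega)
  · rw [v_apply_eq, map_add, grading_gx_mul, grading_gx_mul, ih, grading_pd,
      v_apply_eq n (grading K f)]
    noncomm_ring

/-- Left multiplication by the letter `x_i`. -/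
def hx (K : Type*) [Field K] (i : ℕ) : Module.End K (Lam K) := LinearMap.mulLeft K (gx K i)

theorem hx_apply (i : ℕ) (f : Lam K) : hx K i f = gx K i * f := rfl

theorem hx_sq (i : ℕ) : hx K i * hx K i = 0 := by
  refine LinearMap.ext fun f => ?_
  rw [Module.End.mul_apply, hx_apply, hx_apply, ← mul_assoc, gx_sq, zero_mul,
    LinearMap.zero_apply]

theorem hx_mul_hx (i j : ℕ) : hx K i * hx K j = -(hx K j * hx K i) := by
  refine LinearMap.ext fun f => ?_
  rw [Module.End.mul_apply, LinearMap.neg_apply, Module.End.mul_apply, hx_apply, hx_apply,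
    hx_apply, hx_apply, ← mul_assoc, ← mul_assoc, gx_mul_gx, neg_mul]

theorem pd_mul_hx (i j : ℕ) : pd K i * hx K j = (if i = j then 1 else 0) - hx K j * pd K i := by
  refine LinearMap.ext fun f => ?_
  rw [Module.End.mul_apply, LinearMap.sub_apply, Module.End.mul_apply, hx_apply, hx_apply,
    pd_gx_mul]
  split_ifs <;> rfl

theorem pd_mul_pd_self (i : ℕ) : pd K i * pd K i = 0 := by
  refine LinearMap.ext fun f => ?_
  exact pd_sq i f

theorem v_eq (n : ℕ) : v K n = pd K n + hx K n * (hx K (n + 1) * v K (n + 3)) := by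
  refine LinearMap.ext fun f => ?_
  exact v_apply_eq n f

theorem v_mul_hx {i j : ℕ} (h : i < j) : v K j * hx K i = -(hx K i * v K j) := by
  refine LinearMap.ext fun f => ?_
  exact v_gx_mul h f

theorem v_mul_pd {i j : ℕ} (h : i < j) : v K j * pd K i = -(pd K i * v K j) := by
  refine LinearMap.ext fun f => ?_
  exact v_pd h f

/-- The parity automorphism of the algebra of operators. -/
def hsig (K : Type*) [Field K] : Module.End K (Lam K) →ₗ[K] Module.End K (Lam K) :=
  LinearMap.mulLeft K (grading K) ∘ₗ LinearMap.mulRight K (grading K)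

theorem hsig_apply (a : Module.End K (Lam K)) : hsig K a = grading K * (a * grading K) := rfl

theorem grading_mul_grading : grading K * grading K = 1 := by
  refine LinearMap.ext fun f => ?_
  exact grading_grading f

theorem hsig_one : hsig K 1 = 1 := by rw [hsig_apply, one_mul, grading_mul_grading]

theorem hsig_mul (a b : Module.End K (Lam K)) : hsig K (a * b) = hsig K a * hsig K b := by
  simp only [hsig_apply, mul_assoc]
  rw [← mul_assoc (grading K) (grading K), grading_mul_grading, one_mul]

theorem hsig_hsig (a : Module.End K (Lam K)) : hsig K (hsig K a) = a := by
  simp only [hsig_apply, mul_assoc]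
  rw [grading_mul_grading, mul_one, ← mul_assoc, grading_mul_grading, one_mul]

theorem hsig_eq_neg {a : Module.End K (Lam K)}
    (h : ∀ f, grading K (a f) = -a (grading K f)) : hsig K a = -a := by
  refine LinearMap.ext fun f => ?_
  change grading K (a (grading K f)) = -a f
  rw [h, grading_grading]

theorem hsig_hx (i : ℕ) : hsig K (hx K i) = -hx K i := hsig_eq_neg (grading_gx_mul i)

theorem hsig_v (i : ℕ) : hsig K (v K i) = -v K i := hsig_eq_neg (grading_v i)

end HullRelations

/-! ## The hull as a pivot system -/

section HullGrowth

variable {K : Type*} [Field K]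

variable (K) in
/-- The operators on the Grassmann algebra form a pivot system. -/
def hullSystem : PivotSystem K (Module.End K (Lam K)) where
  x := hx K
  p := pd K
  v := v K
  sig := hsig K
  x_sq := hx_sq
  x_mul_x := hx_mul_hx
  p_mul_x := pd_mul_hx
  p_mul_p_self := pd_mul_pd_self
  v_eq := v_eq
  v_mul_x := v_mul_hx
  v_mul_p := v_mul_pd
  sig_one := hsig_one
  sig_mul := hsig_mul
  sig_sig := hsig_hsig
  sig_x := hsig_hx
  sig_v := hsig_v

theorem finrank_hullFiltration_le {n k : ℕ} (hn : n ≤ wt k) :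
    Module.finrank K (hullFiltration K n) ≤ 2 * monCount 5 * 4 ^ k :=
  ((hullSystem K).finrank_words_le hn).2

theorem four_pow_le_finrank_hullFiltration {N n : ℕ} (hn : 4 * wt N ≤ n) :
    4 ^ N ≤ 8 * Module.finrank K (hullFiltration K n) :=
  (hullSystem K).four_pow_le_finrank_words hn

theorem mem_hullFiltration {l : List (Module.End K (Lam K))} (h : ∀ a ∈ l, a ∈ hullGens K)
    (h1 : 1 ≤ l.length) {n : ℕ} (hn : l.length ≤ n) : l.prod ∈ hullFiltration K n :=
  Submodule.subset_span ⟨l, h, h1, hn, rfl⟩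

theorem iSup_hullFiltration : iSup (hullFiltration K) = (assocHull K).toSubmodule := by
  refine le_antisymm (iSup_le fun n => Submodule.span_le.2 ?_) ?_
  · rintro _ ⟨l, hl, h1, -, rfl⟩
    induction l with
    | nil => simp at h1
    | cons a l ih =>
      have ha : a ∈ assocHull K := NonUnitalAlgebra.subset_adjoin K (hl a List.mem_cons_self)
      rcases l with _ | ⟨b, l⟩
      · rw [List.prod_cons, List.prod_nil, mul_one]
        exact ha
      · rw [List.prod_cons]
        exact (assocHull K).mul_mem ha (ih (fun c hc => hl c (List.mem_cons_of_mem _ hc)) (by simp))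
  · rw [assocHull, NonUnitalAlgebra.adjoin_eq_span, Submodule.span_le]
    intro w hw
    have : ∃ l : List (Module.End K (Lam K)), (∀ a ∈ l, a ∈ hullGens K) ∧ 1 ≤ l.length ∧
        w = l.prod := by
      induction hw using Subsemigroup.closure_induction with
      | mem a ha => exact ⟨[a], by simpa using ha, by simp, by simp⟩
      | mul a b _ _ iha ihb =>
        obtain ⟨l, h1, h2, rfl⟩ := iha
        obtain ⟨l', h1', h2', rfl⟩ := ihb
        refine ⟨l ++ l', fun c hc => ?_, ?_, List.prod_append.symm⟩
        · rcases List.mem_append.1 hc with hc | hc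
          · exact h1 c hc
          · exact h1' c hc
        · rw [List.length_append]; omega
    obtain ⟨l, h1, h2, rfl⟩ := this
    exact Submodule.mem_iSup_of_mem l.length (mem_hullFiltration h1 h2 le_rfl)

end HullGrowth

end FractalSuper

end

noncomputable section

namespace FractalSuper

/-! ## The Jordan superalgebra -/

open Gr

section Jordan

variable {K : Type*} [Field K]

/-! ### Bilinearity of the Kantor product. -/

theorem gmul_zero (f : Ser K) : gmul f 0 = 0 := mul_zero (M₀ := Gr K Letter) f

theorem zero_gmul (f : Ser K) : gmul 0 f = 0 := zero_mul (M₀ := Gr K Letter) f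

theorem gpar_zero : gpar (0 : Ser K) = 0 := map_zero (Gr.par : Gr K Letter →ₗ[K] Gr K Letter)

theorem gpar_gpar (f : Ser K) : gpar (gpar f) = f := Gr.par_par (f : Gr K Letter)

theorem add_gmul (f g h : Ser K) : gmul (f + g) h = gmul f h + gmul g h :=
  add_mul (R := Gr K Letter) f g h

theorem gmul_add (f g h : Ser K) : gmul f (g + h) = gmul f g + gmul f h :=
  mul_add (R := Gr K Letter) f g h

theorem smul_gmul (c : K) (f g : Ser K) : gmul (c • f) g = c • gmul f g :=
  smul_mul_assoc (β := Gr K Letter) c f g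

theorem gmul_smul (c : K) (f g : Ser K) : gmul f (c • g) = c • gmul f g :=
  mul_smul_comm (β := Gr K Letter) c f g

theorem gpar_add (f g : Ser K) : gpar (f + g) = gpar f + gpar g :=
  map_add (Gr.par : Gr K Letter →ₗ[K] Gr K Letter) f g

theorem gpar_smul (c : K) (f : Ser K) : gpar (c • f) = c • gpar f :=
  map_smul (Gr.par : Gr K Letter →ₗ[K] Gr K Letter) c f

theorem isBilinearOn_kanMul : IsBilinearOn ((Htilde K).prod (Htilde K)) (kanMul K) where
  add_left := by
    intro a a' b ha ha' hb
    simp only [kanMul, Prod.fst_add, Prod.snd_add, Prod.mk_add_mk, add_gmul,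
      bracket_add_left ha.2 ha'.2 (gpar_mem hb.2), add_add_add_comm]
  add_right := by
    intro a b b' ha hb hb'
    simp only [kanMul, Prod.fst_add, Prod.snd_add, Prod.mk_add_mk, gmul_add, gpar_add,
      bracket_add_right ha.2 (gpar_mem hb.2) (gpar_mem hb'.2), add_add_add_comm]
  smul_left := by
    intro c a b ha hb
    simp only [kanMul, Prod.smul_fst, Prod.smul_snd, Prod.smul_mk, smul_gmul, smul_add,
      bracket_smul_left c ha.2 (gpar_mem hb.2)]
  smul_right := by
    intro c a b ha hb
    simp only [kanMul, Prod.smul_fst, Prod.smul_snd, Prod.smul_mk, gmul_smul, gpar_smul, smul_add,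
      bracket_smul_right c ha.2 (gpar_mem hb.2)]

theorem bracket_gone_left {g : Ser K} (hg : g ∈ Htilde K) : bracket gone g = 0 :=
  bracket_eq_of_br (f := (1 : Gr K Letter)) gone_mem hg 0 fun M _ => br_one_left M _

theorem bracket_gone_right {f : Ser K} (hf : f ∈ Htilde K) : bracket f gone = 0 :=
  bracket_eq_of_br (g := (1 : Gr K Letter)) hf gone_mem 0 fun M _ => br_one_right M _

/-- Each component of a Kantor product consists of Poisson products and brackets, and parity
preserves the filtration. The generator \bar 1 has Jordan length 1, but its component has Poisson
length 0. -/
theorem jordanFiltration_le_prod (n : ℕ) :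
    jordanFiltration K n ≤ (poissonFiltration K n).prod (poissonFiltration K n) := by
  have key : ∀ m p, JordanMonomial K m p →
      p.1 ∈ poissonFiltration K m ∧ p.2 ∈ poissonFiltration K m := by
    intro m p hp
    induction hp with
    | one => exact ⟨PoissonMonomial.one.mem_filtration le_rfl, zero_mem _⟩
    | gen h =>
      rcases h with rfl | rfl | rfl | rfl
      · exact ⟨(PoissonMonomial.gen (Or.inl rfl)).mem_filtration le_rfl, zero_mem _⟩
      · exact ⟨(PoissonMonomial.gen (Or.inr (Or.inl rfl))).mem_filtration le_rfl, zero_mem _⟩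
      · exact ⟨(PoissonMonomial.gen (Or.inr (Or.inr rfl))).mem_filtration le_rfl, zero_mem _⟩
      · exact ⟨zero_mem _, PoissonMonomial.one.mem_filtration (Nat.zero_le 1)⟩
    | mul _ _ ih1 ih2 =>
      exact ⟨add_mem (gmul_mem_filtration ih1.1 ih2.1)
          (bracket_mem_filtration ih1.2 (gpar_mem_filtration ih2.2)),
        add_mem (gmul_mem_filtration ih1.2 (gpar_mem_filtration ih2.1))
          (gmul_mem_filtration ih1.1 ih2.2)⟩
  refine Submodule.span_le.2 ?_
  rintro p ⟨m, hm, hp⟩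
  exact ⟨poissonFiltration_mono hm (key m p hp).1, poissonFiltration_mono hm (key m p hp).2⟩

theorem finrank_jordanFiltration_le {n k : ℕ} (hn : n ≤ wt k) :
    Module.Finite K (jordanFiltration K n) ∧
      Module.finrank K (jordanFiltration K n) ≤ 4 * monCount 5 * 4 ^ k := by
  obtain ⟨h1, h2⟩ := finrank_poissonFiltration_le (K := K) hn
  have hle := jordanFiltration_le_prod (K := K) n
  have hE : ((poissonFiltration K n).prod (poissonFiltration K n)) =
      LinearMap.range ((poissonFiltration K n).subtype.prodMap (poissonFiltration K n).subtype) := by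
    rw [LinearMap.range_prodMap, Submodule.range_subtype]
  rw [hE] at hle
  refine ⟨Submodule.finiteDimensional_of_le hle, (Submodule.finrank_mono hle).trans ?_⟩
  refine (LinearMap.finrank_range_le _).trans ?_
  rw [Module.finrank_prod]
  linarith

theorem jordanFiltration_mono : Monotone (jordanFiltration K) :=
  fun _ _ h => Submodule.span_mono fun _ ⟨m, hm, hf⟩ => ⟨m, hm.trans h, hf⟩

theorem JordanMonomial.mem_filtration {m n : ℕ} {p : Ser K × Ser K} (h : JordanMonomial K m p)
    (hmn : m ≤ n) : p ∈ jordanFiltration K n := Submodule.subset_span ⟨m, hmn, h⟩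

theorem jordanFiltration_le_Htilde (n : ℕ) :
    jordanFiltration K n ≤ (Htilde K).prod (Htilde K) := fun _ hp =>
  ⟨mem_Htilde_of_mem (jordanFiltration_le_prod n hp).1,
    mem_Htilde_of_mem (jordanFiltration_le_prod n hp).2⟩

theorem kanMul_mem_filtration {m n : ℕ} {p q : Ser K × Ser K} (hp : p ∈ jordanFiltration K m)
    (hq : q ∈ jordanFiltration K n) : kanMul K p q ∈ jordanFiltration K (m + n) := by
  refine isBilinearOn_kanMul.mem_of_span
    (fun _ h => jordanFiltration_le_Htilde m (Submodule.subset_span h))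
    (fun _ h => jordanFiltration_le_Htilde n (Submodule.subset_span h)) ?_ hp hq
  rintro a ⟨i, hi, ha⟩ b ⟨j, hj, hb⟩
  exact (ha.mul hb).mem_filtration (by omega)

theorem bar_one_mem : ((0, gone) : Ser K × Ser K) ∈ jordanFiltration K 1 :=
  (JordanMonomial.gen (Or.inr (Or.inr (Or.inr rfl)))).mem_filtration le_rfl

theorem bar_mem {n : ℕ} {f : Ser K} (hf : (f, 0) ∈ jordanFiltration K n) :
    (0, f) ∈ jordanFiltration K (n + 1) := by
  have h := kanMul_mem_filtration hf bar_one_mem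
  have h0 : bracket 0 (gpar gone) = (0 : Ser K) :=
    isBilinearOn_bracket.zero_left (gpar_mem gone_mem)
  dsimp only [kanMul] at h
  rwa [gmul_zero, h0, zero_gmul, gmul_gone, add_zero, zero_add] at h

theorem bar_gpar_mem {n : ℕ} {f : Ser K} (hf : (f, 0) ∈ jordanFiltration K n) :
    (0, gpar f) ∈ jordanFiltration K (n + 1) := by
  have h := kanMul_mem_filtration bar_one_mem hf
  have h0 : bracket gone (gpar 0) = (0 : Ser K) := bracket_gone_left (gpar_mem (zero_mem _))
  rw [add_comm 1] at h
  dsimp only [kanMul] at h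
  rwa [zero_gmul, h0, zero_gmul, gone_gmul, add_zero, add_zero] at h

theorem gmul_mem_jordanFiltration {m n : ℕ} {f g : Ser K} (hf : (f, 0) ∈ jordanFiltration K m)
    (hg : (g, 0) ∈ jordanFiltration K n) : (gmul f g, 0) ∈ jordanFiltration K (m + n) := by
  have h := kanMul_mem_filtration hf hg
  have h0 : bracket 0 (gpar 0) = (0 : Ser K) :=
    isBilinearOn_bracket.zero_left (gpar_mem (zero_mem _))
  rwa [kanMul, h0, zero_gmul, gmul_zero, add_zero, add_zero] at h

/-- The product of \bar f with the barred `gpar g` is {f, g}, because the sign in the Kantor product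
undoes the parity. The bars come from \bar 1, multiplied on the right of f and on the left of g. -/
theorem bracket_mem_jordanFiltration {m n : ℕ} {f g : Ser K} (hf : (f, 0) ∈ jordanFiltration K m)
    (hg : (g, 0) ∈ jordanFiltration K n) : (bracket f g, 0) ∈ jordanFiltration K (m + n + 2) := by
  have h := kanMul_mem_filtration (bar_mem hf) (bar_gpar_mem hg)
  rw [show m + 1 + (n + 1) = m + n + 2 by ring] at h
  dsimp only [kanMul] at h
  rwa [gpar_gpar, gpar_zero, gmul_zero, zero_gmul, gmul_zero, zero_add, add_zero] at h

/-- Each bracket costs two letters `\bar 1`. -/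
theorem PoissonMonomial.mem_jordanFiltration (h2 : (2 : K) ≠ 0) {n : ℕ} {f : Ser K}
    (h : PoissonMonomial K n f) : (∃ c : K, f = c • gone) ∨
      ∃ m, m + 2 ≤ 3 * n ∧ (f, 0) ∈ jordanFiltration K m := by
  have hsmul : ∀ {m : ℕ} {g : Ser K} (c : K), (g, 0) ∈ jordanFiltration K m →
      (c • g, 0) ∈ jordanFiltration K m := by
    intro m g c hg
    have := Submodule.smul_mem _ c hg
    rwa [Prod.smul_mk, smul_zero] at this
  induction h with
  | one => exact Or.inl ⟨1, (one_smul K _).symm⟩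
  | gen h =>
    refine Or.inr ⟨1, by omega, (JordanMonomial.gen ?_).mem_filtration le_rfl⟩
    rcases h with rfl | rfl | rfl
    · exact Or.inl rfl
    · exact Or.inr (Or.inl rfl)
    · exact Or.inr (Or.inr (Or.inl rfl))
  | @mul m n f g hf hg ih1 ih2 =>
    rcases ih1 with ⟨c, rfl⟩ | ⟨i, hi, h1⟩
    · rw [smul_gmul, gone_gmul]
      rcases ih2 with ⟨d, rfl⟩ | ⟨j, hj, h2⟩
      · exact Or.inl ⟨c * d, smul_smul _ _ _⟩
      · exact Or.inr ⟨j, by omega, hsmul c h2⟩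
    · rcases ih2 with ⟨d, rfl⟩ | ⟨j, hj, h2⟩
      · rw [gmul_smul, gmul_gone]
        exact Or.inr ⟨i, by omega, hsmul d h1⟩
      · exact Or.inr ⟨i + j, by omega, gmul_mem_jordanFiltration h1 h2⟩
  | @bracket m n f g hf hg ih1 ih2 =>
    rcases ih1 with ⟨c, rfl⟩ | ⟨i, hi, h1⟩
    · refine Or.inl ⟨0, ?_⟩
      rw [bracket_smul_left c gone_mem hg.mem_Htilde, bracket_gone_left hg.mem_Htilde, smul_zero,
        zero_smul]
    · rcases ih2 with ⟨d, rfl⟩ | ⟨j, hj, h2⟩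
      · refine Or.inl ⟨0, ?_⟩
        rw [bracket_smul_right d hf.mem_Htilde gone_mem, bracket_gone_right hf.mem_Htilde,
          smul_zero, zero_smul]
      -- Each factor stays 2 below three times its length. One such reserve pays for the two bars,
      -- and the other is kept for the result; scalars are set apart as they have no reserve.
      · exact Or.inr ⟨i + j + 2, by omega, bracket_mem_jordanFiltration h1 h2⟩
  | square h => exact absurd h h2

theorem inl_mem_jordanFiltration (h2 : (2 : K) ≠ 0) {n : ℕ} {f : Ser K}
    (hf : f ∈ poissonFiltration K n) : (f, 0) ∈ jordanFiltration K (3 * n) := by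
  have : poissonFiltration K n ≤
      (jordanFiltration K (3 * n)).comap (LinearMap.inl K (Ser K) (Ser K)) := by
    refine Submodule.span_le.2 ?_
    rintro g ⟨m, hm, hg⟩
    rcases hg.mem_jordanFiltration h2 with ⟨c, rfl⟩ | ⟨i, hi, h⟩
    · exact Submodule.smul_mem _ c
        (JordanMonomial.one.mem_filtration (Nat.zero_le _) : (gone, 0) ∈ jordanFiltration K (3 * n))
    · exact jordanFiltration_mono (by omega) h
  exact this hf

/-- Poisson monomials of length n / 3 have Jordan length at most n, and 15 `wt N` leaves room for
rounding. -/
theorem four_pow_le_finrank_jordanFiltration (h2 : (2 : K) ≠ 0) {N n : ℕ} (hn : 15 * wt N ≤ n) :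
    4 ^ N ≤ 8 * Module.finrank K (jordanFiltration K n) := by
  have hp := wt_pos N
  have h1 := four_pow_le_finrank_poissonFiltration (K := K) (show 4 * wt N ≤ n / 3 by omega)
  have hfin : Module.Finite K (jordanFiltration K n) :=
    (finrank_jordanFiltration_le (K := K) (le_wt n)).1
  have hle : (poissonFiltration K (n / 3)).map (LinearMap.inl K (Ser K) (Ser K)) ≤
      jordanFiltration K n := by
    rintro _ ⟨f, hf, rfl⟩
    exact jordanFiltration_mono (by omega) (inl_mem_jordanFiltration h2 hf)
  have h3 := Submodule.finrank_mono hle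
  rw [← (Submodule.equivMapOfInjective (LinearMap.inl K (Ser K) (Ser K)) LinearMap.inl_injective
    _).finrank_eq] at h3
  omega

theorem iSup_jordanFiltration (h2 : (2 : K) ≠ 0) : iSup (jordanFiltration K) = jordanAlg K := by
  have hmem : ∀ f, f ∈ poissonAlg K → ∃ n, f ∈ poissonFiltration K n := by
    intro f hf
    rw [← iSup_poissonFiltration] at hf
    exact (Submodule.mem_iSup_of_directed _ poissonFiltration_mono.directed_le).1 hf
  refine le_antisymm (iSup_le fun n => (jordanFiltration_le_prod n).trans
    (Submodule.prod_mono (poissonFiltration_le n) (poissonFiltration_le n))) ?_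
  rintro ⟨f, g⟩ ⟨hf, hg⟩
  obtain ⟨m, hm⟩ := hmem f hf
  obtain ⟨n, hn⟩ := hmem g hg
  have h := add_mem (Submodule.mem_iSup_of_mem _ (inl_mem_jordanFiltration h2 hm))
    (Submodule.mem_iSup_of_mem _ (bar_mem (inl_mem_jordanFiltration h2 hn)))
  rwa [Prod.mk_add_mk, add_zero, zero_add] at h

end Jordan

end FractalSuper

end

theorem mainTheorem9 {K : Type*} [Field K] (lam : ℝ) (hlam : lam ^ 3 - lam - 2 = 0) :
    (iSup (FractalSuper.poissonFiltration K) = FractalSuper.poissonAlg K ∧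
      FractalSuper.gkDim (FractalSuper.poissonFiltration K) = ((2 * Real.logb lam 2 : ℝ) : EReal) ∧
      FractalSuper.lowerGkDim (FractalSuper.poissonFiltration K) =
        ((2 * Real.logb lam 2 : ℝ) : EReal)) ∧
    (iSup (FractalSuper.hullFiltration K) = (FractalSuper.assocHull K).toSubmodule ∧
      FractalSuper.gkDim (FractalSuper.hullFiltration K) = ((2 * Real.logb lam 2 : ℝ) : EReal) ∧
      FractalSuper.lowerGkDim (FractalSuper.hullFiltration K) =
        ((2 * Real.logb lam 2 : ℝ) : EReal)) ∧
    ((2 : K) ≠ 0 →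
      iSup (FractalSuper.jordanFiltration K) = FractalSuper.jordanAlg K ∧
      FractalSuper.gkDim (FractalSuper.jordanFiltration K) = ((2 * Real.logb lam 2 : ℝ) : EReal) ∧
      FractalSuper.lowerGkDim (FractalSuper.jordanFiltration K) =
        ((2 * Real.logb lam 2 : ℝ) : EReal)) ∧
    |2 * Real.logb lam 2 - 3.3037| < 0.00005 := by
  open FractalSuper in
  refine ⟨⟨iSup_poissonFiltration, ?_⟩, ⟨iSup_hullFiltration, ?_⟩,
    fun h2 => ⟨iSup_jordanFiltration h2, ?_⟩, abs_logb_sub_lt hlam⟩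
  · exact gkDim_eq_of_bounds hlam (a := 4) (b := 8) (C := 2 * monCount 5) (by norm_num)
      (fun _ _ h => four_pow_le_finrank_poissonFiltration h)
      (fun _ _ h => (finrank_poissonFiltration_le h).2)
  · exact gkDim_eq_of_bounds hlam (a := 4) (b := 8) (C := 2 * monCount 5) (by norm_num)
      (fun _ _ h => four_pow_le_finrank_hullFiltration h)
      (fun _ _ h => finrank_hullFiltration_le h)
  · exact gkDim_eq_of_bounds hlam (a := 15) (b := 8) (C := 4 * monCount 5) (by norm_num)
      (fun _ _ h => four_pow_le_finrank_jordanFiltration h2 h)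
      (fun _ _ h => (finrank_jordanFiltration_le h).2)
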